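/- An instance $I=(V,D,\mathcal C)$ of CSP consists of a finite set $V$ of variables, a finite domain $D$ and a finite set $\mathcal C$ of constraints $(S,R)$, where the scope $S$ is a nonempty sequence of distinct variables and $R\subseteq D^{|S|}$ is given as a list of its tuples; every variable occurs in some scope and every domain value in some relation. The question is whether some $\tau:V\to D$ satisfies $\tau(S)\in R$ for all $(S,R)\in\mathcal C$. Put $n=|V|$, $\mathrm{dom}(I)=|D|$, let $\mathrm{arity}(I)$ be the maximum length of a scope, and let $|I|$ be the length of the input. A class of CSP instances is solvable in subexponential time if one algorithm decides all its instances in time $\mathrm{dom}(I)^{o(n)}\,|I|^{O(1)}$. Here $f(n)=o(n)$ is meant effectively: $f:\mathbb N\to\mathbb N$ is computable and there are a computable, nondecreasing, unbounded $\mu:\mathbb N\to\mathbb N$ and an $n_0$ with $f(n)\le n/\mu(n)$ for all $n\ge n_0$. Running times are those of Turing machines, or of any model equivalent to them up to a polynomial. The Exponential Time Hypothesis (ETH) states that for every $k\ge 3$ the problem $k$-CNF-Sat (satisfiability of a CNF formula, i.e. a finite set of clauses, each with at most $k$ literals) cannot be solved in time $2^{o(n)}$, where $n$ is the number of variables and $o(n)$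 is again effective; the size of such a formula is polynomial in $n$, so a factor polynomial in the size makes no difference. **Theorem.** Assume the ETH. Then for all integers $a\ge 2$ and $d\ge 3$, CSP restricted to the instances $I$ with $\mathrm{arity}(I)=a$ and $\mathrm{dom}(I)=d$ is not solvable in subexponential time. In particular CSP with arity $2$ and domain size $3$ is not solvable in subexponential time. -/

import Mathlib

namespace SubexpCSP

/-! ## Algorithms and their running time

The machine model is the imperative language WHILE over binary trees (pure LISP data, as in
N. D. Jones, "Computability and Complexity from a Programming Perspective").  Every elementary
operation (reading a variable, `nil`, `cons`, `hd`, `tl`, an assignment, a test for `nil`) costs one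
unit.  With trees stored as pointers to shared cells each of these is a constant number of pointer
operations creating at most one cell, so running times agree, up to a polynomial in the running
time and the input length, with running times of Turing machines. -/

/-- The data: binary trees. -/
inductive Data : Type
  | nil : Data
  | cons : Data → Data → Data

/-- The size of a tree: its number of nodes, leaves included (the tree is written out in full,
without sharing). -/
def Data.size : Data → ℕ
  | .nil => 1
  | .cons a b => a.size + b.size + 1

/-- Head of a tree (`nil` for `nil`). -/
def Data.hd : Data → Data
  | .nil => .nil
  | .cons a _ => a

/-- Tail of a tree (`nil` for `nil`). -/
def Data.tl : Data → Data
  | .nil => .nil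
  | .cons _ b => b

/-- A store gives every program variable its value.  (A program mentions finitely many.) -/
abbrev Store : Type := ℕ → Data

/-- Expressions. -/
inductive Exp : Type
  | var : ℕ → Exp
  | nil : Exp
  | cons : Exp → Exp → Exp
  | hd : Exp → Exp
  | tl : Exp → Exp

/-- Value of an expression in a store. -/
def Exp.eval (s : Store) : Exp → Data
  | .var x => s x
  | .nil => .nil
  | .cons e e' => .cons (e.eval s) (e'.eval s)
  | .hd e => (e.eval s).hd
  | .tl e => (e.eval s).tl

/-- Cost of evaluating an expression: its number of operations. -/
def Exp.cost : Exp → ℕ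
  | .var _ => 1
  | .nil => 1
  | .cons e e' => e.cost + e'.cost + 1
  | .hd e => e.cost + 1
  | .tl e => e.cost + 1

/-- Programs: `x := e`, sequencing, `if e then p else q`, `while e do p`; a test succeeds when the
value of `e` is not `nil`. -/
inductive Prog : Type
  | assign : ℕ → Exp → Prog
  | seq : Prog → Prog → Prog
  | cond : Exp → Prog → Prog → Prog
  | loop : Exp → Prog → Prog

/-- `Runs p s s' t`: started in the store `s`, the program `p` halts in the store `s'` after
exactly `t` steps. -/
inductive Runs : Prog → Store → Store → ℕ → Prop
  | assign (x : ℕ) (e : Exp) (s : Store) :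
      Runs (.assign x e) s (Function.update s x (e.eval s)) (e.cost + 1)
  | seq {p q : Prog} {s s' s'' : Store} {t t' : ℕ} :
      Runs p s s' t → Runs q s' s'' t' → Runs (.seq p q) s s'' (t + t')
  | cond_true {e : Exp} {p q : Prog} {s s' : Store} {t : ℕ} :
      e.eval s ≠ .nil → Runs p s s' t → Runs (.cond e p q) s s' (e.cost + 1 + t)
  | cond_false {e : Exp} {p q : Prog} {s s' : Store} {t : ℕ} :
      e.eval s = .nil → Runs q s s' t → Runs (.cond e p q) s s' (e.cost + 1 + t)
  | loop_done {e : Exp} {p : Prog} {s : Store} :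
      e.eval s = .nil → Runs (.loop e p) s s (e.cost + 1)
  | loop_step {e : Exp} {p : Prog} {s s' s'' : Store} {t t' : ℕ} :
      e.eval s ≠ .nil → Runs p s s' t → Runs (.loop e p) s' s'' t' →
      Runs (.loop e p) s s'' (e.cost + 1 + t + t')

/-- The initial store: the input is in variable `0`, every other variable is `nil`. -/
def initStore (input : Data) : Store := fun x => if x = 0 then input else .nil

/-- On the given input, `p` halts after exactly `t` steps with the given output, which is read
from variable `0`. -/
def Prog.Outputs (p : Prog) (input output : Data) (t : ℕ) : Prop :=
  ∃ s : Store, Runs p (initStore input) s t ∧ s 0 = output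

/-! ## Subexponential time -/

/-- Effective little-o: `f` and `g` are computable and `f n ≤ g n / μ n` for all large `n`, for some
computable, nondecreasing, unbounded `μ : ℕ → ℕ` (written without division). -/
def IsLittleOEff (f g : ℕ → ℕ) : Prop :=
  Computable f ∧ Computable g ∧
    ∃ μ : ℕ → ℕ, Computable μ ∧ Monotone μ ∧ (∀ b, ∃ n, b ≤ μ n) ∧
      ∃ n₀, ∀ n ≥ n₀, f n * μ n ≤ g n

/-- The problem "given an instance `I` with `P I`, decide whether `Yes I`" is solvable in (uniform)
subexponential time, that is in time `dom ^ o(n) * |I| ^ O(1)`: one program decides it, accepting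
by an output other than `nil`.  Here `code I` is the input representing `I`, `|I|` is the size of
this input, `n = vars I` and `dom = dom I`. -/
def SolvableInSubexpTime {ι : Type} (P Yes : ι → Prop) (code : ι → Data) (vars dom : ι → ℕ) :
    Prop :=
  ∃ (p : Prog) (f : ℕ → ℕ) (c : ℕ), IsLittleOEff f (fun n => n) ∧
    ∀ I, P I → ∃ (out : Data) (t : ℕ), p.Outputs (code I) out t ∧ (out ≠ .nil ↔ Yes I) ∧
      t ≤ c * dom I ^ f (vars I) * (code I).size ^ c

/-! ## Representing inputs -/

/-- Lists as trees. -/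
def codeList {α : Type} (code : α → Data) : List α → Data
  | [] => .nil
  | a :: l => .cons (code a) (codeList code l)

/-- Numbers in unary.  They only serve as numbers of, and as indices for, variables and values, so
binary notation would give the same notion of subexponential time. -/
def codeNat : ℕ → Data
  | 0 => .nil
  | n + 1 => .cons .nil (codeNat n)

/-- Truth values as trees. -/
def codeBool : Bool → Data
  | false => .nil
  | true => .cons .nil .nil

/-! ## CNF-Sat and the Exponential Time Hypothesis -/

/-- A CNF formula: a finite set of clauses over the variables `0, …, vars - 1`.  A clause is a list
of literals, and a literal `(x, b)` is true under an assignment `τ` when `τ x = b`. -/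
structure CNF where
  vars : ℕ
  clauses : List (List (Fin vars × Bool))
  nodup : clauses.Nodup

/-- Every clause contains at most `k` literals. -/
def CNF.WidthLE (k : ℕ) (F : CNF) : Prop := ∀ C ∈ F.clauses, C.length ≤ k

/-- Some assignment makes a literal of every clause true. -/
def CNF.Satisfiable (F : CNF) : Prop :=
  ∃ τ : Fin F.vars → Bool, ∀ C ∈ F.clauses, ∃ l ∈ C, τ l.1 = l.2

/-- The input representing a CNF formula: the number of variables and the list of clauses. -/
def CNF.code (F : CNF) : Data :=
  .cons (codeNat F.vars)
    (codeList (codeList fun l : Fin F.vars × Bool => .cons (codeNat l.1.val) (codeBool l.2))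
      F.clauses)

/-- The Exponential Time Hypothesis: for every `k ≥ 3`, `k`-CNF-Sat is not solvable in time
`2 ^ o(n)`, where `n` is the number of variables.  (The size of a `k`-CNF formula, a set of clauses
of width at most `k`, is polynomial in `n`, so a factor `|F| ^ O(1)` makes no difference.) -/
def ETH : Prop :=
  ∀ k ≥ 3, ¬ SolvableInSubexpTime (CNF.WidthLE k) CNF.Satisfiable CNF.code CNF.vars (fun _ => 2)

/-! ## The constraint satisfaction problem -/

/-- A constraint over the variables `0, …, n - 1` and the values `0, …, d - 1`: its scope, a
nonempty sequence of distinct variables, and its relation, a set of tuples of the same length,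
given by listing the allowed tuples. -/
structure Constraint (n d : ℕ) where
  scope : List (Fin n)
  scope_ne_nil : scope ≠ []
  scope_nodup : scope.Nodup
  rel : List (List (Fin d))
  rel_nodup : rel.Nodup
  length_eq : ∀ t ∈ rel, t.length = scope.length

/-- Two constraints are the same pair (sequence of variables, set of tuples). -/
def Constraint.Same {n d : ℕ} (C C' : Constraint n d) : Prop :=
  C.scope = C'.scope ∧ ∀ t, t ∈ C.rel ↔ t ∈ C'.rel

/-- The tuple of values of the scope belongs to the relation. -/
def Constraint.SatisfiedBy {n d : ℕ} (C : Constraint n d) (τ : Fin n → Fin d) : Prop :=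
  C.scope.map τ ∈ C.rel

/-- The input representing a constraint: its scope and the list of its tuples. -/
def Constraint.code {n d : ℕ} (C : Constraint n d) : Data :=
  .cons (codeList (fun x : Fin n => codeNat x.val) C.scope)
    (codeList (codeList fun v : Fin d => codeNat v.val) C.rel)

/-- A CSP instance: the variables are `0, …, vars - 1`, the domain values `0, …, dom - 1`, the
constraints a finite set (a list without repetition).  Every variable occurs in some scope and
every domain value in some relation. -/
structure CSP where
  vars : ℕ
  dom : ℕ
  constraints : List (Constraint vars dom)
  distinct : constraints.Pairwise fun C C' => ¬ C.Same C'
  var_occurs : ∀ x : Fin vars, ∃ C ∈ constraints, x ∈ C.scope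
  val_occurs : ∀ v : Fin dom, ∃ C ∈ constraints, ∃ t ∈ C.rel, v ∈ t

/-- The arity of an instance: the maximum length of a constraint scope. -/
def CSP.arity (I : CSP) : ℕ := (I.constraints.map fun C => C.scope.length).foldr max 0

/-- Some assignment satisfies all constraints. -/
def CSP.Satisfiable (I : CSP) : Prop :=
  ∃ τ : Fin I.vars → Fin I.dom, ∀ C ∈ I.constraints, C.SatisfiedBy τ

/-- The input representing an instance: number of variables, number of values, constraints. -/
def CSP.code (I : CSP) : Data :=
  .cons (codeNat I.vars) (.cons (codeNat I.dom) (codeList Constraint.code I.constraints))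

/-- CSP restricted to the instances with property `P` is solvable in subexponential time
`dom ^ o(n) * |I| ^ O(1)`. -/
def CSPSolvableInSubexpTime (P : CSP → Prop) : Prop :=
  SolvableInSubexpTime P CSP.Satisfiable CSP.code CSP.vars CSP.dom

end SubexpCSP

namespace SubexpCSP

/-! ## Programs: locality and Hoare triples -/

/-! Suppose that the CSP instances of arity `a` and domain size `d` are solved in time `d ^ f N` up
to a polynomial factor, where `N` is the number of variables and `f N * μ N ≤ N` for large `N`. The
aim is to solve 3-CNF-Sat in time `2 ^ o(n)`, contradicting the ETH for `k = 3`.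

A formula with `n` variables and `m` clauses becomes an instance with `a + n + m` variables: each
clause gets a variable with values 0, 1, 2 that chooses a true literal, enforced by binary
constraints, and one constraint on `a` extra variables makes arity and domain size exact
(`formulaConstraints_valid`, `formulaConstraints_sat_iff`). Since `m` can be cubic in `n`, the
formula must be sparsified first.

Sparsification is a branching with a parameter `s`. A branch records literals required to be true
and added clauses with two literals. A literal in `s` such clauses, a pair of literals in `s`
clauses with three literals, or a literal in `s * s` of them allows a case distinction: either the
common part is true, or all the remainders are. With the rules tried in this order every literal
keeps at most `2 * s` active partners. Hence the measure `5 * s * (literals) + (active pairs)` is at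
most `14 * s * n`, while it grows by at least 1 on the first side and by at least `s * s` on the
second (`Branch.Good.isBranching`). For `s = q ^ 2` the tree has `2 ^ O(n / q + 1)` nodes
(`nodes_le`), and a leaf has `O(n * q ^ 4)` clauses. If `q ^ 5 = O(μ n)`, then solving a leaf costs
`2 ^ O(n / q + 1)` up to a polynomial factor (`leaf_exponent_le`). As `q` may grow without bound,
the total is `2 ^ o(n)`.

The good `q` depends on `μ`, which is computable but without any bound on the time. So it is never
computed: the final program dovetails over all parameters and time bounds with a clocked version of
the algorithm. An answer is correct for every parameter, so the first one found is returned, and the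
cost is about the cube of the time for the best parameter (`does_searchProg`). The remaining work is
to show in the WHILE model that every single step of the branching is polynomial, and to run through
the tree with a stack (`does_explore`, `exists_algorithm`). -/

/-- All variables of an expression are below this number. -/
def Exp.bound : Exp → ℕ
  | .var x => x + 1
  | .nil => 0
  | .cons e e' => max e.bound e'.bound
  | .hd e => e.bound
  | .tl e => e.bound

/-- All variables of a program are below this number. -/
def Prog.bound : Prog → ℕ
  | .assign x e => max (x + 1) e.bound
  | .seq p q => max p.bound q.bound
  | .cond e p q => max e.bound (max p.bound q.bound)
  | .loop e p => max e.bound p.bound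

/-- Two stores agree on the variables below `b`. -/
def Agree (b : ℕ) (s r : Store) : Prop := ∀ v < b, s v = r v

lemma Exp.eval_agree {b : ℕ} {s r : Store} (h : Agree b s r) :
    ∀ {e : Exp}, e.bound ≤ b → e.eval s = e.eval r
  | .var x, he => h x (by simp only [Exp.bound] at he; omega)
  | .nil, _ => rfl
  | .cons e e', he => by
      simp only [Exp.bound, max_le_iff] at he
      simp only [Exp.eval, Exp.eval_agree h he.1, Exp.eval_agree h he.2]
  | .hd e, he => by
      simp only [Exp.bound] at he
      simp only [Exp.eval, Exp.eval_agree h he]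
  | .tl e, he => by
      simp only [Exp.bound] at he
      simp only [Exp.eval, Exp.eval_agree h he]

lemma Agree.update {b : ℕ} {s r : Store} (h : Agree b s r) (x : ℕ) (a : Data) :
    Agree b (Function.update s x a) (Function.update r x a) := by
  intro v hv
  by_cases hx : v = x
  · subst hx; simp
  · simp [hx, h v hv]

lemma Runs.frame {p : Prog} {s s' : Store} {t : ℕ} (h : Runs p s s' t) :
    ∀ v ≥ p.bound, s' v = s v := by
  induction h with
  | assign x e s =>
    intro v hv
    simp only [Prog.bound, ge_iff_le, max_le_iff] at hv
    exact Function.update_of_ne (by omega) _ _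
  | seq _ _ ih₁ ih₂ =>
    intro v hv
    simp only [Prog.bound, ge_iff_le, max_le_iff] at hv
    rw [ih₂ v hv.2, ih₁ v hv.1]
  | cond_true _ _ ih =>
    intro v hv
    simp only [Prog.bound, ge_iff_le, max_le_iff] at hv
    exact ih v hv.2.1
  | cond_false _ _ ih =>
    intro v hv
    simp only [Prog.bound, ge_iff_le, max_le_iff] at hv
    exact ih v hv.2.2
  | loop_done _ => intro v _; rfl
  | loop_step _ _ _ ih₁ ih₂ =>
    intro v hv
    rw [ih₂ v hv]
    simp only [Prog.bound, ge_iff_le, max_le_iff] at hv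
    exact ih₁ v hv.2

lemma Runs.agree {p : Prog} {s s' : Store} {t : ℕ} (h : Runs p s s' t) :
    ∀ {b : ℕ}, p.bound ≤ b → ∀ {r : Store}, Agree b s r → ∃ r', Runs p r r' t ∧ Agree b s' r' := by
  induction h with
  | assign x e s =>
    intro b hb r hr
    simp only [Prog.bound, max_le_iff] at hb
    refine ⟨_, .assign x e r, ?_⟩
    rw [Exp.eval_agree hr hb.2]
    exact hr.update _ _
  | seq _ _ ih₁ ih₂ =>
    intro b hb r hr
    simp only [Prog.bound, max_le_iff] at hb
    obtain ⟨r₁, h₁, hr₁⟩ := ih₁ hb.1 hr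
    obtain ⟨r₂, h₂, hr₂⟩ := ih₂ hb.2 hr₁
    exact ⟨r₂, h₁.seq h₂, hr₂⟩
  | cond_true he _ ih =>
    intro b hb r hr
    simp only [Prog.bound, max_le_iff] at hb
    obtain ⟨r₁, h₁, hr₁⟩ := ih hb.2.1 hr
    exact ⟨r₁, .cond_true (by rwa [← Exp.eval_agree hr hb.1]) h₁, hr₁⟩
  | cond_false he _ ih =>
    intro b hb r hr
    simp only [Prog.bound, max_le_iff] at hb
    obtain ⟨r₁, h₁, hr₁⟩ := ih hb.2.2 hr
    exact ⟨r₁, .cond_false (by rwa [← Exp.eval_agree hr hb.1]) h₁, hr₁⟩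
  | loop_done he =>
    intro b hb r hr
    simp only [Prog.bound, max_le_iff] at hb
    exact ⟨r, .loop_done (by rwa [← Exp.eval_agree hr hb.1]), hr⟩
  | loop_step he _ _ ih₁ ih₂ =>
    intro b hb r hr
    have hb' := hb
    simp only [Prog.bound, max_le_iff] at hb
    obtain ⟨r₁, h₁, hr₁⟩ := ih₁ hb.2 hr
    obtain ⟨r₂, h₂, hr₂⟩ := ih₂ hb' hr₁
    exact ⟨r₂, .loop_step (by rwa [← Exp.eval_agree hr hb.1]) h₁ h₂, hr₂⟩

/-- Started in any store with `x` in variable `0`, the program `p` halts within `t` steps with a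
value satisfying `Q` in variable `0`, and keeps all variables from `b` on. -/
def Does (p : Prog) (b : ℕ) (x : Data) (Q : Data → Prop) (t : ℕ) : Prop :=
  ∀ s : Store, s 0 = x → ∃ s' t', t' ≤ t ∧ Runs p s s' t' ∧ Q (s' 0) ∧ ∀ v ≥ b, s' v = s v

lemma Does.mono {p : Prog} {b b' : ℕ} {x : Data} {Q Q' : Data → Prop} {t t' : ℕ}
    (h : Does p b x Q t) (hb : b ≤ b') (hQ : ∀ y, Q y → Q' y) (ht : t ≤ t') :
    Does p b' x Q' t' := by
  intro s hs
  obtain ⟨s', u, hu, hr, hq, hf⟩ := h s hs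
  exact ⟨s', u, hu.trans ht, hr, hQ _ hq, fun v hv => hf v (hb.trans hv)⟩

lemma Does.seq {p q : Prog} {b : ℕ} {x : Data} {Q R : Data → Prop} {t u : ℕ}
    (hp : Does p b x Q t) (hq : ∀ y, Q y → Does q b y R u) :
    Does (.seq p q) b x R (t + u) := by
  intro s hs
  obtain ⟨s₁, t₁, ht₁, h₁, hQ₁, hf₁⟩ := hp s hs
  obtain ⟨s₂, t₂, ht₂, h₂, hQ₂, hf₂⟩ := hq _ hQ₁ s₁ rfl
  exact ⟨s₂, _, Nat.add_le_add ht₁ ht₂, h₁.seq h₂, hQ₂,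
    fun v hv => (hf₂ v hv).trans (hf₁ v hv)⟩

/-- Since `e` mentions variable 0 only, its value can be read off in any store with the right entry
there; later this store is a `constStore`. -/
lemma Does.assign {e : Exp} (he : e.bound ≤ 1) (s₀ : Store) :
    Does (.assign 0 e) 1 (s₀ 0) (· = e.eval s₀) (e.cost + 1) := by
  intro s hs
  refine ⟨_, _, le_rfl, .assign 0 e s, ?_, ?_⟩
  · simp only [Function.update_self]
    exact Exp.eval_agree (b := 1) (fun v hv => by rw [Nat.lt_one_iff.1 hv, hs]) he
  · intro v hv
    exact Function.update_of_ne (by omega) _ _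

/-- Runs `p` and `q` on the same input and pairs the results. -/
def pairProg (b : ℕ) (p q : Prog) : Prog :=
  .seq (.assign b (.var 0)) (.seq p (.seq (.assign (b + 1) (.var 0)) (.seq (.assign 0 (.var b))
    (.seq q (.assign 0 (.cons (.var (b + 1)) (.var 0)))))))

/-- The input survives the run of `p` in variable `b`, and the first result survives the run of `q`
in `b + 1`, because both programs keep all variables from `b` on. This is the purpose of the frame
condition in `Does`. -/
lemma Does.pair {p q : Prog} {b : ℕ} {x : Data} {Q R : Data → Prop} {t u : ℕ} (hb : 0 < b)
    (hp : Does p b x Q t) (hq : Does q b x R u) :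
    Does (pairProg b p q) (b + 2) x (fun y => ∃ y₁ y₂, y = .cons y₁ y₂ ∧ Q y₁ ∧ R y₂)
      (t + u + 10) := by
  intro s hs
  obtain ⟨s₁, t₁, ht₁, h₁, hQ₁, hf₁⟩ := hp (Function.update s b x) (by
    rw [Function.update_of_ne (by omega), hs])
  obtain ⟨s₂, t₂, ht₂, h₂, hQ₂, hf₂⟩ :=
    hq (Function.update (Function.update s₁ (b + 1) (s₁ 0)) 0 x) (by simp)
  have e₁ : s₁ b = x := by rw [hf₁ b le_rfl]; simp
  have a₁ := Runs.assign b (.var 0) s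
  have a₂ := Runs.assign (b + 1) (.var 0) s₁
  have a₃ := Runs.assign 0 (.var b) (Function.update s₁ (b + 1) (s₁ 0))
  have a₄ := Runs.assign 0 (.cons (.var (b + 1)) (.var 0)) s₂
  simp only [Exp.eval, Exp.cost] at a₁ a₂ a₃ a₄
  rw [Function.update_of_ne (by omega), e₁] at a₃
  rw [hs] at a₁
  refine ⟨_, _, ?_, a₁.seq (h₁.seq (a₂.seq (a₃.seq (h₂.seq a₄)))), ?_, ?_⟩
  · omega
  · refine ⟨_, _, ?_, hQ₁, hQ₂⟩
    rw [Function.update_self, hf₂ (b + 1) (by omega), Function.update_of_ne (by omega),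
      Function.update_self]
  · intro v hv
    rw [Function.update_of_ne (by omega), hf₂ v (by omega), Function.update_of_ne (by omega),
      Function.update_of_ne (by omega), hf₁ v (by omega), Function.update_of_ne (by omega)]

/-- Tests with `c` and continues with `p` or `q` on the original input. -/
def iteProg (b : ℕ) (c p q : Prog) : Prog :=
  .seq (.assign b (.var 0)) (.seq c (.cond (.var 0)
    (.seq (.assign 0 (.var b)) p) (.seq (.assign 0 (.var b)) q)))

lemma Does.ite {c p q : Prog} {b : ℕ} {x : Data} {C Q : Data → Prop} {t u : ℕ} (hb : 0 < b)
    (hc : Does c b x C t) (hp : ∀ y, C y → y ≠ .nil → Does p b x Q u)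
    (hq : C .nil → Does q b x Q u) :
    Does (iteProg b c p q) (b + 1) x Q (t + u + 6) := by
  intro s hs
  obtain ⟨s₁, t₁, ht₁, h₁, hQ₁, hf₁⟩ := hc (Function.update s b x) (by
    rw [Function.update_of_ne (by omega), hs])
  have e₁ : s₁ b = x := by rw [hf₁ b le_rfl]; simp
  have a₁ := Runs.assign b (.var 0) s
  have a₂ := Runs.assign 0 (.var b) s₁
  simp only [Exp.eval, Exp.cost] at a₁ a₂
  rw [e₁] at a₂
  rw [hs] at a₁
  by_cases hn : s₁ 0 = .nil
  · obtain ⟨s₂, t₂, ht₂, h₂, hQ₂, hf₂⟩ := hq (hn ▸ hQ₁) (Function.update s₁ 0 x) (by simp)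
    refine ⟨_, _, ?_, a₁.seq (h₁.seq (.cond_false hn (a₂.seq h₂))), hQ₂, ?_⟩
    · simp only [Exp.cost]; omega
    · intro v hv
      rw [hf₂ v (by omega), Function.update_of_ne (by omega), hf₁ v (by omega),
        Function.update_of_ne (by omega)]
  · obtain ⟨s₂, t₂, ht₂, h₂, hQ₂, hf₂⟩ := hp _ hQ₁ hn (Function.update s₁ 0 x) (by simp)
    refine ⟨_, _, ?_, a₁.seq (h₁.seq (.cond_true hn (a₂.seq h₂))), hQ₂, ?_⟩
    · simp only [Exp.cost]; omega
    · intro v hv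
      rw [hf₂ v (by omega), Function.update_of_ne (by omega), hf₁ v (by omega),
        Function.update_of_ne (by omega)]

lemma Does.loop_done {e : Exp} {p : Prog} {b : ℕ} {Q : Data → Prop} (he : e.bound ≤ 1)
    {s₀ : Store} (hs : e.eval s₀ = .nil) (hQ : Q (s₀ 0)) :
    Does (.loop e p) b (s₀ 0) Q (e.cost + 1) := by
  intro s hs'
  have : e.eval s = e.eval s₀ :=
    Exp.eval_agree (b := 1) (fun v hv => by rw [Nat.lt_one_iff.1 hv, hs']) he
  exact ⟨s, _, le_rfl, .loop_done (by rw [this, hs]), hs' ▸ hQ, fun _ _ => rfl⟩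

lemma Does.loop_step {e : Exp} {p : Prog} {b : ℕ} {Q R : Data → Prop} {t u : ℕ}
    (he : e.bound ≤ 1) {s₀ : Store} (hs : e.eval s₀ ≠ .nil) (hp : Does p b (s₀ 0) R t)
    (hl : ∀ y, R y → Does (.loop e p) b y Q u) :
    Does (.loop e p) b (s₀ 0) Q (e.cost + 1 + t + u) := by
  intro s hs'
  have : e.eval s = e.eval s₀ :=
    Exp.eval_agree (b := 1) (fun v hv => by rw [Nat.lt_one_iff.1 hv, hs']) he
  obtain ⟨s₁, t₁, ht₁, h₁, hQ₁, hf₁⟩ := hp s hs'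
  obtain ⟨s₂, t₂, ht₂, h₂, hQ₂, hf₂⟩ := hl _ hQ₁ s₁ rfl
  exact ⟨s₂, _, by omega, .loop_step (by rwa [this]) h₁ h₂, hQ₂,
    fun v hv => (hf₂ v hv).trans (hf₁ v hv)⟩

lemma Does.outputs {p : Prog} {b : ℕ} {x : Data} {Q : Data → Prop} {t : ℕ}
    (h : Does p b x Q t) : ∃ y t', p.Outputs x y t' ∧ Q y ∧ t' ≤ t := by
  obtain ⟨s', t', ht, hr, hQ, -⟩ := h (initStore x) rfl
  exact ⟨_, t', ⟨s', hr, rfl⟩, hQ, ht⟩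

/-- Sets the variables `1, …, n` to `nil`. -/
def clearVars : ℕ → Prog
  | 0 => .assign 0 (.var 0)
  | n + 1 => .seq (clearVars n) (.assign (n + 1) .nil)

lemma runs_clearVars (s : Store) : ∀ n, ∃ s', Runs (clearVars n) s s' (2 * (n + 1)) ∧
    ∀ v, s' v = if 1 ≤ v ∧ v ≤ n then .nil else s v
  | 0 => ⟨_, .assign 0 (.var 0) s, fun v => by
      rw [if_neg (by omega)]
      by_cases h : v = 0
      · subst h; simp [Exp.eval]
      · simp [h]⟩
  | n + 1 => by
      obtain ⟨s', h, h'⟩ := runs_clearVars s n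
      refine ⟨_, h.seq (.assign (n + 1) .nil s'), fun v => ?_⟩
      by_cases hv : v = n + 1
      · subst hv; simp [Exp.eval]
      · rw [Function.update_of_ne hv, h' v]
        congr 1
        apply propext
        omega

/-- A program made independent of the initial values of the variables other than `0`. -/
def fresh (p : Prog) : Prog := .seq (clearVars p.bound) p

/-- `Outputs` speaks of the initial store only. After clearing, the store agrees with the initial
one on all variables that `p` mentions, so `Runs.agree` transfers the run and `p` becomes usable as
a subroutine. -/
lemma Does.of_outputs {p : Prog} {x y : Data} {t : ℕ} (h : p.Outputs x y t) :
    Does (fresh p) (p.bound + 1) x (· = y) (2 * (p.bound + 1) + t) := by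
  intro s hs
  obtain ⟨s₁, h₁, e₁⟩ := runs_clearVars s p.bound
  obtain ⟨s₂, h₂, e₂⟩ := h
  obtain ⟨s₃, h₃, e₃⟩ := h₂.agree (b := p.bound + 1) (by omega) (r := s₁) (by
    intro v hv
    rw [e₁ v, initStore]
    by_cases h0 : v = 0
    · subst h0; simp [hs]
    · rw [if_neg h0, if_pos (by omega)])
  refine ⟨s₃, _, le_rfl, h₁.seq h₃, ?_, ?_⟩
  · rw [← e₂, e₃ 0 (by omega)]
  · intro v hv
    rw [h₃.frame v (by omega), e₁ v, if_neg (by omega)]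

/-! ## Clocked programs -/

/-- The program `p` with a counter in the variable `k`, decreased by one in every iteration of a
loop; all loops are left when it is exhausted.  The variable `k + 1` is used for tests. -/
def clocked (k : ℕ) : Prog → Prog
  | .assign x e => .assign x e
  | .seq p q => .seq (clocked k p) (clocked k q)
  | .cond e p q => .cond e (clocked k p) (clocked k q)
  | .loop e p =>
    .seq (.cond (.var k) (.assign (k + 1) e) (.assign (k + 1) .nil))
      (.loop (.var (k + 1)) (.seq (.assign k (.tl (.var k))) (.seq (clocked k p)
        (.cond (.var k) (.assign (k + 1) e) (.assign (k + 1) .nil)))))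

/-- The factor in the running time of a clocked program. -/
def clockedFactor : Prog → ℕ
  | .assign _ e => e.cost + 1
  | .seq p q => clockedFactor p + clockedFactor q
  | .cond e p q => e.cost + 1 + clockedFactor p + clockedFactor q
  | .loop e p => clockedFactor p + 2 * e.cost + 20

/-- With an empty counter every guard sets the loop flag to `nil`, so no loop body is entered and
the time depends on the program alone. No run of `p` is needed, which matters because the store left
by an interrupted loop is arbitrary. -/
lemma clocked_exhausted {k : ℕ} : ∀ {p : Prog}, p.bound ≤ k → ∀ s : Store, s k = .nil →
    ∃ s' t, Runs (clocked k p) s s' t ∧ t ≤ clockedFactor p ∧ s' k = .nil ∧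
      ∀ v ≥ k + 2, s' v = s v
  | .assign x e, hp, s, hs => by
      simp only [Prog.bound, max_le_iff] at hp
      refine ⟨_, _, .assign x e s, le_rfl, ?_, fun v hv => ?_⟩
      · rw [Function.update_of_ne (by omega), hs]
      · rw [Function.update_of_ne (by omega)]
  | .seq p q, hp, s, hs => by
      simp only [Prog.bound, max_le_iff] at hp
      obtain ⟨s₁, t₁, h₁, ht₁, e₁, f₁⟩ := clocked_exhausted hp.1 s hs
      obtain ⟨s₂, t₂, h₂, ht₂, e₂, f₂⟩ := clocked_exhausted hp.2 s₁ e₁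
      exact ⟨s₂, _, h₁.seq h₂, Nat.add_le_add ht₁ ht₂, e₂,
        fun v hv => (f₂ v hv).trans (f₁ v hv)⟩
  | .cond e p q, hp, s, hs => by
      simp only [Prog.bound, max_le_iff] at hp
      by_cases he : e.eval s = .nil
      · obtain ⟨s₁, t₁, h₁, ht₁, e₁, f₁⟩ := clocked_exhausted hp.2.2 s hs
        exact ⟨s₁, _, .cond_false he h₁, by simp only [clockedFactor]; omega, e₁, f₁⟩
      · obtain ⟨s₁, t₁, h₁, ht₁, e₁, f₁⟩ := clocked_exhausted hp.2.1 s hs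
        exact ⟨s₁, _, .cond_true he h₁, by simp only [clockedFactor]; omega, e₁, f₁⟩
  | .loop e p, hp, s, hs => by
      have a := Runs.assign (k + 1) .nil s
      refine ⟨_, _, Runs.seq (.cond_false (by simpa [Exp.eval] using hs) a)
        (.loop_done (by simp [Exp.eval])), ?_, ?_, fun v hv => ?_⟩
      · simp only [Exp.cost, clockedFactor]; omega
      · rw [Function.update_of_ne (by omega), hs]
      · rw [Function.update_of_ne (by omega)]

lemma codeNat_eq_nil {n : ℕ} : codeNat n = .nil ↔ n = 0 := by
  cases n <;> simp [codeNat]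

lemma codeNat_tl (n : ℕ) : (codeNat n).tl = codeNat (n - 1) := by
  cases n <;> simp [codeNat, Data.tl]

/-- The test of a clocked loop. -/
lemma runs_guard {k : ℕ} {e : Exp} (he : e.bound ≤ k) {s r : Store} {T : ℕ}
    (hr : r k = codeNat T) (h : 0 < T → Agree k s r) :
    ∃ r' t, Runs (.cond (.var k) (.assign (k + 1) e) (.assign (k + 1) .nil)) r r' t ∧
      t ≤ e.cost + 4 ∧ r' k = codeNat T ∧ (0 < T → Agree k s r' ∧ r' (k + 1) = e.eval s) ∧
      (T = 0 → r' (k + 1) = .nil) ∧ ∀ v ≥ k + 2, r' v = r v := by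
  by_cases hT : T = 0
  · subst hT
    refine ⟨_, _, .cond_false (by simp [Exp.eval, hr, codeNat]) (.assign (k + 1) .nil r), ?_, ?_,
      by simp, by simp [Exp.eval], fun v hv => ?_⟩
    · simp only [Exp.cost]; omega
    · rw [Function.update_of_ne (by omega), hr]
    · rw [Function.update_of_ne (by omega)]
  · refine ⟨_, _, .cond_true (by simp [Exp.eval, hr, codeNat_eq_nil, hT]) (.assign (k + 1) e r),
      ?_, ?_, fun _ => ⟨fun v hv => ?_, ?_⟩, by simp [hT], fun v hv => ?_⟩
    · simp only [Exp.cost]; omega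
    · rw [Function.update_of_ne (by omega), hr]
    · rw [Function.update_of_ne (by omega), h (by omega) v hv]
    · rw [Function.update_self, Exp.eval_agree (h (by omega)) he]
    · rw [Function.update_of_ne (by omega)]

/-- The clocked run of a program that reaches the store `s'` in `t` steps: it ends in a similar
store if the counter stays positive. -/
def Follows (k : ℕ) (q : Prog) (K : ℕ) (s' : Store) (t T : ℕ) (r : Store) : Prop :=
  ∃ r' t' T', Runs q r r' t' ∧ r' k = codeNat T' ∧ T' ≤ T ∧ t' ≤ K * (T - T' + 1) ∧
    (0 < T' → Agree k s' r') ∧ T ≤ T' + t ∧ ∀ v ≥ k + 2, r' v = r v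

lemma follows_zero {k : ℕ} {p : Prog} (hp : p.bound ≤ k) {r : Store} (hr : r k = codeNat 0)
    (s' : Store) (t : ℕ) : Follows k (clocked k p) (clockedFactor p) s' t 0 r := by
  obtain ⟨r', t', h, ht, e, f⟩ := clocked_exhausted hp r hr
  exact ⟨r', t', 0, h, e, le_rfl, by simpa using ht, by simp, by simp, f⟩

/-- Induction along the original run. Ticks pay for the time, `clockedFactor p` steps each, plus one
initial share; this holds even if the simulation is cut short. At most `t` ticks are spent because
each loop iteration of `p` takes at least one step. After exhaustion the stores may differ, so
agreement is claimed for a positive counter only. -/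
lemma Runs.follows {k : ℕ} {p : Prog} {s s' : Store} {t : ℕ} (h : Runs p s s' t) :
    p.bound ≤ k → ∀ {r : Store} {T : ℕ}, r k = codeNat T → (0 < T → Agree k s r) →
      Follows k (clocked k p) (clockedFactor p) s' t T r := by
  induction h with
  | assign x e s =>
    intro hp r T hr ha
    obtain rfl | hT := T.eq_zero_or_pos
    · exact follows_zero hp hr _ _
    simp only [Prog.bound, max_le_iff] at hp
    refine ⟨_, _, T, .assign x e r, ?_, le_rfl, by simp [clockedFactor], fun _ => ?_, by omega,
      fun v hv => ?_⟩
    · rw [Function.update_of_ne (by omega), hr]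
    · rw [Exp.eval_agree (ha hT) hp.2]
      exact (ha hT).update _ _
    · rw [Function.update_of_ne (by omega)]
  | @seq p q s s' s'' t t' _ _ ih₁ ih₂ =>
    intro hp r T hr ha
    simp only [Prog.bound, max_le_iff] at hp
    obtain ⟨r₁, t₁, T₁, h₁, e₁, l₁, b₁, a₁, c₁, f₁⟩ := ih₁ hp.1 hr ha
    obtain ⟨r₂, t₂, T₂, h₂, e₂, l₂, b₂, a₂, c₂, f₂⟩ := ih₂ hp.2 e₁ a₁
    refine ⟨r₂, _, T₂, h₁.seq h₂, e₂, l₂.trans l₁, ?_, a₂, by omega,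
      fun v hv => (f₂ v hv).trans (f₁ v hv)⟩
    have m₁ : clockedFactor p * (T - T₁ + 1) ≤ clockedFactor p * (T - T₂ + 1) :=
      Nat.mul_le_mul_left _ (by omega)
    have m₂ : clockedFactor q * (T₁ - T₂ + 1) ≤ clockedFactor q * (T - T₂ + 1) :=
      Nat.mul_le_mul_left _ (by omega)
    simp only [clockedFactor]
    rw [add_mul]
    omega
  | @cond_true e p q s s' t he _ ih =>
    intro hp r T hr ha
    obtain rfl | hT := T.eq_zero_or_pos
    · exact follows_zero hp hr _ _
    simp only [Prog.bound, max_le_iff] at hp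
    obtain ⟨r₁, t₁, T₁, h₁, e₁, l₁, b₁, a₁, c₁, f₁⟩ := ih hp.2.1 hr ha
    refine ⟨r₁, _, T₁, .cond_true (by rwa [← Exp.eval_agree (ha hT) hp.1]) h₁, e₁, l₁, ?_, a₁,
      by omega, f₁⟩
    have m₁ : e.cost + 1 ≤ (e.cost + 1) * (T - T₁ + 1) := Nat.le_mul_of_pos_right _ (by omega)
    simp only [clockedFactor]
    rw [add_mul, add_mul]
    omega
  | @cond_false e p q s s' t he _ ih =>
    intro hp r T hr ha
    obtain rfl | hT := T.eq_zero_or_pos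
    · exact follows_zero hp hr _ _
    simp only [Prog.bound, max_le_iff] at hp
    obtain ⟨r₁, t₁, T₁, h₁, e₁, l₁, b₁, a₁, c₁, f₁⟩ := ih hp.2.2 hr ha
    refine ⟨r₁, _, T₁, .cond_false (by rwa [← Exp.eval_agree (ha hT) hp.1]) h₁, e₁, l₁, ?_, a₁,
      by omega, f₁⟩
    have m₁ : e.cost + 1 ≤ (e.cost + 1) * (T - T₁ + 1) := Nat.le_mul_of_pos_right _ (by omega)
    simp only [clockedFactor]
    rw [add_mul, add_mul]
    omega
  | @loop_done e p s he =>
    intro hp r T hr ha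
    obtain rfl | hT := T.eq_zero_or_pos
    · exact follows_zero hp hr _ _
    simp only [Prog.bound, max_le_iff] at hp
    obtain ⟨r₁, t₁, h₁, b₁, e₁, a₁, -, f₁⟩ := runs_guard hp.1 hr ha
    refine ⟨r₁, _, T, h₁.seq (.loop_done ?_), e₁, le_rfl, ?_, fun _ => (a₁ hT).1, by omega, f₁⟩
    · simp only [Exp.eval]
      rw [(a₁ hT).2, he]
    · simp only [Exp.cost, clockedFactor, Nat.sub_self]; omega
  | @loop_step e p s s' s'' t t' he _ _ ih₁ ih₂ =>
    intro hp r T hr ha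
    obtain rfl | hT := T.eq_zero_or_pos
    · exact follows_zero hp hr _ _
    have hp' := hp
    simp only [Prog.bound, max_le_iff] at hp
    obtain ⟨r₁, t₁, h₁, b₁, e₁, a₁, -, f₁⟩ := runs_guard hp.1 hr ha
    have g := Runs.assign k (.tl (.var k)) r₁
    simp only [Exp.eval, Exp.cost] at g
    rw [e₁, codeNat_tl] at g
    obtain ⟨r₂, t₂, T₂, h₂, e₂, l₂, b₂, a₂, c₂, f₂⟩ := ih₁ hp.2
      (r := Function.update r₁ k (codeNat (T - 1))) (T := T - 1) (by simp) (fun _ v hv => by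
        rw [Function.update_of_ne (by omega)]; exact (a₁ hT).1 v hv)
    obtain ⟨r₃, t₃, T₃, h₃, e₃, l₃, b₃, a₃, c₃, f₃⟩ := ih₂ hp' e₂ a₂
    -- The clocked run of the remaining loop starts with its guard `g₁`. The same guard ends the
    -- body of a clocked loop, so it is moved there, and `g₂` continues the inner loop.
    cases h₃ with
    | @seq _ _ _ m _ u₁ u₂ g₁ g₂ =>
    refine ⟨r₃, _, T₃, h₁.seq (.loop_step ?_ (g.seq (h₂.seq g₁)) g₂), e₃, by omega, ?_, a₃,
      by omega, fun v hv => ?_⟩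
    · simp only [Exp.eval]
      rwa [(a₁ hT).2]
    -- The body spends `i` ticks and the remaining loop `j`; the tick of the present iteration pays
    -- for the guard and the decrement.
    · obtain ⟨i, rfl⟩ : ∃ i, T = T₂ + i + 1 := ⟨T - T₂ - 1, by omega⟩
      obtain ⟨j, rfl⟩ : ∃ j, T₂ = T₃ + j := ⟨T₂ - T₃, by omega⟩
      rw [show T₃ + j + i + 1 - 1 - (T₃ + j) + 1 = i + 1 by omega] at b₂
      rw [show T₃ + j - T₃ + 1 = j + 1 by omega] at b₃
      rw [show T₃ + j + i + 1 - T₃ + 1 = (i + 1) + (j + 1) by omega, mul_add]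
      have : clockedFactor p * (i + 1) + (2 * e.cost + 20) ≤
          clockedFactor (.loop e p) * (i + 1) := by
        have := Nat.le_mul_of_pos_right (2 * e.cost + 20) (Nat.succ_pos i)
        simp only [clockedFactor, add_mul, Nat.succ_eq_add_one] at this ⊢
        omega
      simp only [Exp.cost]
      omega
    · rw [f₃ v hv, f₂ v hv, Function.update_of_ne (by omega), f₁ v hv]

/-- The clocked version of `p` as a program on pairs (counter, input); the output is `nil` when
the counter is exhausted and the pair of `nil` and the output of `p` otherwise. -/
def clockedProg (p : Prog) : Prog :=
  .seq (.assign p.bound.succ (.hd (.var 0))) (.seq (.assign 0 (.tl (.var 0)))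
    (.seq (clocked p.bound.succ p) (.cond (.var p.bound.succ)
      (.assign 0 (.cons .nil (.var 0))) (.assign 0 .nil))))

/-- The time is bounded through `T` alone, without the unknown `t`. This allows trying parameters
for which `p` is far too slow. -/
lemma does_clockedProg {p : Prog} {b : ℕ} {x : Data} {Q : Data → Prop} {t : ℕ}
    (h : Does p b x Q t) (T : ℕ) :
    Does (clockedProg p) (p.bound + 3) (.cons (codeNat T) x)
      (fun y => (y ≠ .nil → Q y.tl) ∧ (t < T → y ≠ .nil))
      (clockedFactor p * (T + 1) + 12) := by
  intro s hs
  have g₁ := Runs.assign p.bound.succ (.hd (.var 0)) s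
  simp only [Exp.eval, Exp.cost, hs, Data.hd] at g₁
  have g₂ := Runs.assign 0 (.tl (.var 0)) (Function.update s p.bound.succ (codeNat T))
  simp only [Exp.eval, Exp.cost] at g₂
  rw [Function.update_of_ne (by omega), hs] at g₂
  simp only [Data.tl] at g₂
  set r := Function.update (Function.update s p.bound.succ (codeNat T)) 0 x with hr
  obtain ⟨s₁, t₁, ht₁, h₁, hQ, -⟩ := h r (by simp [hr])
  obtain ⟨r₁, u, T₁, h₂, e₂, l₂, b₂, a₂, c₂, f₂⟩ := h₁.follows (k := p.bound.succ) (by omega)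
    (r := r) (T := T) (by simp [hr]) (fun _ _ _ => rfl)
  have hu : u ≤ clockedFactor p * (T + 1) := b₂.trans (Nat.mul_le_mul_left _ (by omega))
  have hf : ∀ v ≥ p.bound + 3, r₁ v = s v := fun v hv => by
    rw [f₂ v (by omega), hr, Function.update_of_ne (by omega), Function.update_of_ne (by omega)]
  obtain rfl | hT := T₁.eq_zero_or_pos
  · refine ⟨_, _, ?_, g₁.seq (g₂.seq (h₂.seq (.cond_false (by simp [Exp.eval, e₂, codeNat])
      (.assign 0 .nil r₁)))), ?_, fun v hv => ?_⟩
    · simp only [Exp.cost]; omega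
    · simp only [Exp.eval, Function.update_self, ne_eq, not_true_eq_false, false_implies,
        true_and, imp_false]
      omega
    · rw [Function.update_of_ne (by omega), hf v hv]
  · refine ⟨_, _, ?_, g₁.seq (g₂.seq (h₂.seq (.cond_true
      (by simp [Exp.eval, e₂, codeNat_eq_nil, hT.ne']) (.assign 0 (.cons .nil (.var 0)) r₁)))),
      ?_, fun v hv => ?_⟩
    · simp only [Exp.cost]; omega
    · simp only [Exp.eval, Function.update_self, ne_eq, reduceCtorEq, not_false_eq_true, Data.tl,
        implies_true, and_true, true_implies]
      rwa [← a₂ hT 0 (by omega)]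
    · rw [Function.update_of_ne (by omega), hf v hv]

/-! ## Running an algorithm for all values of a parameter -/

/-- The state of the search: a flag, the time bound, the parameter, the input, the result. -/
def searchState (flag : Data) (T j : ℕ) (x res : Data) : Data :=
  .cons flag (.cons (codeNat T) (.cons (codeNat j) (.cons x res)))

/-- The store with `x` in every variable. -/
abbrev constStore (x : Data) : Store := fun _ => x

/-- The next pair (time bound, parameter). -/
def searchNext : Prog :=
  .assign 0 (.cons (.hd (.var 0)) (.cons (.cons .nil (.hd (.tl (.var 0))))
    (.cons (.cons .nil (.hd (.tl (.var 0)))) (.tl (.tl (.tl (.var 0)))))))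

/-- Tries the current parameter with the current time bound. -/
def searchTry (p : Prog) : Prog :=
  .seq (pairProg (p.bound + 3)
    (.seq (.assign 0 (.cons (.hd (.tl (.var 0)))
        (.cons (.hd (.tl (.tl (.var 0)))) (.hd (.tl (.tl (.tl (.var 0))))))))
      (clockedProg p))
    (.assign 0 (.var 0)))
  (iteProg (p.bound + 5) (.assign 0 (.hd (.var 0)))
    (.assign 0 (.cons .nil (.cons .nil (.cons .nil (.cons .nil (.tl (.hd (.var 0))))))))
    (.assign 0 (.cons (.hd (.tl (.var 0))) (.cons (.hd (.tl (.tl (.var 0))))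
      (.cons (.tl (.hd (.tl (.tl (.tl (.var 0)))))) (.tl (.tl (.tl (.tl (.var 0))))))))))

/-- One step of the search. -/
def searchBody (p : Prog) : Prog :=
  iteProg (p.bound + 6) (.assign 0 (.hd (.tl (.tl (.var 0))))) (searchTry p) searchNext

/-- The search through all pairs (time bound, parameter). -/
def searchProg (p : Prog) : Prog :=
  .seq (.assign 0 (.cons (.cons .nil .nil) (.cons .nil (.cons .nil (.cons (.var 0) .nil)))))
    (.seq (.loop (.hd (.var 0)) (searchBody p)) (.assign 0 (.tl (.tl (.tl (.tl (.var 0)))))))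

lemma does_searchTry {p : Prog} {b : ℕ} {x : Data} {Q : Data → Prop} {j t : ℕ}
    (h : Does p b (.cons (codeNat j) x) Q t) (T : ℕ) (flag res : Data) :
    Does (searchTry p) (p.bound + 6) (searchState flag T j x res)
      (fun y => (∃ r, Q r ∧ y = searchState .nil 0 0 .nil r) ∨
        T ≤ t ∧ y = searchState flag T (j - 1) x res)
      (clockedFactor p * (T + 1) + 100) := by
  have d₁ := Does.assign (e := .cons (.hd (.tl (.var 0)))
        (.cons (.hd (.tl (.tl (.var 0)))) (.hd (.tl (.tl (.tl (.var 0)))))))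
        (by simp [Exp.bound]) (constStore (searchState flag T j x res))
  have d₂ := Does.assign (e := .var 0) (by simp [Exp.bound])
    (constStore (searchState flag T j x res))
  simp only [Exp.eval, Exp.cost, searchState, Data.hd, Data.tl] at d₁ d₂
  have d₃ := (d₁.mono (b' := p.bound + 3) (by omega) (fun _ h => h) le_rfl).seq
    (q := clockedProg p) (fun y hy => by rw [hy]; exact does_clockedProg h T)
  have d₄ := d₃.pair (by omega) (d₂.mono (by omega) (fun _ h => h) le_rfl)
  refine (Does.seq (b := p.bound + 6) (u := 50) (d₄.mono (by omega) (fun _ h => h) le_rfl)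
    ?_).mono le_rfl (fun _ h => h) (by omega)
  rintro _ ⟨y, z, rfl, ⟨hy₁, hy₂⟩, rfl⟩
  have e₁ := Does.assign (e := .hd (.var 0)) (by simp [Exp.bound])
    (constStore (.cons y (searchState flag T j x res)))
  have e₂ := Does.assign (e := .cons .nil (.cons .nil (.cons .nil (.cons .nil
    (.tl (.hd (.var 0))))))) (by simp [Exp.bound])
    (constStore (.cons y (searchState flag T j x res)))
  have e₃ := Does.assign (e := .cons (.hd (.tl (.var 0))) (.cons (.hd (.tl (.tl (.var 0))))
      (.cons (.tl (.hd (.tl (.tl (.tl (.var 0)))))) (.tl (.tl (.tl (.tl (.var 0))))))))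
    (by simp [Exp.bound]) (constStore (.cons y (searchState flag T j x res)))
  simp only [Exp.eval, Exp.cost, searchState, Data.hd, Data.tl] at e₁ e₂ e₃
  refine (Does.ite (b := p.bound + 5) (u := 30) (by omega)
    (e₁.mono (by omega) (fun _ h => h) le_rfl) (fun y' hy' hn => ?_) (fun hn => ?_)).mono
    le_rfl (fun _ h => h) (by omega)
  · subst hy'
    exact e₂.mono (by omega) (fun w hw => .inl ⟨_, hy₁ hn, hw⟩) (by omega)
  · exact e₃.mono (by omega)
      (fun w hw => .inr ⟨not_lt.1 fun hT => hy₂ hT hn.symm,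
        hw.trans (by rw [searchState, ← codeNat_tl]; rfl)⟩) (by omega)

lemma does_searchNext (flag : Data) (T : ℕ) (x res : Data) :
    Does searchNext 1 (searchState flag T 0 x res)
      (· = searchState flag (T + 1) (T + 1) x res) 50 := by
  have d := Does.assign (e := .cons (.hd (.var 0)) (.cons (.cons .nil (.hd (.tl (.var 0))))
    (.cons (.cons .nil (.hd (.tl (.var 0)))) (.tl (.tl (.tl (.var 0)))))))
    (by simp [Exp.bound]) (constStore (searchState flag T 0 x res))
  simp only [Exp.eval, Exp.cost, searchState, Data.hd, Data.tl] at d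
  exact d.mono le_rfl (fun _ h => h) (by omega)

/-- For each time bound `T` the parameter runs down from `T` to 1, so the measure `(T₀ - T) * (T₀ +
2) + j` decreases. The pair `(T₀, j₀)` is never passed: there the clock exceeds `t₀`, so an answer
is found. Stopping earlier is harmless, as `Q` holds for the answer with any parameter. -/
lemma does_searchLoop {p : Prog} {b : ℕ} {x : Data} {Q : Data → Prop}
    (hp : ∀ j, 1 ≤ j → ∃ t, Does p b (.cons (codeNat j) x) Q t) {j₀ t₀ : ℕ} (hj₀ : 1 ≤ j₀)
    (h₀ : Does p b (.cons (codeNat j₀) x) Q t₀) {T₀ : ℕ} (hT₀ : t₀ < T₀)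
    (hjT : j₀ ≤ T₀) :
    ∀ (m T j : ℕ), (T₀ - T) * (T₀ + 2) + j < m → (T < T₀ ∨ T = T₀ ∧ j₀ ≤ j) →
      Does (.loop (.hd (.var 0)) (searchBody p)) (p.bound + 7)
        (searchState (.cons .nil .nil) T j x .nil) (fun y => Q y.tl.tl.tl.tl)
        (m * (clockedFactor p * (T₀ + 1) + 200) + 3)
  | 0, _, _, h, _ => absurd h (by omega)
  | m + 1, T, j, h, hT => by
      have step : Does (searchBody p) (p.bound + 7) (searchState (.cons .nil .nil) T j x .nil)
          (fun y => (∃ r, Q r ∧ y = searchState .nil 0 0 .nil r) ∨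
            ∃ T' j', (T₀ - T') * (T₀ + 2) + j' < m ∧ (T' < T₀ ∨ T' = T₀ ∧ j₀ ≤ j') ∧
              y = searchState (.cons .nil .nil) T' j' x .nil)
          (clockedFactor p * (T₀ + 1) + 197) := by
        have e := Does.assign (e := .hd (.tl (.tl (.var 0)))) (by simp [Exp.bound])
          (constStore (searchState (.cons .nil .nil) T j x .nil))
        simp only [Exp.eval, Exp.cost, searchState, Data.hd, Data.tl] at e
        have hTm : clockedFactor p * (T + 1) ≤ clockedFactor p * (T₀ + 1) :=
          Nat.mul_le_mul_left _ (by omega)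
        refine (Does.ite (b := p.bound + 6) (u := clockedFactor p * (T + 1) + 100) (by omega)
          (e.mono (by omega) (fun _ h => h) le_rfl) (fun y hy hn => ?_) (fun hn => ?_)).mono
          le_rfl (fun _ h => h) (by omega)
        · subst hy
          have hj : j ≠ 0 := fun h => hn (codeNat_eq_nil.2 h)
          -- Nothing is known about the time for a general `j`, but for `j = j₀` it has to be `t₀`,
          -- so that a timeout at `T = T₀` contradicts `t₀ < T₀`.
          have key : ∃ t, Does p b (.cons (codeNat j) x) Q t ∧ (j = j₀ → t = t₀) := by
            by_cases hjj : j = j₀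
            · exact ⟨t₀, hjj ▸ h₀, fun _ => rfl⟩
            · obtain ⟨t, ht⟩ := hp j (by omega)
              exact ⟨t, ht, fun h => absurd h hjj⟩
          obtain ⟨t, ht, htt⟩ := key
          refine (does_searchTry ht T _ _).mono le_rfl (fun y hy => ?_) le_rfl
          refine hy.imp id fun ⟨hTt, hy⟩ => ⟨T, j - 1, by omega, ?_, hy⟩
          rcases hT with hT | ⟨hT, hj'⟩
          · exact .inl hT
          · refine .inr ⟨hT, ?_⟩
            by_cases hjj : j = j₀
            · have := htt hjj
              omega
            · omega
        · have hj : j = 0 := codeNat_eq_nil.1 hn.symm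
          subst hj
          refine (does_searchNext _ T _ _).mono (by omega) (fun y hy => .inr
            ⟨T + 1, T + 1, ?_, ?_, hy⟩) (by omega)
          · obtain ⟨i, rfl⟩ : ∃ i, T₀ = T + 1 + i := ⟨T₀ - T - 1, by omega⟩
            rw [show T + 1 + i - T = i + 1 by omega, add_mul] at h
            rw [show T + 1 + i - (T + 1) = i by omega]
            omega
          · omega
      refine (Does.loop_step (e := .hd (.var 0)) (b := p.bound + 7)
        (s₀ := constStore (searchState (.cons .nil .nil) T j x .nil))
        (u := m * (clockedFactor p * (T₀ + 1) + 200) + 3) (by simp [Exp.bound])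
        (by simp [Exp.eval, searchState, Data.hd]) step ?_).mono le_rfl (fun _ h => h) ?_
      · rintro y (⟨r, hr, rfl⟩ | ⟨T', j', h', hT', rfl⟩)
        · refine (Does.loop_done (e := .hd (.var 0)) (b := p.bound + 7)
            (Q := fun y => Q y.tl.tl.tl.tl)
            (s₀ := constStore (searchState .nil 0 0 .nil r)) (by simp [Exp.bound])
            (by simp [Exp.eval, searchState, Data.hd])
            (by simpa [searchState, Data.tl] using hr)).mono le_rfl (fun _ h => h) ?_
          simp only [Exp.cost]; omega
        · exact does_searchLoop hp hj₀ h₀ hT₀ hjT m T' j' h' hT'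
      · simp only [Exp.cost]
        rw [add_mul]
        omega

/-- If `p` solves a problem for every value of the parameter, then `searchProg p` solves it almost
as fast as `p` does with the best value of the parameter. -/
lemma does_searchProg {p : Prog} {b : ℕ} {x : Data} {Q : Data → Prop}
    (hp : ∀ j, 1 ≤ j → ∃ t, Does p b (.cons (codeNat j) x) Q t) {j t : ℕ} (hj : 1 ≤ j)
    (h : Does p b (.cons (codeNat j) x) Q t) :
    Does (searchProg p) (p.bound + 7) x Q
      ((clockedFactor p + 300) * (t + j + 4) ^ 3) := by
  have d₁ := Does.assign (e := .cons (.cons .nil .nil) (.cons .nil (.cons .nil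
    (.cons (.var 0) .nil)))) (by simp [Exp.bound]) (constStore x)
  simp only [Exp.eval, Exp.cost] at d₁
  -- The choice `T₀ = t + j + 1` exceeds `t` and is at least `j`; the fuel is one more than the
  -- measure of the start `T = 0`, parameter 0.
  have d₂ := does_searchLoop hp hj h (T₀ := t + j + 1) (by omega) (by omega)
    ((t + j + 1) * (t + j + 1 + 2) + 1) 0 0 (by simp) (.inl (by omega))
  refine (Does.seq (u := (t + j + 1) * (t + j + 1 + 2) * (clockedFactor p * (t + j + 1 + 1) + 200)
      + (clockedFactor p * (t + j + 1 + 1) + 200) + 3 + 6)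
    (d₁.mono (b' := p.bound + 7) (by omega) (fun _ h => h) le_rfl) fun y hy => ?_).mono
    le_rfl (fun _ h => h) ?_
  · subst hy
    refine (d₂.seq (u := 6) fun y hy => ?_).mono le_rfl (fun _ h => h) (by rw [add_mul]; omega)
    have d₃ := Does.assign (e := .tl (.tl (.tl (.tl (.var 0))))) (by simp [Exp.bound])
      (constStore y)
    simp only [Exp.eval, Exp.cost] at d₃
    exact d₃.mono (by omega) (fun z hz => by rw [hz]; exact hy) le_rfl
  · generalize clockedFactor p = K
    generalize t + j = n
    have : (K + 300) * (n + 4) ^ 3 = K * (n + 4) ^ 3 + 300 * (n + 4) ^ 3 := by ring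
    rw [this]
    have h₁ : (n + 1) * (n + 1 + 2) * (K * (n + 1 + 1) + 200) + (K * (n + 1 + 1) + 200) =
      K * ((n + 1) * (n + 3) * (n + 2) + (n + 2)) + 200 * ((n + 1) * (n + 3) + 1) := by ring
    rw [h₁]
    have h₂ : (n + 1) * (n + 3) * (n + 2) + (n + 2) ≤ (n + 4) ^ 3 := by nlinarith
    have h₃ : 200 * ((n + 1) * (n + 3) + 1) + 50 ≤ 300 * (n + 4) ^ 3 := by nlinarith
    have h₄ := Nat.mul_le_mul_left K h₂
    generalize K * ((n + 1) * (n + 3) * (n + 2) + (n + 2)) = A at *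
    generalize 200 * ((n + 1) * (n + 3) + 1) = B at *
    generalize K * (n + 4) ^ 3 = C at *
    generalize 300 * (n + 4) ^ 3 = D at *
    omega

/-! ## Functions computable in polynomial time with output of polynomial size -/

@[simp] lemma Data.hd_cons (x y : Data) : (Data.cons x y).hd = x := rfl

@[simp] lemma Data.tl_cons (x y : Data) : (Data.cons x y).tl = y := rfl

lemma Data.one_le_size (x : Data) : 1 ≤ x.size := by
  cases x <;> simp [Data.size]

lemma Data.size_hd_le (x : Data) : x.hd.size ≤ x.size := by
  cases x
  · simp [Data.hd]
  · simp only [Data.hd, Data.size]; omega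

lemma Data.size_tl_le (x : Data) : x.tl.size ≤ x.size := by
  cases x
  · simp [Data.tl]
  · simp only [Data.tl, Data.size]; omega

lemma polyEval_mono (P : Polynomial ℕ) {m n : ℕ} (h : m ≤ n) : P.eval m ≤ P.eval n := by
  induction P using Polynomial.induction_on' with
  | add p q hp hq => simpa using Nat.add_le_add hp hq
  | monomial k a => simpa using Nat.mul_le_mul_left a (Nat.pow_le_pow_left h k)

lemma exists_pow_bound (P : Polynomial ℕ) : ∃ c, ∀ n, 1 ≤ n → P.eval n ≤ c * n ^ c := by
  induction P using Polynomial.induction_on' with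
  | add p q hp hq =>
    obtain ⟨c, hc⟩ := hp
    obtain ⟨d, hd⟩ := hq
    refine ⟨c + d, fun n hn => ?_⟩
    rw [Polynomial.eval_add, add_mul]
    exact Nat.add_le_add
      ((hc n hn).trans (Nat.mul_le_mul_left _ (Nat.pow_le_pow_right hn (by omega))))
      ((hd n hn).trans (Nat.mul_le_mul_left _ (Nat.pow_le_pow_right hn (by omega))))
  | monomial k a =>
    refine ⟨a + k, fun n hn => ?_⟩
    rw [Polynomial.eval_monomial]
    exact Nat.mul_le_mul (by omega) (Nat.pow_le_pow_right hn (by omega))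

/-- The function on trees is computable in polynomial time, with results of polynomial size. -/
def PT (F : Data → Data) : Prop :=
  ∃ (p : Prog) (b : ℕ) (P : Polynomial ℕ), 0 < b ∧
    ∀ x, Does p b x (· = F x) (P.eval x.size) ∧ (F x).size ≤ P.eval x.size

lemma PT.of_exp {F : Data → Data} {e : Exp} (he : e.bound ≤ 1)
    (h : ∀ s : Store, e.eval s = F (s 0)) {c : ℕ} (hc : ∀ x, (F x).size ≤ c * x.size + c) :
    PT F := by
  refine ⟨.assign 0 e, 1, .C c * .X + .C (c + e.cost + 1), one_pos, fun x => ⟨?_, ?_⟩⟩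
  · refine (Does.assign he (constStore x)).mono le_rfl (fun y hy => hy.trans (h _)) ?_
    simp only [Polynomial.eval_add, Polynomial.eval_mul, Polynomial.eval_C, Polynomial.eval_X]
    omega
  · have := hc x
    simp only [Polynomial.eval_add, Polynomial.eval_mul, Polynomial.eval_C, Polynomial.eval_X]
    omega

lemma PT.id : PT fun x => x :=
  .of_exp (e := .var 0) (by simp [Exp.bound]) (fun _ => rfl) (c := 1) (fun x => by omega)

lemma PT.nil : PT fun _ => .nil :=
  .of_exp (e := .nil) (by simp [Exp.bound]) (fun _ => rfl) (c := 1)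
    (fun x => by simp [Data.size])

/-- The size bound in `PT` does not follow from the time bound: `cons` of a tree with itself costs
one unit but doubles the unshared size. Without it the time of the second program could not be
controlled. -/
lemma PT.comp {G F : Data → Data} (hG : PT G) (hF : PT F) : PT fun x => G (F x) := by
  obtain ⟨p, b, P, hb, hp⟩ := hF
  obtain ⟨q, c, R, hc, hq⟩ := hG
  refine ⟨.seq p q, max b c, P + R.comp P, by omega, fun x => ⟨?_, ?_⟩⟩
  · rw [Polynomial.eval_add, Polynomial.eval_comp]
    refine Does.seq ((hp x).1.mono (le_max_left _ _) (fun _ h => h) le_rfl) fun y hy => ?_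
    subst hy
    exact (hq _).1.mono (le_max_right _ _) (fun _ h => h) (polyEval_mono _ (hp x).2)
  · rw [Polynomial.eval_add, Polynomial.eval_comp]
    exact ((hq _).2.trans (polyEval_mono _ (hp x).2)).trans (Nat.le_add_left _ _)

lemma PT.hd {F : Data → Data} (hF : PT F) : PT fun x => (F x).hd :=
  (PT.of_exp (F := Data.hd) (e := .hd (.var 0)) (by simp [Exp.bound]) (fun _ => rfl) (c := 1)
    (fun x => by have := x.size_hd_le; omega)).comp hF

lemma PT.tl {F : Data → Data} (hF : PT F) : PT fun x => (F x).tl :=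
  (PT.of_exp (F := Data.tl) (e := .tl (.var 0)) (by simp [Exp.bound]) (fun _ => rfl) (c := 1)
    (fun x => by have := x.size_tl_le; omega)).comp hF

lemma PT.cons {F G : Data → Data} (hF : PT F) (hG : PT G) : PT fun x => .cons (F x) (G x) := by
  obtain ⟨p, b, P, hb, hp⟩ := hF
  obtain ⟨q, c, R, hc, hq⟩ := hG
  refine ⟨pairProg (max b c) p q, max b c + 2, P + R + .C 10, by omega, fun x => ⟨?_, ?_⟩⟩
  · refine (Does.pair (by omega) ((hp x).1.mono (le_max_left _ _) (fun _ h => h) le_rfl)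
      ((hq x).1.mono (le_max_right _ _) (fun _ h => h) le_rfl)).mono le_rfl ?_ (by simp)
    rintro _ ⟨_, _, rfl, rfl, rfl⟩
    rfl
  · have h₁ := (hp x).2
    have h₂ := (hq x).2
    simp only [Data.size, Polynomial.eval_add, Polynomial.eval_C]
    omega

lemma PT.const : ∀ d : Data, PT fun _ => d
  | .nil => PT.nil
  | .cons a b => (PT.const a).cons (PT.const b)

/-- The case distinction between `nil` and other trees. -/
def Data.ite : Data → Data → Data → Data
  | .nil, _, g => g
  | .cons _ _, f, _ => f

lemma PT.ite {C F G : Data → Data} (hC : PT C) (hF : PT F) (hG : PT G) :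
    PT fun x => (C x).ite (F x) (G x) := by
  obtain ⟨r, a, Q, ha, hr⟩ := hC
  obtain ⟨p, b, P, hb, hp⟩ := hF
  obtain ⟨q, c, R, hc, hq⟩ := hG
  refine ⟨iteProg (max a (max b c)) r p q, max a (max b c) + 1, Q + (P + R) + .C 6, by omega,
    fun x => ⟨?_, ?_⟩⟩
  · refine (Does.ite (b := max a (max b c)) (u := P.eval x.size + R.eval x.size) (by omega)
      ((hr x).1.mono (by omega) (fun _ h => h) le_rfl) (fun y hy hn => ?_) (fun hn => ?_)).mono
      le_rfl (fun _ h => h) (by simp)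
    · refine (hp x).1.mono (by omega) (fun z hz => ?_) (by omega)
      subst hy
      cases h : C x with
      | nil => exact absurd h hn
      | cons _ _ => simpa only [h, Data.ite] using hz
    · refine (hq x).1.mono (by omega) (fun z hz => ?_) (by omega)
      simpa only [← hn, Data.ite] using hz
  · have h₁ := (hp x).2
    have h₂ := (hq x).2
    simp only [Polynomial.eval_add, Polynomial.eval_C]
    cases C x <;> simp only [Data.ite] <;> omega

/-! ### Polynomial-time iteration with an accumulator -/

/-- Iteration over the tails of a list, with an environment `e` and an accumulator. -/
def Data.foldT (F : Data → Data) (e : Data) : Data → Data → Data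
  | .nil, acc => acc
  | .cons h t, acc => Data.foldT F e t (F (.cons e (.cons (.cons h t) acc)))

/-- The growth allowed in one step must not depend on the accumulator; this keeps repeated steps
from compounding to exponential size. -/
lemma Data.size_foldT_le {F : Data → Data} {P : Polynomial ℕ}
    (hP : ∀ e l acc, (F (.cons e (.cons l acc))).size ≤ acc.size + P.eval (e.size + l.size))
    (e : Data) : ∀ (l acc : Data) {L : ℕ}, l.size ≤ L →
      (Data.foldT F e l acc).size ≤ acc.size + l.size * P.eval (e.size + L)
  | .nil, acc, L, _ => by simp [Data.foldT]
  | .cons h t, acc, L, hL => by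
      have h₁ := Data.size_foldT_le hP e t (F (.cons e (.cons (.cons h t) acc))) (L := L)
        (by simp only [Data.size] at hL; omega)
      have h₂ := hP e (.cons h t) acc
      have h₃ := polyEval_mono P (Nat.add_le_add_left hL e.size)
      simp only [Data.foldT]
      refine h₁.trans ?_
      have : (t.size + 1) * P.eval (e.size + L) ≤ (Data.cons h t).size * P.eval (e.size + L) :=
        Nat.mul_le_mul_right _ (by simp only [Data.size]; omega)
      rw [add_mul] at this
      omega

/-- The condition with `M` is an invariant: each step adds to the accumulator at most what the
shorter list releases. So `M` bounds every accumulator met and the cost of each step is uniform. -/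
lemma does_foldT {F : Data → Data} {P R : Polynomial ℕ} {p : Prog} {b : ℕ}
    (hP : ∀ e l acc, (F (.cons e (.cons l acc))).size ≤ acc.size + P.eval (e.size + l.size))
    (hp : ∀ e l acc, Does p b (.cons e (.cons l acc))
      (· = .cons e (.cons l.tl (F (.cons e (.cons l acc)))))
      (R.eval (Data.cons e (.cons l acc)).size)) (e : Data) {L M : ℕ} :
    ∀ l acc : Data, l.size ≤ L → acc.size + l.size * P.eval (e.size + L) ≤ M →
      Does (.loop (.hd (.tl (.var 0))) p) b (.cons e (.cons l acc))
        (· = .cons e (.cons .nil (Data.foldT F e l acc)))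
        (l.size * (R.eval (e.size + L + M + 2) + 4) + 4)
  | .nil, acc, hL, hM => by
      refine (Does.loop_done (e := .hd (.tl (.var 0)))
        (s₀ := constStore (.cons e (.cons .nil acc))) (by simp [Exp.bound])
        (by simp [Exp.eval, Data.hd, Data.tl]) (by simp [Data.foldT])).mono le_rfl
        (fun _ h => h) (by simp only [Exp.cost]; omega)
  | .cons h t, acc, hL, hM => by
      have h₂ := hP e (.cons h t) acc
      have h₃ := polyEval_mono P (Nat.add_le_add_left hL e.size)
      have h₄ : (t.size + 1) * P.eval (e.size + L) ≤
          (Data.cons h t).size * P.eval (e.size + L) :=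
        Nat.mul_le_mul_right _ (by simp only [Data.size]; omega)
      have h₅ := does_foldT hP hp e (L := L) (M := M) t (F (.cons e (.cons (.cons h t) acc)))
        (by simp only [Data.size] at hL; omega) (by rw [add_mul] at h₄; omega)
      refine (Does.loop_step (e := .hd (.tl (.var 0)))
        (u := t.size * (R.eval (e.size + L + M + 2) + 4) + 4)
        (s₀ := constStore (.cons e (.cons (.cons h t) acc))) (by simp [Exp.bound])
        (by simp [Exp.eval, Data.hd, Data.tl]) (hp e (.cons h t) acc) (fun y hy => ?_)).mono
        le_rfl (fun _ h => h) ?_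
      · subst hy
        exact h₅
      · have h₆ : R.eval (Data.cons e (.cons (.cons h t) acc)).size ≤
            R.eval (e.size + L + M + 2) :=
          polyEval_mono _ (by simp only [Data.size] at hL ⊢; omega)
        have h₇ : (t.size + 1) * (R.eval (e.size + L + M + 2) + 4) ≤
            (Data.cons h t).size * (R.eval (e.size + L + M + 2) + 4) :=
          Nat.mul_le_mul_right _ (by simp only [Data.size]; omega)
        rw [add_mul] at h₇
        simp only [Exp.cost]
        omega

lemma PT.foldT {F : Data → Data} (hF : PT F) {P : Polynomial ℕ}
    (hP : ∀ e l acc, (F (.cons e (.cons l acc))).size ≤ acc.size + P.eval (e.size + l.size)) :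
    PT fun x => Data.foldT F x.hd x.tl.hd x.tl.tl := by
  obtain ⟨p, b, R, hb, hp⟩ := PT.cons PT.id.hd (PT.cons PT.id.tl.hd.tl hF)
  have hp' : ∀ e l acc, Does p b (.cons e (.cons l acc))
      (· = .cons e (.cons l.tl (F (.cons e (.cons l acc)))))
      (R.eval (Data.cons e (.cons l acc)).size) := fun e l acc => (hp _).1
  obtain ⟨q, c, S, hc, hq⟩ := PT.cons PT.id.hd (PT.cons PT.id.tl.hd PT.id.tl.tl)
  have hM : ∀ x : Data, x.tl.tl.size + x.tl.hd.size * P.eval (x.hd.size + x.size) ≤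
      x.size + x.size * P.eval (x.size + x.size) := fun x =>
    Nat.add_le_add (x.tl.size_tl_le.trans x.size_tl_le)
      (Nat.mul_le_mul (x.tl.size_hd_le.trans x.size_tl_le)
        (polyEval_mono _ (Nat.add_le_add_right x.size_hd_le _)))
  refine ⟨.seq q (.seq (.loop (.hd (.tl (.var 0))) p) (.assign 0 (.tl (.tl (.var 0))))),
    max b c, S + .X * (R.comp (.X + .X + (.X + .X * P.comp (.X + .X)) + .C 2) + .C 4) + .C 10 +
      (.X + .X * P.comp (.X + .X)), by omega, fun x => ⟨?_, ?_⟩⟩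
  · have d₂ := does_foldT hP hp' x.hd x.tl.hd x.tl.tl
      (x.tl.size_hd_le.trans x.size_tl_le) (hM x)
    set N := x.size + x.size * P.eval (x.size + x.size) with hN
    have ht : x.tl.hd.size * (R.eval (x.hd.size + x.size + N + 2) + 4) ≤
        x.size * (R.eval (x.size + x.size + N + 2) + 4) :=
      Nat.mul_le_mul (x.tl.size_hd_le.trans x.size_tl_le)
        (Nat.add_le_add_right (polyEval_mono _ (by have := x.size_hd_le; omega)) 4)
    have d₃ : Does (.seq (.loop (.hd (.tl (.var 0))) p) (.assign 0 (.tl (.tl (.var 0)))))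
        (max b c) (.cons x.hd (.cons x.tl.hd x.tl.tl))
        (· = Data.foldT F x.hd x.tl.hd x.tl.tl) _ :=
      (d₂.mono (le_max_left _ _) (fun _ h => h) le_rfl).seq (u := 4) fun z hz => by
        subst hz
        exact (Does.assign (e := .tl (.tl (.var 0))) (by simp [Exp.bound]) (constStore _)).mono
          (by omega) (fun _ h => h) (by simp [Exp.cost])
    refine (Does.seq ((hq x).1.mono (le_max_right _ _) (fun _ h => h) le_rfl)
      fun y hy => by subst hy; exact d₃).mono le_rfl (fun _ h => h) ?_
    simp only [Polynomial.eval_add, Polynomial.eval_mul, Polynomial.eval_X,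
      Polynomial.eval_comp, Polynomial.eval_C, ← hN]
    omega
  · refine (Data.size_foldT_le hP x.hd x.tl.hd x.tl.tl
      (x.tl.size_hd_le.trans x.size_tl_le)).trans ((hM x).trans ?_)
    simp only [Polynomial.eval_add, Polynomial.eval_mul, Polynomial.eval_X,
      Polynomial.eval_comp, Polynomial.eval_C]
    omega

/-- Reversal of a list in front of another one. -/
def Data.revAppend : Data → Data → Data
  | .nil, acc => acc
  | .cons h t, acc => Data.revAppend t (.cons h acc)

lemma Data.size_revAppend_le : ∀ l acc : Data, (Data.revAppend l acc).size ≤ acc.size + l.size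
  | .nil, acc => by simp [Data.revAppend]
  | .cons h t, acc => by
      have := Data.size_revAppend_le t (.cons h acc)
      simp only [Data.revAppend, Data.size] at *
      omega

lemma PT.revAppend {F G : Data → Data} (hF : PT F) (hG : PT G) :
    PT fun x => Data.revAppend (F x) (G x) := by
  have h := PT.foldT (F := fun x => .cons x.tl.hd.hd x.tl.tl) (P := .X)
    (PT.cons PT.id.tl.hd.hd PT.id.tl.tl) (fun e l acc => by
      have := l.size_hd_le
      have := e.one_le_size
      have := l.hd.size_hd_le
      simp only [Data.tl_cons, Data.hd_cons, Data.size, Polynomial.eval_X]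
      omega)
  have e : ∀ l acc, Data.foldT (fun x => .cons x.tl.hd.hd x.tl.tl) .nil l acc =
      Data.revAppend l acc := by
    intro l
    induction l with
    | nil => intro acc; rfl
    | cons h t _ ih => intro acc; exact ih _
  have := h.comp (PT.nil.cons (hF.cons hG))
  simp only [Data.hd_cons, Data.tl_cons] at this
  simpa only [e] using this

/-! ## Polynomial time on encoded types -/

/-- Types whose elements are represented by trees. -/
class Enc (α : Type) where
  /-- The tree representing an element. -/
  code : α → Data

/-- The tree representing an element. -/
abbrev enc {α : Type} [Enc α] : α → Data := Enc.code

instance : Enc Unit := ⟨fun _ => .nil⟩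
instance : Enc Bool := ⟨codeBool⟩
instance : Enc ℕ := ⟨codeNat⟩
instance {α β : Type} [Enc α] [Enc β] : Enc (α × β) := ⟨fun p => .cons (enc p.1) (enc p.2)⟩
instance {α : Type} [Enc α] : Enc (List α) := ⟨codeList enc⟩

/-- The function is computable in polynomial time, with results of polynomial size. -/
def Poly {α β : Type} [Enc α] [Enc β] (f : α → β) : Prop :=
  ∃ F, PT F ∧ ∀ a, F (enc a) = enc (f a)

section Poly

variable {α β γ δ : Type} [Enc α] [Enc β] [Enc γ] [Enc δ]

lemma Poly.id : Poly fun a : α => a := ⟨_, PT.id, fun _ => rfl⟩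

lemma Poly.congr {f g : α → β} (hf : Poly f) (h : ∀ a, f a = g a) : Poly g :=
  (funext h : f = g) ▸ hf

lemma Poly.const (b : β) : Poly fun _ : α => b := ⟨_, PT.const (enc b), fun _ => rfl⟩

lemma Poly.comp {g : β → γ} {f : α → β} (hg : Poly g) (hf : Poly f) : Poly fun a => g (f a) := by
  obtain ⟨F, hF, eF⟩ := hf
  obtain ⟨G, hG, eG⟩ := hg
  exact ⟨_, hG.comp hF, fun a => by rw [eF, eG]⟩

lemma Poly.fst {f : α → β × γ} (hf : Poly f) : Poly fun a => (f a).1 := by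
  obtain ⟨F, hF, eF⟩ := hf
  exact ⟨_, hF.hd, fun a => by rw [eF]; rfl⟩

lemma Poly.snd {f : α → β × γ} (hf : Poly f) : Poly fun a => (f a).2 := by
  obtain ⟨F, hF, eF⟩ := hf
  exact ⟨_, hF.tl, fun a => by rw [eF]; rfl⟩

lemma Poly.pair {f : α → β} {g : α → γ} (hf : Poly f) (hg : Poly g) :
    Poly fun a => (f a, g a) := by
  obtain ⟨F, hF, eF⟩ := hf
  obtain ⟨G, hG, eG⟩ := hg
  exact ⟨_, hF.cons hG, fun a => by rw [eF, eG]; rfl⟩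

lemma Poly.ite {c : α → Bool} {f g : α → β} (hc : Poly c) (hf : Poly f) (hg : Poly g) :
    Poly fun a => if c a = true then f a else g a := by
  obtain ⟨C, hC, eC⟩ := hc
  obtain ⟨F, hF, eF⟩ := hf
  obtain ⟨G, hG, eG⟩ := hg
  refine ⟨_, hC.ite hF hG, fun a => ?_⟩
  beta_reduce
  rw [eC, eF, eG]
  cases c a <;> rfl

lemma Poly.not {c : α → Bool} (hc : Poly c) : Poly fun a => !c a := by
  have := hc.ite (.const false) (.const true)
  refine this.congr fun a => ?_
  cases c a <;> rfl

lemma Poly.and {c d : α → Bool} (hc : Poly c) (hd : Poly d) : Poly fun a => c a && d a := by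
  have := hc.ite hd (.const false)
  refine this.congr fun a => ?_
  cases c a <;> rfl

lemma Poly.or {c d : α → Bool} (hc : Poly c) (hd : Poly d) : Poly fun a => c a || d a := by
  have := hc.ite (.const true) hd
  refine this.congr fun a => ?_
  cases c a <;> rfl

lemma Poly.cons {f : α → β} {g : α → List β} (hf : Poly f) (hg : Poly g) :
    Poly fun a => f a :: g a := by
  obtain ⟨F, hF, eF⟩ := hf
  obtain ⟨G, hG, eG⟩ := hg
  exact ⟨_, hF.cons hG, fun a => by rw [eF, eG]; rfl⟩

lemma Poly.tail {f : α → List β} (hf : Poly f) : Poly fun a => (f a).tail := by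
  obtain ⟨F, hF, eF⟩ := hf
  exact ⟨_, hF.tl, fun a => by beta_reduce; rw [eF]; cases f a <;> rfl⟩

lemma Poly.isEmpty {f : α → List β} (hf : Poly f) : Poly fun a => (f a).isEmpty := by
  obtain ⟨F, hF, eF⟩ := hf
  exact ⟨_, hF.ite (.const (enc false)) (.const (enc true)),
    fun a => by beta_reduce; rw [eF]; cases f a <;> rfl⟩

lemma Poly.headD {f : α → List β} {g : α → β} (hf : Poly f) (hg : Poly g) :
    Poly fun a => (f a).headD (g a) := by
  obtain ⟨F, hF, eF⟩ := hf
  obtain ⟨G, hG, eG⟩ := hg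
  exact ⟨_, hF.ite hF.hd hG, fun a => by beta_reduce; rw [eF, eG]; cases f a <;> rfl⟩

lemma enc_revAppend : ∀ l m : List β, Data.revAppend (enc l) (enc m) = enc (l.reverse ++ m)
  | [], _ => rfl
  | b :: l, m => by
      rw [List.reverse_cons, List.append_assoc]
      exact enc_revAppend l (b :: m)

lemma Poly.append {f g : α → List β} (hf : Poly f) (hg : Poly g) :
    Poly fun a => f a ++ g a := by
  obtain ⟨F, hF, eF⟩ := hf
  obtain ⟨G, hG, eG⟩ := hg
  refine ⟨_, (hF.revAppend .nil).revAppend hG, fun a => ?_⟩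
  rw [eF, eG, show (Data.nil) = enc ([] : List β) from rfl, enc_revAppend, enc_revAppend]
  simp

/-- Concatenation of lists computed from an element of a list and the elements after it. -/
def flatTails (g : β → List β → List γ) : List β → List γ
  | [] => []
  | b :: bs => g b bs ++ flatTails g bs

/-- The pieces are prepended in reverse to the accumulator, which grows by the size of a piece only,
as `PT.foldT` requires; a final reversal restores the order. Access to the rest of the list supplies
a numbering of the elements, namely by the length of the rest. -/
lemma Poly.flatTails {f : α → List β} {g : α × (β × List β) → List γ} (hf : Poly f)
    (hg : Poly g) : Poly fun a => flatTails (fun b bs => g (a, (b, bs))) (f a) := by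
  obtain ⟨F, hF, eF⟩ := hf
  obtain ⟨G, hG, eG⟩ := hg
  have ⟨_, _, P, _, hP⟩ := hG
  have h := PT.foldT (F := fun x => Data.revAppend (G (.cons x.hd x.tl.hd)) x.tl.tl)
    (P := P.comp (.X + .C 1)) ((hG.comp (PT.id.hd.cons PT.id.tl.hd)).revAppend PT.id.tl.tl)
    (fun e l acc => by
      refine (Data.size_revAppend_le _ _).trans (Nat.add_le_add_left ((hP _).2.trans ?_) _)
      simp [Data.size])
  have e : ∀ a (l : List β) (acc : List γ),
      Data.foldT (fun x => Data.revAppend (G (.cons x.hd x.tl.hd)) x.tl.tl) (enc a) (enc l)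
        (enc acc) = enc ((SubexpCSP.flatTails (fun b bs => g (a, (b, bs))) l).reverse ++ acc) := by
    intro a l
    induction l with
    | nil => intro acc; rfl
    | cons b l ih =>
      intro acc
      change Data.foldT _ _ (enc l) (Data.revAppend (G (enc (a, (b, l)))) (enc acc)) = _
      rw [eG, enc_revAppend, ih]
      simp [SubexpCSP.flatTails]
  refine ⟨_, (h.comp (PT.id.cons (hF.cons .nil))).revAppend .nil, fun a => ?_⟩
  simp only [Data.hd_cons, Data.tl_cons]
  rw [eF, show (Data.nil) = enc ([] : List γ) from rfl, e, enc_revAppend]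
  simp

lemma flatTails_eq_flatMap {ι κ : Type} (g : ι → List κ) (l : List ι) :
    SubexpCSP.flatTails (fun b _ => g b) l = l.flatMap g := by
  induction l with
  | nil => rfl
  | cons b l ih => simp [SubexpCSP.flatTails, ih]

lemma Poly.flatMap {f : α → List β} {g : α × β → List γ} (hf : Poly f) (hg : Poly g) :
    Poly fun a => (f a).flatMap fun b => g (a, b) := by
  have := hf.flatTails (g := fun p : α × (β × List β) => g (p.1, p.2.1))
    (hg.comp (Poly.id.fst.pair Poly.id.snd.fst))
  simpa only [flatTails_eq_flatMap] using this

lemma Poly.map {f : α → List β} {g : α × β → γ} (hf : Poly f) (hg : Poly g) :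
    Poly fun a => (f a).map fun b => g (a, b) := by
  have := hf.flatMap (hg.cons (.const []))
  simpa only [← List.map_eq_flatMap] using this

lemma Poly.filter {f : α → List β} {c : α × β → Bool} (hf : Poly f) (hc : Poly c) :
    Poly fun a => (f a).filter fun b => c (a, b) := by
  have := hf.flatMap (hc.ite (Poly.id.snd.cons (.const [])) (.const []))
  refine this.congr fun a => ?_
  induction f a with
  | nil => rfl
  | cons b l ih =>
    simp only [List.flatMap_cons, List.filter_cons, ih]
    split <;> rfl

lemma Poly.any {f : α → List β} {c : α × β → Bool} (hf : Poly f) (hc : Poly c) :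
    Poly fun a => (f a).any fun b => c (a, b) := by
  have := (hf.filter hc).isEmpty.not
  refine this.congr fun a => ?_
  rw [Bool.eq_iff_iff]
  simp [List.filter_eq_nil_iff]

/-! Numbers are lists of units. -/

lemma enc_replicate : ∀ n : ℕ, enc (List.replicate n ()) = enc n
  | 0 => rfl
  | n + 1 => congrArg (Data.cons .nil) (enc_replicate n)

lemma enc_units : ∀ l : List Unit, enc l = enc l.length
  | [] => rfl
  | _ :: l => congrArg (Data.cons .nil) (enc_units l)

lemma Poly.replicate {f : α → ℕ} (hf : Poly f) : Poly fun a => List.replicate (f a) () := by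
  obtain ⟨F, hF, eF⟩ := hf
  exact ⟨F, hF, fun a => by rw [eF, enc_replicate]⟩

lemma Poly.length {f : α → List β} (hf : Poly f) : Poly fun a => (f a).length := by
  obtain ⟨F, hF, eF⟩ := hf.map (g := fun _ => ()) (.const ())
  exact ⟨F, hF, fun a => by rw [eF, enc_units, List.length_map]⟩

lemma Poly.succ {f : α → ℕ} (hf : Poly f) : Poly fun a => f a + 1 := by
  obtain ⟨F, hF, eF⟩ := hf
  exact ⟨_, PT.nil.cons hF, fun a => by rw [eF]; rfl⟩

lemma Poly.add {f g : α → ℕ} (hf : Poly f) (hg : Poly g) : Poly fun a => f a + g a := by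
  have := (hf.replicate.append hg.replicate).length
  simpa using this

lemma Poly.mul {f g : α → ℕ} (hf : Poly f) (hg : Poly g) : Poly fun a => f a * g a := by
  have := (hf.replicate.flatMap (g := fun p => List.replicate (g p.1) ())
    (hg.comp Poly.id.fst).replicate).length
  simpa [List.length_flatMap] using this

/-- The tail of the unary number is taken once per unit of `g a`; truncation at zero comes from the
tail of `nil` being `nil`. -/
lemma Poly.sub {f g : α → ℕ} (hf : Poly f) (hg : Poly g) : Poly fun a => f a - g a := by
  obtain ⟨F, hF, eF⟩ := hf
  obtain ⟨G, hG, eG⟩ := hg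
  have h := PT.foldT (F := fun x => x.tl.tl.tl) (P := 0) PT.id.tl.tl.tl (fun e l acc => by
    simpa using acc.size_tl_le)
  have e : ∀ n m : ℕ, Data.foldT (fun x => x.tl.tl.tl) .nil (enc n) (enc m) = enc (m - n) := by
    intro n
    induction n with
    | zero => intro m; rfl
    | succ n ih =>
      intro m
      change Data.foldT _ _ (enc n) (codeNat m).tl = _
      rw [codeNat_tl]
      exact (ih _).trans (by rw [Nat.sub_sub, Nat.add_comm])
  refine ⟨_, h.comp (PT.nil.cons (hG.cons hF)), fun a => ?_⟩
  simp only [Data.hd_cons, Data.tl_cons]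
  rw [eF, eG, e]

lemma Poly.le {f g : α → ℕ} (hf : Poly f) (hg : Poly g) : Poly fun a => decide (f a ≤ g a) := by
  have := (hf.sub hg).replicate.isEmpty
  refine this.congr fun a => ?_
  rw [Bool.eq_iff_iff]
  simp [Nat.sub_eq_zero_iff_le]

/-- Concatenation of lists computed from all numbers below a number. -/
def natFlat (g : ℕ → List γ) : ℕ → List γ
  | 0 => []
  | n + 1 => g n ++ natFlat g n

/-- A number is a list of units, and the lengths of its proper tails are exactly the smaller
numbers. -/
lemma Poly.natFlat {f : α → ℕ} {g : α × ℕ → List γ} (hf : Poly f) (hg : Poly g) :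
    Poly fun a => natFlat (fun n => g (a, n)) (f a) := by
  have := hf.replicate.flatTails (g := fun p : α × (Unit × List Unit) => g (p.1, p.2.2.length))
    (hg.comp (Poly.id.fst.pair Poly.id.snd.snd.length))
  refine this.congr fun a => ?_
  induction f a with
  | zero => rfl
  | succ n ih => simp [List.replicate_succ, SubexpCSP.flatTails, SubexpCSP.natFlat, ih]

/-- Types with equality decidable in polynomial time. -/
class PolyEq (α : Type) [Enc α] [DecidableEq α] : Prop where
  poly_eq : Poly fun p : α × α => decide (p.1 = p.2)

instance : PolyEq ℕ := ⟨by
  have := (Poly.le Poly.id.fst Poly.id.snd).and (Poly.le (α := ℕ × ℕ) Poly.id.snd Poly.id.fst)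
  refine this.congr fun a => ?_
  rw [Bool.eq_iff_iff]
  simp [le_antisymm_iff]⟩

instance : PolyEq Bool := ⟨by
  have := Poly.id.fst.ite Poly.id.snd (Poly.not (α := Bool × Bool) Poly.id.snd)
  refine this.congr fun a => ?_
  rcases a with ⟨_ | _, _ | _⟩ <;> rfl⟩

instance [DecidableEq α] [DecidableEq β] [PolyEq α] [PolyEq β] : PolyEq (α × β) := ⟨by
  have := (PolyEq.poly_eq.comp (Poly.id.fst.fst.pair Poly.id.snd.fst)).and
    (PolyEq.poly_eq.comp
      (Poly.pair (α := (α × β) × (α × β)) Poly.id.fst.snd Poly.id.snd.snd))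
  refine this.congr fun a => ?_
  rw [Bool.eq_iff_iff]
  simp [Prod.ext_iff]⟩

lemma Poly.eq [DecidableEq β] [PolyEq β] {f g : α → β} (hf : Poly f) (hg : Poly g) :
    Poly fun a => decide (f a = g a) :=
  PolyEq.poly_eq.comp (hf.pair hg)

lemma Poly.mem [DecidableEq β] [PolyEq β] {f : α → β} {l : α → List β}
    [∀ a, Decidable (f a ∈ l a)] (hf : Poly f) (hl : Poly l) : Poly fun a => decide (f a ∈ l a) := by
  have := hl.any ((hf.comp Poly.id.fst).eq Poly.id.snd)
  refine this.congr fun a => ?_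
  rw [Bool.eq_iff_iff]
  simp

end Poly

/-! ## Sparsification -/

/-- A literal: a variable and the truth value that makes the literal true. -/
abbrev Lit : Type := ℕ × Bool

/-- A clause with three literals, not necessarily distinct. -/
abbrev Triple : Type := Lit × Lit × Lit

/-- The literals required to be true and the clauses with two literals that have been added. -/
abbrev Branch : Type := List Lit × List (Lit × Lit)

/-- All literals over the variables below `n`. -/
def lits (n : ℕ) : List Lit := natFlat (fun i => [(i, true), (i, false)]) n

/-- All pairs of literals. -/
def litPairs (n : ℕ) : List (Lit × Lit) :=
  (lits n).flatMap fun x => (lits n).map fun y => (x, y)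

/-- The clause `x ∨ y` is present and contains no literal required to be true. -/
def adj (σ : Branch) (x y : Lit) : Bool :=
  decide ((x, y) ∈ σ.2) && (!decide (x ∈ σ.1) && !decide (y ∈ σ.1))

/-- The clause `x ∨ y ∨ z` is present and not implied by smaller clauses. -/
def act (Th : List Triple) (σ : Branch) (x y z : Lit) : Bool :=
  decide ((x, y, z) ∈ Th) && ((!decide (x ∈ σ.1) && (!decide (y ∈ σ.1) && !decide (z ∈ σ.1))) &&
    (!decide ((x, y) ∈ σ.2) && (!decide ((x, z) ∈ σ.2) && !decide ((y, z) ∈ σ.2))))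

/-- The literals `y` with `x ∨ y` present. -/
def nbr₂ (n : ℕ) (σ : Branch) (x : Lit) : List Lit := (lits n).filter fun y => adj σ x y

/-- The literals `z` with `x ∨ y ∨ z` present. -/
def nbr₃ (n : ℕ) (Th : List Triple) (σ : Branch) (x y : Lit) : List Lit :=
  (lits n).filter fun z => act Th σ x y z

/-- The pairs `(y, z)` with `x ∨ y ∨ z` present. -/
def nbrPairs (n : ℕ) (Th : List Triple) (σ : Branch) (x : Lit) : List (Lit × Lit) :=
  (litPairs n).filter fun q => act Th σ x q.1 q.2

/-- Requires the literals in `V` to be true. -/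
def addLits (n : ℕ) (σ : Branch) (V : List Lit) : Branch :=
  ((lits n).filter fun x => decide (x ∈ σ.1) || decide (x ∈ V), σ.2)

/-- Adds clauses with two literals. -/
def addPairs (n : ℕ) (σ : Branch) (V : List (Lit × Lit)) : Branch :=
  (σ.1, (litPairs n).filter fun q => decide (q ∈ σ.2) || decide (q ∈ V))

/-- Branching on a literal that is in many clauses with two literals. -/
def branch₂ (n s : ℕ) (σ : Branch) : List (Branch × Branch) :=
  (lits n).flatMap fun x => if decide (s ≤ (nbr₂ n σ x).length) = true then
    [(addLits n σ [x], addLits n σ (nbr₂ n σ x))] else []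

/-- Branching on a pair of literals that is in many clauses. -/
def branch₃ (n s : ℕ) (Th : List Triple) (σ : Branch) : List (Branch × Branch) :=
  (litPairs n).flatMap fun q => if decide (s ≤ (nbr₃ n Th σ q.1 q.2).length) = true then
    [(addPairs n σ [(q.1, q.2), (q.2, q.1)], addLits n σ (nbr₃ n Th σ q.1 q.2))] else []

/-- Branching on a literal that is in many clauses with three literals. -/
def branch₁ (n s : ℕ) (Th : List Triple) (σ : Branch) : List (Branch × Branch) :=
  (lits n).flatMap fun x => if decide (s * s ≤ (nbrPairs n Th σ x).length) = true then
    [(addLits n σ [x], addPairs n σ (nbrPairs n Th σ x))] else []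

/-- The possible branchings, the preferred one first. -/
def branchings (n s : ℕ) (Th : List Triple) (σ : Branch) : List (Branch × Branch) :=
  branch₂ n s σ ++ (branch₃ n s Th σ ++ branch₁ n s Th σ)

/-- The clauses of a sparse formula, each with three literals. -/
def sparseClauses (n : ℕ) (Th : List Triple) (σ : Branch) : List Triple :=
  (σ.1.map fun x => (x, x, x)) ++
    (((lits n).flatMap fun x => (nbr₂ n σ x).map fun y => (x, x, y)) ++
      (lits n).flatMap fun x => (nbrPairs n Th σ x).map fun q => (x, q.1, q.2))

/-- The literal is true. -/
def Lit.Holds (τ : ℕ → Bool) (x : Lit) : Prop := τ x.1 = x.2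

/-- The clause is true. -/
def Triple.Holds (τ : ℕ → Bool) (t : Triple) : Prop :=
  Lit.Holds τ t.1 ∨ Lit.Holds τ t.2.1 ∨ Lit.Holds τ t.2.2

/-- All clauses are true. -/
structure Branch.Sat (Th : List Triple) (σ : Branch) (τ : ℕ → Bool) : Prop where
  triples : ∀ t ∈ Th, Triple.Holds τ t
  lits : ∀ x ∈ σ.1, Lit.Holds τ x
  pairs : ∀ q ∈ σ.2, Lit.Holds τ q.1 ∨ Lit.Holds τ q.2

/-- The set of clauses is closed under permutations of a clause. -/
structure PermClosed (Th : List Triple) : Prop where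
  swap : ∀ x y z, (x, y, z) ∈ Th → (x, z, y) ∈ Th
  rotate : ∀ x y z, (x, y, z) ∈ Th → (y, z, x) ∈ Th

lemma mem_lits {n : ℕ} {x : Lit} : x ∈ lits n ↔ x.1 < n := by
  induction n with
  | zero => simp [lits, natFlat]
  | succ n ih =>
    rcases x with ⟨i, b⟩
    simp only [lits] at ih
    simp only [lits, natFlat, List.cons_append, List.nil_append, List.mem_cons, ih,
      Prod.mk.injEq]
    cases b <;> simp <;> omega

lemma length_lits (n : ℕ) : (lits n).length = 2 * n := by
  induction n with
  | zero => simp [lits, natFlat]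
  | succ n ih =>
    simp only [lits] at ih
    simp only [lits, natFlat, List.cons_append, List.nil_append, List.length_cons, ih]
    omega

lemma nodup_lits (n : ℕ) : (lits n).Nodup := by
  induction n with
  | zero => simp [lits, natFlat]
  | succ n ih =>
    have h : ∀ b, (n, b) ∉ lits n := fun b hb => absurd (mem_lits.1 hb) (lt_irrefl _)
    simp only [lits] at ih h
    simp [lits, natFlat, ih, h]

lemma mem_litPairs {n : ℕ} {q : Lit × Lit} : q ∈ litPairs n ↔ q.1 ∈ lits n ∧ q.2 ∈ lits n := by
  rcases q with ⟨x, y⟩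
  simp [litPairs]

lemma nodup_litPairs (n : ℕ) : (litPairs n).Nodup :=
  (nodup_lits n).product (nodup_lits n)

lemma length_litPairs (n : ℕ) : (litPairs n).length = 4 * n ^ 2 := by
  have := List.length_product (lits n) (lits n)
  rw [length_lits] at this
  exact this.trans (by ring)

lemma adj_iff {σ : Branch} {x y : Lit} :
    adj σ x y = true ↔ (x, y) ∈ σ.2 ∧ x ∉ σ.1 ∧ y ∉ σ.1 := by
  simp [adj]

lemma act_iff {Th : List Triple} {σ : Branch} {x y z : Lit} :
    act Th σ x y z = true ↔ (x, y, z) ∈ Th ∧ (x ∉ σ.1 ∧ y ∉ σ.1 ∧ z ∉ σ.1) ∧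
      (x, y) ∉ σ.2 ∧ (x, z) ∉ σ.2 ∧ (y, z) ∉ σ.2 := by
  simp [act]

/-! ### Invariant and progress measure of the branching -/

/-- The invariant of the branching. -/
structure Branch.Good (n s : ℕ) (σ : Branch) : Prop where
  lits_sub : ∀ x ∈ σ.1, x ∈ lits n
  nodup : σ.1.Nodup
  pairs_sub : ∀ q ∈ σ.2, q ∈ litPairs n
  length_pairs : σ.2.length ≤ 4 * n ^ 2
  symm : ∀ x y, (x, y) ∈ σ.2 → (y, x) ∈ σ.2
  deg : ∀ x, (nbr₂ n σ x).length ≤ 2 * s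

/-- The active clauses with two literals. -/
def Branch.active (σ : Branch) : Finset (Lit × Lit) :=
  σ.2.toFinset.filter fun q => q.1 ∉ σ.1 ∧ q.2 ∉ σ.1

/-- The progress measure of the branching. -/
def Branch.progress (s : ℕ) (σ : Branch) : ℕ := 5 * s * σ.1.length + σ.active.card

lemma Branch.mem_active {σ : Branch} {x y : Lit} :
    (x, y) ∈ σ.active ↔ adj σ x y = true := by
  simp [Branch.active, adj_iff]

lemma nodup_nbr₂ (n : ℕ) (σ : Branch) (x : Lit) : (nbr₂ n σ x).Nodup := (nodup_lits n).filter _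

lemma Branch.Good.card_row_le {n s : ℕ} {σ : Branch} (h : σ.Good n s) (x : Lit) :
    (σ.active.filter fun q => q.1 = x).card ≤ (nbr₂ n σ x).length := by
  rw [← List.toFinset_card_of_nodup (nodup_nbr₂ n σ x)]
  refine (Finset.card_le_card ?_).trans (Finset.card_image_le (f := fun y => (x, y)))
  rintro ⟨x', y⟩ hq
  simp only [Finset.mem_filter, Branch.mem_active] at hq
  obtain ⟨hq, rfl⟩ := hq
  have := (mem_litPairs.1 (h.pairs_sub _ (adj_iff.1 hq).1)).2
  simp [nbr₂, hq, this]

lemma Branch.Good.card_active_filter_le {n s : ℕ} {σ : Branch} (h : σ.Good n s)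
    (V : Finset Lit) : (σ.active.filter fun q => q.1 ∈ V).card ≤ V.card * (2 * s) := by
  refine Finset.card_le_mul_card_image_of_maps_to (f := Prod.fst) (t := V)
    (fun q hq => (Finset.mem_filter.1 hq).2) (2 * s) (fun x _ => ?_) |>.trans_eq (mul_comm _ _)
  refine (Finset.card_le_card ?_).trans ((h.card_row_le x).trans (h.deg x))
  intro q hq
  simp only [Finset.mem_filter] at hq ⊢
  exact ⟨hq.1.1, hq.2⟩

lemma Branch.Good.card_active_filter_snd_le {n s : ℕ} {σ : Branch} (h : σ.Good n s)
    (V : Finset Lit) : (σ.active.filter fun q => q.2 ∈ V).card ≤ V.card * (2 * s) := by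
  refine le_trans (Finset.card_le_card_of_injOn Prod.swap ?_ Prod.swap_injective.injOn)
    (h.card_active_filter_le V)
  rintro ⟨x, y⟩ hq
  simp only [Finset.coe_filter, Set.mem_ofPred_eq, Branch.mem_active, adj_iff] at hq
  simp only [Prod.swap, Finset.coe_filter, Set.mem_ofPred_eq, Branch.mem_active, adj_iff]
  exact ⟨⟨h.symm _ _ hq.1.1, hq.1.2.2, hq.1.2.1⟩, hq.2⟩

/-- At most `2 * n` required literals contribute `5 * s` each, and each of the `2 * n` literals is
the first entry of at most `2 * s` active pairs. -/
lemma Branch.Good.progress_le {n s : ℕ} {σ : Branch} (h : σ.Good n s) :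
    σ.progress s ≤ 14 * s * n := by
  have h₁ : σ.1.length ≤ 2 * n := by
    rw [← length_lits]
    exact (List.subperm_of_subset h.nodup h.lits_sub).length_le
  have h₂ := h.card_active_filter_le (lits n).toFinset
  rw [List.toFinset_card_of_nodup (nodup_lits n), length_lits, Finset.filter_true_of_mem] at h₂
  · unfold Branch.progress
    nlinarith
  · rintro ⟨x, y⟩ hq
    rw [Branch.mem_active, adj_iff] at hq
    simpa using (mem_litPairs.1 (h.pairs_sub _ hq.1)).1

lemma Branch.Good.empty (n s : ℕ) : Branch.Good n s ([], []) where
  lits_sub := by simp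
  nodup := by simp
  pairs_sub := by simp
  length_pairs := by simp
  symm := by simp
  deg := by simp [nbr₂, adj]

lemma mem_addLits {n : ℕ} {σ : Branch} {V : List Lit} (hV : ∀ x ∈ V, x ∈ lits n)
    (h : ∀ x ∈ σ.1, x ∈ lits n) {x : Lit} : x ∈ (addLits n σ V).1 ↔ x ∈ σ.1 ∨ x ∈ V := by
  simp only [addLits, List.mem_filter, Bool.or_eq_true, decide_eq_true_eq]
  exact ⟨fun h => h.2, fun h' => ⟨h'.elim (h x) (hV x), h'⟩⟩

/-- A new literal earns `5 * s` and deactivates at most `2 * s` ordered pairs in each of the two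
positions. The weight 5 is chosen to leave a net gain of `s` per literal. -/
lemma Branch.Good.addLits {n s : ℕ} {σ : Branch} (h : σ.Good n s) {V : List Lit}
    (hV : ∀ x ∈ V, x ∈ lits n) (hn : V.Nodup) (hd : ∀ x ∈ V, x ∉ σ.1) :
    (addLits n σ V).Good n s ∧
      σ.progress s + s * V.length ≤ (SubexpCSP.addLits n σ V).progress s := by
  have hm := fun x => mem_addLits (x := x) hV h.lits_sub
  have hnd : (SubexpCSP.addLits n σ V).1.Nodup := (nodup_lits n).filter _
  refine ⟨⟨fun x hx => (List.mem_filter.1 hx).1, hnd, h.pairs_sub, h.length_pairs, h.symm,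
    fun x => ?_⟩, ?_⟩
  · refine (List.Sublist.length_le ?_).trans (h.deg x)
    refine List.monotone_filter_right _ fun y hy => ?_
    rw [adj_iff] at hy ⊢
    rw [hm, hm] at hy
    exact ⟨hy.1, fun h => hy.2.1 (.inl h), fun h => hy.2.2 (.inl h)⟩
  · have h₁ : (SubexpCSP.addLits n σ V).1.length = σ.1.length + V.length := by
      rw [← List.length_append]
      refine List.Perm.length_eq ((List.perm_ext_iff_of_nodup hnd ?_).2 fun x => ?_)
      · exact List.Nodup.append h.nodup hn fun x hx hx' => hd x hx' hx
      · rw [hm, List.mem_append]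
    have h₂ : σ.active ⊆ (SubexpCSP.addLits n σ V).active ∪
        ((σ.active.filter fun q => q.1 ∈ V.toFinset) ∪
          σ.active.filter fun q => q.2 ∈ V.toFinset) := by
      rintro ⟨x, y⟩ hq
      simp only [Finset.mem_union, Finset.mem_filter, hq, true_and, List.mem_toFinset]
      rw [Branch.mem_active, adj_iff] at hq ⊢
      rw [hm, hm]
      have := hq.1
      simp only [SubexpCSP.addLits, this, true_and]
      tauto
    have h₃ := (Finset.card_le_card h₂).trans ((Finset.card_union_le _ _).trans
      (Nat.add_le_add_left (Finset.card_union_le _ _) _))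
    have h₄ := h.card_active_filter_le V.toFinset
    have h₅ := h.card_active_filter_snd_le V.toFinset
    rw [List.toFinset_card_of_nodup hn] at h₄ h₅
    unfold Branch.progress
    rw [h₁]
    nlinarith

lemma mem_addPairs {n : ℕ} {σ : Branch} {V : List (Lit × Lit)} (hV : ∀ q ∈ V, q ∈ litPairs n)
    (h : ∀ q ∈ σ.2, q ∈ litPairs n) {q : Lit × Lit} :
    q ∈ (addPairs n σ V).2 ↔ q ∈ σ.2 ∨ q ∈ V := by
  simp only [addPairs, List.mem_filter, Bool.or_eq_true, decide_eq_true_eq]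
  exact ⟨fun h => h.2, fun h' => ⟨h'.elim (h q) (hV q), h'⟩⟩

/-- All pairs in `V` are new and active, so each counts. The degree bound survives since a literal
has at most `s` old partners and receives at most `s` new ones. -/
lemma Branch.Good.addPairs {n s : ℕ} {σ : Branch} (h : σ.Good n s) {V : List (Lit × Lit)}
    (hV : ∀ q ∈ V, q ∈ litPairs n) (hs : ∀ x y, (x, y) ∈ V → (y, x) ∈ V)
    (hd : ∀ x y, (x, y) ∈ V → (x, y) ∉ σ.2 ∧ x ∉ σ.1 ∧ y ∉ σ.1)
    (hdeg : ∀ x, (nbr₂ n σ x).length ≤ s)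
    (hrow : ∀ x, (V.toFinset.filter fun q => q.1 = x).card ≤ s) :
    (addPairs n σ V).Good n s ∧
      σ.progress s + V.toFinset.card ≤ (SubexpCSP.addPairs n σ V).progress s := by
  have hm := fun q => mem_addPairs (q := q) hV h.pairs_sub
  refine ⟨⟨h.lits_sub, h.nodup, fun x hx => (List.mem_filter.1 hx).1, ?_, fun x y => ?_,
    fun x => ?_⟩, ?_⟩
  · rw [← length_litPairs]
    exact List.length_filter_le _ _
  · rw [hm, hm]
    exact Or.imp (h.symm x y) (hs x y)
  · rw [← List.toFinset_card_of_nodup (nodup_nbr₂ n _ x)]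
    have : (nbr₂ n (SubexpCSP.addPairs n σ V) x).toFinset ⊆ (nbr₂ n σ x).toFinset ∪
        (V.toFinset.filter fun q => q.1 = x).image Prod.snd := by
      intro y hy
      simp only [nbr₂, List.mem_toFinset, List.mem_filter, adj_iff, hm] at hy
      simp only [Finset.mem_union, nbr₂, List.mem_toFinset, List.mem_filter, adj_iff,
        Finset.mem_image, Finset.mem_filter]
      rcases hy with ⟨hy, hy' | hy', hx⟩
      · exact .inl ⟨hy, hy', hx⟩
      · exact .inr ⟨(x, y), ⟨hy', rfl⟩, rfl⟩
    have h₁ := (Finset.card_le_card this).trans (Finset.card_union_le _ _)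
    have h₂ := (Finset.card_image_le (f := Prod.snd)
      (s := V.toFinset.filter fun q => q.1 = x)).trans (hrow x)
    rw [List.toFinset_card_of_nodup (nodup_nbr₂ n σ x)] at h₁
    have := hdeg x
    omega
  · have h₁ : σ.active ∪ V.toFinset ⊆ (SubexpCSP.addPairs n σ V).active := by
      rintro ⟨x, y⟩ hq
      simp only [Finset.mem_union, Branch.mem_active, adj_iff, List.mem_toFinset, hm] at hq ⊢
      rcases hq with hq | hq
      · exact ⟨.inl hq.1, hq.2⟩
      · exact ⟨.inr hq, (hd x y hq).2⟩
    have h₂ : Disjoint σ.active V.toFinset := by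
      rw [Finset.disjoint_left]
      rintro ⟨x, y⟩ hq hq'
      rw [Branch.mem_active, adj_iff] at hq
      exact (hd x y (List.mem_toFinset.1 hq')).1 hq.1
    have h₃ := Finset.card_le_card h₁
    rw [Finset.card_union_of_disjoint h₂] at h₃
    unfold Branch.progress
    have : (SubexpCSP.addPairs n σ V).1 = σ.1 := rfl
    rw [this]
    omega

lemma sat_addLits {n : ℕ} {Th : List Triple} {σ : Branch} {V : List Lit} {τ : ℕ → Bool}
    (hV : ∀ x ∈ V, x ∈ lits n) (h : ∀ x ∈ σ.1, x ∈ lits n) :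
    (addLits n σ V).Sat Th τ ↔ σ.Sat Th τ ∧ ∀ x ∈ V, Lit.Holds τ x := by
  have hm := fun x => mem_addLits (x := x) hV h
  refine ⟨fun hs => ⟨⟨hs.triples, fun x hx => hs.lits x ((hm x).2 (.inl hx)), hs.pairs⟩,
    fun x hx => hs.lits x ((hm x).2 (.inr hx))⟩, fun ⟨hs, hs'⟩ => ⟨hs.triples, fun x hx => ?_,
    hs.pairs⟩⟩
  exact ((hm x).1 hx).elim (hs.lits x) (hs' x)

lemma sat_addPairs {n : ℕ} {Th : List Triple} {σ : Branch} {V : List (Lit × Lit)} {τ : ℕ → Bool}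
    (hV : ∀ q ∈ V, q ∈ litPairs n) (h : ∀ q ∈ σ.2, q ∈ litPairs n) :
    (addPairs n σ V).Sat Th τ ↔
      σ.Sat Th τ ∧ ∀ q ∈ V, Lit.Holds τ q.1 ∨ Lit.Holds τ q.2 := by
  have hm := fun q => mem_addPairs (q := q) hV h
  refine ⟨fun hs => ⟨⟨hs.triples, hs.lits, fun x hx => hs.pairs x ((hm x).2 (.inl hx))⟩,
    fun x hx => hs.pairs x ((hm x).2 (.inr hx))⟩, fun ⟨hs, hs'⟩ => ⟨hs.triples, hs.lits,
    fun x hx => ?_⟩⟩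
  exact ((hm x).1 hx).elim (hs.pairs x) (hs' x)

/-! ### The three branching rules -/

/-- All literals of the clauses are over the variables below `n`. -/
def TripleVars (n : ℕ) (Th : List Triple) : Prop :=
  ∀ t ∈ Th, t.1 ∈ lits n ∧ t.2.1 ∈ lits n ∧ t.2.2 ∈ lits n

/-- The properties of a branching. -/
structure IsBranching (n s : ℕ) (Th : List Triple) (σ : Branch) (c : Branch × Branch) : Prop where
  good_fst : c.1.Good n s
  good_snd : c.2.Good n s
  progress_fst : σ.progress s + 1 ≤ c.1.progress s
  progress_snd : σ.progress s + s * s ≤ c.2.progress s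
  sat_iff : ∀ τ, σ.Sat Th τ ↔ c.1.Sat Th τ ∨ c.2.Sat Th τ

/-- If `x` is false, then all its partners must be true. One new literal gains `s`, and at least `s`
of them gain `s * s`. -/
lemma Branch.Good.isBranching₂ {n s : ℕ} {Th : List Triple} {σ : Branch} (h : σ.Good n s)
    (hs : 2 ≤ s) {c : Branch × Branch} (hc : c ∈ branch₂ n s σ) : IsBranching n s Th σ c := by
  simp only [branch₂, List.mem_flatMap, decide_eq_true_eq] at hc
  obtain ⟨x, hx, hc⟩ := hc
  split at hc
  case isFalse => simp at hc
  case isTrue hl =>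
    obtain rfl := List.mem_singleton.1 hc
    have hV : ∀ y ∈ nbr₂ n σ x, y ∈ SubexpCSP.lits n := fun y hy => (List.mem_filter.1 hy).1
    have hV' : ∀ y ∈ [x], y ∈ SubexpCSP.lits n := by simpa using hx
    have ha : ∀ y ∈ nbr₂ n σ x, (x, y) ∈ σ.2 ∧ x ∉ σ.1 ∧ y ∉ σ.1 :=
      fun y hy => adj_iff.1 (List.mem_filter.1 hy).2
    obtain ⟨y₀, hy₀⟩ := List.exists_mem_of_length_pos (by omega : 0 < (nbr₂ n σ x).length)
    obtain ⟨g₁, p₁⟩ := h.addLits hV' (List.nodup_singleton x) (by simpa using (ha _ hy₀).2.1)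
    obtain ⟨g₂, p₂⟩ := h.addLits hV (nodup_nbr₂ n σ x) fun y hy => (ha y hy).2.2
    refine ⟨g₁, g₂, ?_, ?_, fun τ => ?_⟩
    · rw [List.length_singleton, mul_one] at p₁
      exact le_trans (by omega) p₁
    · exact (Nat.add_le_add_left (Nat.mul_le_mul_left s hl) _).trans p₂
    · rw [sat_addLits hV' h.lits_sub, sat_addLits hV h.lits_sub]
      refine ⟨fun hσ => ?_, fun hσ => hσ.elim And.left And.left⟩
      by_cases hτ : Lit.Holds τ x
      · exact .inl ⟨hσ, by simpa using hτ⟩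
      · exact .inr ⟨hσ, fun y hy => (hσ.pairs _ (ha y hy).1).resolve_left hτ⟩

lemma Branch.Good.length_nbr₂_lt {n s : ℕ} {σ : Branch} (h : σ.Good n s) (hs : 0 < s)
    (hb : branch₂ n s σ = []) (x : Lit) : (nbr₂ n σ x).length < s := by
  by_cases hx : x ∈ SubexpCSP.lits n
  · have := List.flatMap_eq_nil_iff.1 hb x hx
    simpa using this
  · rw [nbr₂, List.filter_eq_nil_iff.2]
    · exact hs
    · intro y _ hy
      exact hx (mem_litPairs.1 (h.pairs_sub _ (adj_iff.1 hy).1)).1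

lemma length_nbr₃_lt {n s : ℕ} {Th : List Triple} {σ : Branch} (hT : TripleVars n Th)
    (hs : 0 < s) (hb : branch₃ n s Th σ = []) (x y : Lit) : (nbr₃ n Th σ x y).length < s := by
  by_cases hx : (x, y) ∈ litPairs n
  · have := List.flatMap_eq_nil_iff.1 hb (x, y) hx
    simpa using this
  · rw [nbr₃, List.filter_eq_nil_iff.2]
    · exact hs
    · intro z _ hz
      have := hT _ (act_iff.1 hz).1
      exact hx (mem_litPairs.2 ⟨this.1, this.2.1⟩)

lemma length_nbrPairs_lt {n s : ℕ} {Th : List Triple} {σ : Branch} (hT : TripleVars n Th)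
    (hs : 0 < s) (hb : branch₁ n s Th σ = []) (x : Lit) :
    (nbrPairs n Th σ x).length < s * s := by
  by_cases hx : x ∈ SubexpCSP.lits n
  · have := List.flatMap_eq_nil_iff.1 hb x hx
    simpa using this
  · rw [nbrPairs, List.filter_eq_nil_iff.2]
    · exact Nat.mul_pos hs hs
    · intro y _ hy
      exact hx (hT _ (act_iff.1 hy).1).1

/-- If `x ∨ y` fails, then all third literals must be true. The first side adds `x ∨ y` in both
orders; the failure of the first rule leaves room below `2 * s` for these at most two entries,
whence `2 ≤ s`. -/
lemma Branch.Good.isBranching₃ {n s : ℕ} {Th : List Triple} {σ : Branch} (h : σ.Good n s)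
    (hs : 2 ≤ s) (hb : branch₂ n s σ = []) {c : Branch × Branch}
    (hc : c ∈ branch₃ n s Th σ) : IsBranching n s Th σ c := by
  simp only [branch₃, List.mem_flatMap, decide_eq_true_eq] at hc
  obtain ⟨⟨x, y⟩, hxy, hc⟩ := hc
  have hxy' := mem_litPairs.1 hxy
  split at hc
  case isFalse => simp at hc
  case isTrue hl =>
    obtain rfl := List.mem_singleton.1 hc
    have hV : ∀ z ∈ nbr₃ n Th σ x y, z ∈ SubexpCSP.lits n := fun z hz => (List.mem_filter.1 hz).1
    have hV' : ∀ q ∈ [(x, y), (y, x)], q ∈ litPairs n := by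
      simp [mem_litPairs, hxy'.1, hxy'.2]
    have ha : ∀ z ∈ nbr₃ n Th σ x y, _ := fun z hz => act_iff.1 (List.mem_filter.1 hz).2
    obtain ⟨z₀, hz₀⟩ :=
      List.exists_mem_of_length_pos (by simp only at hl; omega : 0 < (nbr₃ n Th σ x y).length)
    obtain ⟨-, ⟨hx, hy, -⟩, hP, -⟩ := ha z₀ hz₀
    have hP' : (y, x) ∉ σ.2 := fun h' => hP (h.symm _ _ h')
    obtain ⟨g₁, p₁⟩ := h.addPairs hV' (by simp; tauto) (by
        intro u v huv
        simp only [List.mem_cons, Prod.mk.injEq, List.not_mem_nil, or_false] at huv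
        rcases huv with ⟨rfl, rfl⟩ | ⟨rfl, rfl⟩
        · exact ⟨hP, hx, hy⟩
        · exact ⟨hP', hy, hx⟩) (fun u => (h.length_nbr₂_lt (by omega) hb u).le) (fun u =>
      (Finset.card_filter_le _ _).trans ((List.toFinset_card_le _).trans hs))
    obtain ⟨g₂, p₂⟩ := h.addLits hV ((nodup_lits n).filter _) fun z hz => (ha z hz).2.1.2.2
    refine ⟨g₁, g₂, ?_, ?_, fun τ => ?_⟩
    · refine (Nat.add_le_add_left (Finset.card_pos.2 ⟨(x, y), ?_⟩) _).trans p₁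
      simp
    · exact (Nat.add_le_add_left (Nat.mul_le_mul_left s hl) _).trans p₂
    · rw [sat_addPairs hV' h.pairs_sub, sat_addLits hV h.lits_sub]
      refine ⟨fun hσ => ?_, fun hσ => hσ.elim And.left And.left⟩
      by_cases hτ : Lit.Holds τ x ∨ Lit.Holds τ y
      · exact .inl ⟨hσ, by simp; tauto⟩
      · refine .inr ⟨hσ, fun z hz => ?_⟩
        have := hσ.triples _ (ha z hz).1
        simp only [Triple.Holds] at this
        tauto

lemma act_comm {Th : List Triple} (hT : PermClosed Th) {σ : Branch}
    (hσ : ∀ x y, (x, y) ∈ σ.2 → (y, x) ∈ σ.2) {x y z : Lit} (h : act Th σ x y z = true) :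
    act Th σ x z y = true := by
  rw [act_iff] at h ⊢
  obtain ⟨h₁, ⟨h₂, h₃, h₄⟩, h₅, h₆, h₇⟩ := h
  exact ⟨hT.swap _ _ _ h₁, ⟨h₂, h₄, h₃⟩, h₆, h₅, fun h => h₇ (hσ _ _ h)⟩

/-- If `x` is false, then all remainders `y ∨ z` must hold. Here the order of the rules matters: as
the second rule fails, a literal `u` is in fewer than `s` of the remainders, and as the first fails,
it has fewer than `s` partners already. -/
lemma Branch.Good.isBranching₁ {n s : ℕ} {Th : List Triple} {σ : Branch} (h : σ.Good n s)
    (hs : 2 ≤ s) (hp : PermClosed Th) (hT : TripleVars n Th) (hb : branch₂ n s σ = [])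
    (hb' : branch₃ n s Th σ = []) {c : Branch × Branch} (hc : c ∈ branch₁ n s Th σ) :
    IsBranching n s Th σ c := by
  simp only [branch₁, List.mem_flatMap, decide_eq_true_eq] at hc
  obtain ⟨x, hx, hc⟩ := hc
  split at hc
  case isFalse => simp at hc
  case isTrue hl =>
    obtain rfl := List.mem_singleton.1 hc
    have hV : ∀ q ∈ nbrPairs n Th σ x, q ∈ litPairs n := fun q hq => (List.mem_filter.1 hq).1
    have hV' : ∀ y ∈ [x], y ∈ SubexpCSP.lits n := by simpa using hx
    have hn : (nbrPairs n Th σ x).Nodup := (nodup_litPairs n).filter _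
    have ha : ∀ q ∈ nbrPairs n Th σ x, _ := fun q hq => act_iff.1 (List.mem_filter.1 hq).2
    have hpos : 0 < s * s := by positivity
    obtain ⟨q₀, hq₀⟩ :=
      List.exists_mem_of_length_pos (hpos.trans_le hl : 0 < (nbrPairs n Th σ x).length)
    obtain ⟨g₁, p₁⟩ := h.addLits hV' (List.nodup_singleton x) (by simpa using (ha _ hq₀).2.1.1)
    obtain ⟨g₂, p₂⟩ := h.addPairs hV (by
        intro y z hyz
        have h' := mem_litPairs.1 (hV _ hyz)
        exact List.mem_filter.2 ⟨mem_litPairs.2 ⟨h'.2, h'.1⟩,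
          act_comm hp h.symm (List.mem_filter.1 hyz).2⟩) (by
        intro y z hyz
        exact ⟨(ha _ hyz).2.2.2.2, (ha _ hyz).2.1.2⟩)
      (fun u => (h.length_nbr₂_lt (by omega) hb u).le) (fun u => by
        refine le_trans ?_ (length_nbr₃_lt hT (by omega) hb' x u).le
        rw [← List.toFinset_card_of_nodup (l := nbr₃ n Th σ x u) ((nodup_lits n).filter _)]
        refine (Finset.card_le_card ?_).trans (Finset.card_image_le (f := fun z => (u, z)))
        rintro ⟨y, z⟩ hyz
        simp only [Finset.mem_filter, List.mem_toFinset] at hyz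
        obtain ⟨hyz, rfl⟩ := hyz
        have := List.mem_filter.1 hyz
        simp [nbr₃, this.2, (mem_litPairs.1 this.1).2])
    rw [List.toFinset_card_of_nodup hn] at p₂
    refine ⟨g₁, g₂, ?_, ?_, fun τ => ?_⟩
    · rw [List.length_singleton, mul_one] at p₁
      exact le_trans (by omega) p₁
    · exact (Nat.add_le_add_left hl _).trans p₂
    · rw [sat_addLits hV' h.lits_sub, sat_addPairs hV h.pairs_sub]
      refine ⟨fun hσ => ?_, fun hσ => hσ.elim And.left And.left⟩
      by_cases hτ : Lit.Holds τ x
      · exact .inl ⟨hσ, by simpa using hτ⟩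
      · exact .inr ⟨hσ, fun q hq => (hσ.triples _ (ha q hq).1).resolve_left hτ⟩

lemma Branch.Good.isBranching {n s : ℕ} {Th : List Triple} {σ : Branch} (h : σ.Good n s)
    (hs : 2 ≤ s) (hp : PermClosed Th) (hT : TripleVars n Th) {c : Branch × Branch}
    {l : List (Branch × Branch)} (hc : branchings n s Th σ = c :: l) :
    IsBranching n s Th σ c := by
  rw [branchings] at hc
  by_cases hb : branch₂ n s σ = []
  · rw [hb, List.nil_append] at hc
    by_cases hb' : branch₃ n s Th σ = []
    · rw [hb', List.nil_append] at hc
      exact h.isBranching₁ hs hp hT hb hb' (hc ▸ List.mem_cons_self)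
    · obtain ⟨d, m, hd⟩ := List.exists_cons_of_ne_nil hb'
      rw [hd, List.cons_append] at hc
      obtain ⟨rfl, -⟩ := List.cons.inj hc
      exact h.isBranching₃ hs hb (hd ▸ List.mem_cons_self)
  · obtain ⟨d, m, hd⟩ := List.exists_cons_of_ne_nil hb
    rw [hd, List.cons_append] at hc
    obtain ⟨rfl, -⟩ := List.cons.inj hc
    exact h.isBranching₂ hs (hd ▸ List.mem_cons_self)

/-! ### The sparse formulas at the leaves -/

lemma length_flatMap_le {α β : Type} {l : List α} {f : α → List β} {k : ℕ}
    (h : ∀ x ∈ l, (f x).length ≤ k) : (l.flatMap f).length ≤ l.length * k := by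
  rw [List.length_flatMap]
  have := List.sum_le_card_nsmul (l.map fun x => (f x).length) k (by simpa using h)
  simpa using this

/-- Where no rule applies, each of the `2 * n` literals begins at most `s` listed pairs and at most
`s * s` listed triples; the required literals add another `2 * n`. -/
lemma Branch.Good.length_sparseClauses_le {n s : ℕ} {Th : List Triple} {σ : Branch}
    (h : σ.Good n s) (hs : 0 < s) (hT : TripleVars n Th) (hc : branchings n s Th σ = []) :
    (sparseClauses n Th σ).length ≤ 2 * n * (1 + s + s * s) := by
  obtain ⟨h₂, h₃, h₁⟩ : branch₂ n s σ = [] ∧ branch₃ n s Th σ = [] ∧ branch₁ n s Th σ = [] := by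
    simpa [branchings] using hc
  have e₁ : σ.1.length ≤ 2 * n := by
    rw [← length_lits]
    exact (List.subperm_of_subset h.nodup h.lits_sub).length_le
  have e₂ := length_flatMap_le (l := SubexpCSP.lits n)
    (f := fun x => (nbr₂ n σ x).map fun y => (x, x, y)) (k := s)
    (fun x _ => by simpa using (h.length_nbr₂_lt hs h₂ x).le)
  have e₃ := length_flatMap_le (l := SubexpCSP.lits n)
    (f := fun x => (nbrPairs n Th σ x).map fun q => (x, q.1, q.2)) (k := s * s)
    (fun x _ => by simpa using (length_nbrPairs_lt hT hs h₁ x).le)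
  rw [length_lits] at e₂ e₃
  simp only [sparseClauses, List.length_append, List.length_map]
  rw [mul_add, mul_add, mul_one]
  omega

/-- The omitted clauses are implied by the listed ones: an inactive pair contains a required
literal, and an inactive triple contains a required literal or an added pair. -/
lemma Branch.Good.sat_iff {n s : ℕ} {Th : List Triple} {σ : Branch} (h : σ.Good n s)
    (hT : TripleVars n Th) (τ : ℕ → Bool) :
    σ.Sat Th τ ↔ ∀ t ∈ sparseClauses n Th σ, Triple.Holds τ t := by
  have hm : ∀ t, t ∈ sparseClauses n Th σ ↔ (∃ x ∈ σ.1, (x, x, x) = t) ∨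
      (∃ x y, adj σ x y = true ∧ (x, x, y) = t) ∨
      ∃ x y z, act Th σ x y z = true ∧ (x, y, z) = t := by
    intro t
    simp only [sparseClauses, List.mem_append, List.mem_map, List.mem_flatMap, nbr₂, nbrPairs,
      List.mem_filter]
    refine or_congr Iff.rfl (or_congr ⟨?_, ?_⟩ ⟨?_, ?_⟩)
    · rintro ⟨x, -, y, ⟨-, h'⟩, e⟩
      exact ⟨x, y, h', e⟩
    · rintro ⟨x, y, h', e⟩
      have := mem_litPairs.1 (h.pairs_sub _ (adj_iff.1 h').1)
      exact ⟨x, this.1, y, ⟨this.2, h'⟩, e⟩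
    · rintro ⟨x, -, q, ⟨-, h'⟩, e⟩
      exact ⟨x, q.1, q.2, h', e⟩
    · rintro ⟨x, y, z, h', e⟩
      have := hT _ (act_iff.1 h').1
      exact ⟨x, this.1, (y, z), ⟨mem_litPairs.2 this.2, h'⟩, e⟩
  constructor
  · intro hσ t ht
    rcases (hm t).1 ht with ⟨x, hx, rfl⟩ | ⟨x, y, hxy, rfl⟩ | ⟨x, y, z, hxyz, rfl⟩
    · exact .inl (hσ.lits x hx)
    · exact (hσ.pairs _ (adj_iff.1 hxy).1).elim .inl fun h => .inr (.inr h)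
    · exact hσ.triples _ (act_iff.1 hxyz).1
  · intro hσ
    have h₁ : ∀ x ∈ σ.1, Lit.Holds τ x := fun x hx => by
      simpa [Triple.Holds] using hσ _ ((hm _).2 (.inl ⟨x, hx, rfl⟩))
    have h₂ : ∀ x y, (x, y) ∈ σ.2 → Lit.Holds τ x ∨ Lit.Holds τ y := fun x y hxy => by
      by_cases hx : x ∈ σ.1
      · exact .inl (h₁ x hx)
      by_cases hy : y ∈ σ.1
      · exact .inr (h₁ y hy)
      simpa [Triple.Holds] using
        hσ _ ((hm _).2 (.inr (.inl ⟨x, y, adj_iff.2 ⟨hxy, hx, hy⟩, rfl⟩)))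
    refine ⟨fun ⟨x, y, z⟩ ht => ?_, h₁, fun q hq => h₂ q.1 q.2 hq⟩
    by_cases ha : act Th σ x y z = true
    · exact hσ _ ((hm _).2 (.inr (.inr ⟨x, y, z, ha, rfl⟩)))
    · by_contra hn
      simp only [Triple.Holds, not_or] at hn
      exact ha (act_iff.2 ⟨ht, ⟨fun h => hn.1 (h₁ x h), fun h => hn.2.1 (h₁ y h),
        fun h => hn.2.2 (h₁ z h)⟩, fun h => (h₂ x y h).elim hn.1 hn.2.1,
        fun h => (h₂ x z h).elim hn.1 hn.2.2, fun h => (h₂ y z h).elim hn.2.1 hn.2.2⟩)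

/-! ## CSP instances over natural numbers -/

lemma codeList_map {α β : Type} (f : α → β) (g : β → Data) (l : List α) :
    codeList g (l.map f) = codeList (fun x => g (f x)) l := by
  induction l with
  | nil => rfl
  | cons x l ih => simp only [List.map_cons, codeList, ih]

/-- A scope and a list of tuples. -/
abbrev RawConstraint : Type := List ℕ × List (List ℕ)

/-- The conditions under which a list of constraints is an instance with `N` variables and `d`
values. -/
structure RawValid (N d : ℕ) (cs : List RawConstraint) : Prop where
  scope_ne_nil : ∀ c ∈ cs, c.1 ≠ []
  scope_nodup : ∀ c ∈ cs, c.1.Nodup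
  scope_lt : ∀ c ∈ cs, ∀ x ∈ c.1, x < N
  rel_nodup : ∀ c ∈ cs, c.2.Nodup
  rel_lt : ∀ c ∈ cs, ∀ t ∈ c.2, ∀ v ∈ t, v < d
  length_eq : ∀ c ∈ cs, ∀ t ∈ c.2, t.length = c.1.length
  distinct : cs.Pairwise fun c c' => ¬ (c.1 = c'.1 ∧ ∀ t, t ∈ c.2 ↔ t ∈ c'.2)
  var_occurs : ∀ x < N, ∃ c ∈ cs, x ∈ c.1
  val_occurs : ∀ v < d, ∃ c ∈ cs, ∃ t ∈ c.2, v ∈ t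

/-- The underlying scope and list of tuples. -/
def Constraint.raw {n d : ℕ} (C : Constraint n d) : RawConstraint :=
  (C.scope.map Fin.val, C.rel.map (List.map Fin.val))

lemma Constraint.code_eq {n d : ℕ} (C : Constraint n d) : C.code = enc C.raw := by
  simp only [Constraint.code, Constraint.raw, enc, Enc.code, codeList_map]

lemma exists_map_eq {α β : Type} {f : α → β} :
    ∀ {l : List β}, (∀ b ∈ l, ∃ a, f a = b) → ∃ l' : List α, l'.map f = l
  | [], _ => ⟨[], rfl⟩
  | b :: l, h => by
      obtain ⟨a, ha⟩ := h b List.mem_cons_self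
      obtain ⟨l', hl'⟩ := exists_map_eq fun b hb => h b (List.mem_cons_of_mem _ hb)
      exact ⟨a :: l', by simp [ha, hl']⟩

lemma map_val_injective {d : ℕ} : Function.Injective (List.map (Fin.val : Fin d → ℕ)) :=
  List.map_injective_iff.2 Fin.val_injective

lemma RawValid.exists_constraint {N d : ℕ} {cs : List RawConstraint} (h : RawValid N d cs)
    {c : RawConstraint} (hc : c ∈ cs) : ∃ C : Constraint N d, C.raw = c := by
  obtain ⟨s, hs⟩ := exists_map_eq (f := (Fin.val : Fin N → ℕ)) (l := c.1)
    fun x hx => ⟨⟨x, h.scope_lt c hc x hx⟩, rfl⟩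
  obtain ⟨r, hr⟩ := exists_map_eq (f := List.map (Fin.val : Fin d → ℕ)) (l := c.2)
    fun t ht => exists_map_eq fun v hv => ⟨⟨v, h.rel_lt c hc t ht v hv⟩, rfl⟩
  refine ⟨⟨s, ?_, ?_, r, ?_, fun t ht => ?_⟩, Prod.ext hs hr⟩
  · rintro rfl
    exact h.scope_ne_nil c hc hs.symm
  · exact List.Nodup.of_map Fin.val (hs ▸ h.scope_nodup c hc)
  · exact List.Nodup.of_map (List.map Fin.val) (hr ▸ h.rel_nodup c hc)
  · have := h.length_eq c hc (t.map Fin.val) (hr ▸ List.mem_map_of_mem ht)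
    rwa [← hs, List.length_map, List.length_map] at this

lemma Constraint.satisfiedBy_iff {n d : ℕ} {C : Constraint n d} {τ : Fin n → Fin d} {τ' : ℕ → ℕ}
    (h : ∀ x, τ' x.val = (τ x).val) : C.SatisfiedBy τ ↔ C.raw.1.map τ' ∈ C.raw.2 := by
  have e : (C.scope.map Fin.val).map τ' = (C.scope.map τ).map Fin.val := by
    simp [h]
  rw [Constraint.raw, e, List.mem_map_of_injective map_val_injective, Constraint.SatisfiedBy]

/-- Instances with bounded indices are awkward to compute with. Encodings only see the underlying
numbers, so an algorithm may produce lists of numbers, and the typed instance is recovered here with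
the same code. -/
lemma RawValid.exists_csp {N d : ℕ} {cs : List RawConstraint} (h : RawValid N d cs) :
    ∃ I : CSP, I.vars = N ∧ I.dom = d ∧ I.code = enc (N, d, cs) ∧
      I.arity = (cs.map fun c => c.1.length).foldr max 0 ∧
      (I.Satisfiable ↔ ∃ τ : ℕ → ℕ, (∀ x < N, τ x < d) ∧ ∀ c ∈ cs, c.1.map τ ∈ c.2) := by
  obtain ⟨L, rfl⟩ := exists_map_eq (f := Constraint.raw) (l := cs)
    fun c hc => h.exists_constraint hc
  refine ⟨⟨N, d, L, ?_, fun x => ?_, fun v => ?_⟩, rfl, rfl, ?_, ?_, ?_⟩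
  · have := h.distinct
    rw [List.pairwise_map] at this
    refine this.imp fun {C C'} hC hS => hC ⟨congrArg (List.map Fin.val) hS.1, fun t => ?_⟩
    simp only [Constraint.raw, List.mem_map, hS.2]
  · obtain ⟨c, hc, hx⟩ := h.var_occurs x.val x.isLt
    obtain ⟨C, hC, rfl⟩ := List.mem_map.1 hc
    exact ⟨C, hC, (List.mem_map_of_injective Fin.val_injective).1 hx⟩
  · obtain ⟨c, hc, t, ht, hv⟩ := h.val_occurs v.val v.isLt
    obtain ⟨C, hC, rfl⟩ := List.mem_map.1 hc
    obtain ⟨t, ht', rfl⟩ := List.mem_map.1 ht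
    exact ⟨C, hC, t, ht',
      (List.mem_map_of_injective Fin.val_injective).1 hv⟩
  · simp only [CSP.code, enc, Enc.code, codeList_map]
    refine congrArg (Data.cons _) (congrArg (Data.cons _) (congrFun (congrArg _ ?_) _))
    exact funext fun C => C.code_eq
  · simp [CSP.arity, Constraint.raw, Function.comp_def]
  · constructor
    · rintro ⟨τ, hτ⟩
      refine ⟨fun x => if hx : x < N then (τ ⟨x, hx⟩).val else 0, fun x hx => ?_, fun c hc => ?_⟩
      · simp [hx]
      · obtain ⟨C, hC, rfl⟩ := List.mem_map.1 hc
        exact (Constraint.satisfiedBy_iff (by simp)).1 (hτ C hC)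
    · rintro ⟨τ, hτ, hc⟩
      exact ⟨fun x => ⟨τ x, hτ x x.isLt⟩, fun C hC =>
        (Constraint.satisfiedBy_iff fun _ => rfl).2 (hc _ (List.mem_map_of_mem hC))⟩

/-! ## From sparse formulas to constraint satisfaction -/

/-- The tuples `[v, w]` with `v < 3` and `w < 2` such that `w` is the truth value `b` if `v = p`. -/
def litTable (p : ℕ) (b : Bool) : List (List ℕ) :=
  [[0, 0], [0, 1], [1, 0], [1, 1], [2, 0], [2, 1]].filter fun t => t != [p, 1 - b.toNat]

/-- If the variable `i` has value `p`, then the literal `x` is true; the variables of the formula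
are shifted by `a`. -/
def litConstraint (a i p : ℕ) (x : Lit) : RawConstraint :=
  ([i, a + x.1], if x.2 = true then litTable p true else litTable p false)

/-- The variable `i` chooses a true literal of the clause. -/
def clauseConstraints (a i : ℕ) (t : Triple) : List RawConstraint :=
  [litConstraint a i 0 t.1, litConstraint a i 1 t.2.1, litConstraint a i 2 t.2.2]

/-- A constraint of arity `a` in which all `d` values occur. -/
def wideConstraint (a d : ℕ) : RawConstraint :=
  (List.range a, (List.range d).map fun v => List.replicate a v)

/-- The constraints for a formula with clauses `ts`. -/
def formulaConstraints (a d n : ℕ) (ts : List Triple) : List RawConstraint :=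
  wideConstraint a d :: (natFlat (fun x => [([a + x], [[0], [1]])]) n ++
    flatTails (fun t rest => clauseConstraints a (a + n + rest.length) t) ts)

lemma mem_natFlat {γ : Type} {g : ℕ → List γ} {n : ℕ} {c : γ} :
    c ∈ natFlat g n ↔ ∃ x < n, c ∈ g x := by
  induction n with
  | zero => simp [natFlat]
  | succ n ih =>
    simp only [natFlat, List.mem_append, ih, Nat.lt_succ_iff_lt_or_eq]
    constructor
    · rintro (h | ⟨x, hx, h⟩)
      · exact ⟨n, .inr rfl, h⟩
      · exact ⟨x, .inl hx, h⟩
    · rintro ⟨x, hx | rfl, h⟩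
      · exact .inr ⟨x, hx, h⟩
      · exact .inl h

/-- Elements are numbered by how many follow them, that is, from the end of the list; hence the
reversal. -/
lemma mem_flatTails {β γ : Type} {g : ℕ → β → List γ} {l : List β} {c : γ} :
    c ∈ flatTails (fun t rest => g rest.length t) l ↔
      ∃ j t, l.reverse[j]? = some t ∧ c ∈ g j t := by
  induction l with
  | nil => simp [flatTails]
  | cons b l ih =>
    simp only [flatTails, List.mem_append, ih, List.reverse_cons]
    constructor
    · rintro (h | ⟨j, t, hj, h⟩)
      · exact ⟨l.length, b, by simp, h⟩
      · refine ⟨j, t, ?_, h⟩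
        rw [List.getElem?_append_left (List.getElem?_eq_some_iff.1 hj).1, hj]
    · rintro ⟨j, t, hj, h⟩
      rw [List.getElem?_append] at hj
      split at hj
      · exact .inr ⟨j, t, hj, h⟩
      · obtain ⟨hl, rfl⟩ := List.getElem?_eq_some_iff.1 hj
        have : j = l.length := by
          rw [List.length_reverse, List.length_singleton] at *
          omega
        subst this
        exact .inl (by simpa using h)

/-- The constraints of an instance must be distinct, but repeated literals in a clause such as `(x,
x, x)` give equal scopes. The tables differ, as `[p, 1 - b.toNat]` is missing from the table for `p`
only. -/
lemma litTable_distinct : ∀ p < 3, ∀ p' < 3, p ≠ p' → ∀ b b',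
    ∃ t, ¬ (t ∈ litTable p b ↔ t ∈ litTable p' b') := by
  intro p hp p' hp' h b b'
  refine ⟨[p, 1 - b.toNat], ?_⟩
  revert h
  interval_cases p <;> interval_cases p' <;> cases b <;> cases b' <;> decide

lemma mem_litTable {p v w : ℕ} {b : Bool} :
    [v, w] ∈ litTable p b ↔ v < 3 ∧ w < 2 ∧ (v = p → w = b.toNat) := by
  simp only [litTable, List.mem_filter, List.mem_cons, List.cons.injEq, and_true,
    List.not_mem_nil, or_false, bne_iff_ne, ne_eq]
  cases b <;> simp <;> omega

lemma litConstraint_snd (a i p : ℕ) (x : Lit) :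
    (litConstraint a i p x).2 = litTable p x.2 := by
  rcases x with ⟨x, _ | _⟩ <;> rfl

lemma mem_litTable_elim {p : ℕ} {b : Bool} {t : List ℕ} (h : t ∈ litTable p b) :
    t.length = 2 ∧ ∀ v ∈ t, v < 3 := by
  have := (List.mem_filter.1 h).1
  simp only [List.mem_cons, List.not_mem_nil, or_false] at this
  rcases this with rfl | rfl | rfl | rfl | rfl | rfl <;> simp

lemma pairwise_natFlat {γ : Type} {R : γ → γ → Prop} {g : ℕ → List γ}
    (h₁ : ∀ i, (g i).Pairwise R) (h₂ : ∀ i j, i < j → ∀ x ∈ g j, ∀ y ∈ g i, R x y) (n : ℕ) :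
    (natFlat g n).Pairwise R := by
  induction n with
  | zero => exact .nil
  | succ n ih =>
    refine List.pairwise_append.2 ⟨h₁ n, ih, fun x hx y hy => ?_⟩
    obtain ⟨i, hi, hy⟩ := mem_natFlat.1 hy
    exact h₂ i n hi x hx y hy

lemma pairwise_flatTails {β γ : Type} {R : γ → γ → Prop} {g : ℕ → β → List γ}
    (h₁ : ∀ i t, (g i t).Pairwise R)
    (h₂ : ∀ i j t t', i < j → ∀ x ∈ g j t, ∀ y ∈ g i t', R x y) (l : List β) :
    (flatTails (fun t rest => g rest.length t) l).Pairwise R := by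
  induction l with
  | nil => exact .nil
  | cons b l ih =>
    refine List.pairwise_append.2 ⟨h₁ _ _, ih, fun x hx y hy => ?_⟩
    obtain ⟨j, t, hj, hy⟩ := mem_flatTails.1 hy
    exact h₂ j _ _ _ (by simpa using (List.getElem?_eq_some_iff.1 hj).1) x hx y hy

lemma mem_formulaConstraints {a d n : ℕ} {ts : List Triple} {c : RawConstraint} :
    c ∈ formulaConstraints a d n ts ↔ c = wideConstraint a d ∨
      (∃ x < n, c = ([a + x], [[0], [1]])) ∨
      ∃ j t, ts.reverse[j]? = some t ∧ (c = litConstraint a (a + n + j) 0 t.1 ∨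
        c = litConstraint a (a + n + j) 1 t.2.1 ∨ c = litConstraint a (a + n + j) 2 t.2.2) := by
  simp only [formulaConstraints, List.mem_cons, List.mem_append, mem_natFlat, List.not_mem_nil,
    or_false]
  refine or_congr Iff.rfl (or_congr Iff.rfl ?_)
  rw [mem_flatTails (g := fun j t => clauseConstraints a (a + n + j) t)]
  simp [clauseConstraints]

/-- The wide constraint uses every domain value and the variables below `a`; the unary constraints
make each variable of the formula occur even if no clause mentions it; each clause variable occurs
in its own three constraints. -/
lemma formulaConstraints_valid {a d n : ℕ} {ts : List Triple} (ha : 2 ≤ a) (hd : 3 ≤ d)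
    (hT : TripleVars n ts) : RawValid (a + n + ts.length) d (formulaConstraints a d n ts) := by
  have hl : ∀ (j : ℕ) (t : Triple), ts.reverse[j]? = some t →
      j < ts.length ∧ t.1.1 < n ∧ t.2.1.1 < n ∧ t.2.2.1 < n := by
    intro j t h
    obtain ⟨hj, rfl⟩ := List.getElem?_eq_some_iff.1 h
    have := hT (ts.reverse[j]) (List.mem_reverse.1 (List.getElem_mem _))
    rw [mem_lits, mem_lits, mem_lits] at this
    exact ⟨by simpa using hj, this⟩
  refine ⟨?_, ?_, ?_, ?_, ?_, ?_, ?_, ?_, ?_⟩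
  · intro c hc
    rcases mem_formulaConstraints.1 hc with rfl | ⟨x, hx, rfl⟩ | ⟨j, t, hj, rfl | rfl | rfl⟩
    · simp only [wideConstraint, ne_eq, List.range_eq_nil]
      omega
    all_goals simp [litConstraint]
  · intro c hc
    rcases mem_formulaConstraints.1 hc with rfl | ⟨x, hx, rfl⟩ | ⟨j, t, hj, rfl | rfl | rfl⟩
    · exact List.nodup_range
    · simp
    all_goals
      have := hl j t hj
      simp [litConstraint]
      omega
  · intro c hc
    rcases mem_formulaConstraints.1 hc with rfl | ⟨x, hx, rfl⟩ | ⟨j, t, hj, rfl | rfl | rfl⟩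
    · simp [wideConstraint]
      omega
    · simp
      omega
    all_goals
      have := hl j t hj
      simp [litConstraint]
      omega
  · intro c hc
    rcases mem_formulaConstraints.1 hc with rfl | ⟨x, hx, rfl⟩ | ⟨j, t, hj, rfl | rfl | rfl⟩
    · refine List.nodup_range.map fun v w h => ?_
      have := congrArg List.head? h
      simpa [List.head?_replicate, show a ≠ 0 by omega] using this
    · simp
    all_goals
      rw [litConstraint_snd]
      exact List.Nodup.filter _ (by decide)
  · intro c hc u hu v hv
    rcases mem_formulaConstraints.1 hc with rfl | ⟨x, hx, rfl⟩ | ⟨j, t, hj, rfl | rfl | rfl⟩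
    · simp only [wideConstraint, List.mem_map, List.mem_range] at hu
      obtain ⟨w, hw, rfl⟩ := hu
      rw [List.eq_of_mem_replicate hv]
      exact hw
    · simp at hu
      rcases hu with rfl | rfl <;> simp at hv <;> omega
    all_goals
      rw [litConstraint_snd] at hu
      exact ((mem_litTable_elim hu).2 v hv).trans_le hd
  · intro c hc u hu
    rcases mem_formulaConstraints.1 hc with rfl | ⟨x, hx, rfl⟩ | ⟨j, t, hj, rfl | rfl | rfl⟩
    · simp only [wideConstraint, List.mem_map, List.mem_range] at hu
      obtain ⟨w, hw, rfl⟩ := hu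
      simp [wideConstraint]
    · simp at hu
      rcases hu with rfl | rfl <;> simp
    all_goals
      rw [litConstraint_snd] at hu
      rw [(mem_litTable_elim hu).1]
      simp [litConstraint]
  · refine List.pairwise_cons.2 ⟨fun c hc h => ?_, List.pairwise_append.2 ⟨?_, ?_, ?_⟩⟩
    -- Variable 0 is in the wide scope, whereas all other scopes consist of variables from `a` on.
    · have h₀ : 0 ∈ c.1 := by
        rw [← h.1]
        simp [wideConstraint]
        omega
      have hc' : c ∈ formulaConstraints a d n ts := List.mem_cons_of_mem _ hc
      simp only [List.mem_append, mem_natFlat] at hc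
      rw [mem_flatTails (g := fun j t => clauseConstraints a (a + n + j) t)] at hc
      rcases hc with ⟨x, hx, hc⟩ | ⟨j, t, hj, hc⟩
      · rw [List.mem_singleton] at hc
        subst hc
        simp at h₀
        omega
      · simp only [clauseConstraints, List.mem_cons, List.not_mem_nil, or_false] at hc
        rcases hc with rfl | rfl | rfl <;> simp [litConstraint] at h₀ <;> omega
    · refine pairwise_natFlat (fun i => List.pairwise_singleton _ _) (fun i j hij x hx y hy => ?_) _
      rw [List.mem_singleton] at hx hy
      subst hx hy
      simp
      omega
    · refine pairwise_flatTails (g := fun j t => clauseConstraints a (a + n + j) t)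
        (fun i t => ?_) (fun i j t t' hij x hx y hy => ?_) _
      · have key : ∀ p < 3, ∀ p' < 3, p ≠ p' → ∀ x y,
            ¬ ((litConstraint a (a + n + i) p x).1 = (litConstraint a (a + n + i) p' y).1 ∧
              ∀ t, t ∈ (litConstraint a (a + n + i) p x).2 ↔
                t ∈ (litConstraint a (a + n + i) p' y).2) := by
          rintro p hp p' hp' hpp x y ⟨-, h⟩
          obtain ⟨t, ht⟩ := litTable_distinct p hp p' hp' hpp x.2 y.2
          rw [litConstraint_snd, litConstraint_snd] at h
          exact ht (h t)
        simp only [clauseConstraints, List.pairwise_cons, List.mem_cons, List.not_mem_nil,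
          or_false, forall_eq_or_imp, forall_eq, IsEmpty.forall_iff, implies_true, List.Pairwise.nil,
          and_true]
        exact ⟨⟨key 0 (by omega) 1 (by omega) (by omega) _ _,
          key 0 (by omega) 2 (by omega) (by omega) _ _⟩,
          key 1 (by omega) 2 (by omega) (by omega) _ _⟩
      · rintro ⟨h, -⟩
        simp only [clauseConstraints, List.mem_cons, List.not_mem_nil, or_false] at hx hy
        rcases hx with rfl | rfl | rfl <;> rcases hy with rfl | rfl | rfl <;>
          simp [litConstraint] at h <;> omega
    · intro x hx y hy h
      obtain ⟨i, hi, hx⟩ := mem_natFlat.1 hx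
      rw [mem_flatTails (g := fun j t => clauseConstraints a (a + n + j) t)] at hy
      obtain ⟨j, t, hj, hy⟩ := hy
      rw [List.mem_singleton] at hx
      subst hx
      simp only [clauseConstraints, List.mem_cons, List.not_mem_nil, or_false] at hy
      rcases hy with rfl | rfl | rfl <;> simp [litConstraint] at h
  · intro x hx
    by_cases h₁ : x < a
    · exact ⟨_, mem_formulaConstraints.2 (.inl rfl), by simpa [wideConstraint] using h₁⟩
    by_cases h₂ : x < a + n
    · exact ⟨_, mem_formulaConstraints.2 (.inr (.inl ⟨x - a, by omega, rfl⟩)), by simp; omega⟩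
    · have hj : x - (a + n) < ts.reverse.length := by simp; omega
      exact ⟨_, mem_formulaConstraints.2 (.inr (.inr ⟨x - (a + n), _,
        List.getElem?_eq_getElem hj, .inl rfl⟩)), by simp [litConstraint]; omega⟩
  · intro v hv
    refine ⟨_, mem_formulaConstraints.2 (.inl rfl), List.replicate a v, ?_, ?_⟩
    · exact List.mem_map_of_mem (List.mem_range.2 hv)
    · simp
      omega

lemma formulaConstraints_arity {a d n : ℕ} {ts : List Triple} (ha : 2 ≤ a) :
    ((formulaConstraints a d n ts).map fun c => c.1.length).foldr max 0 = a := by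
  have h : ∀ l : List ℕ, (∀ x ∈ l, x ≤ a) → l.foldr max 0 ≤ a := by
    intro l
    induction l with
    | nil => simp
    | cons x l ih => simpa using fun h₁ h₂ => ⟨h₁, ih h₂⟩
  refine le_antisymm (h _ fun x hx => ?_) ?_
  · obtain ⟨c, hc, rfl⟩ := List.mem_map.1 hx
    rcases mem_formulaConstraints.1 hc with rfl | ⟨x, hx, rfl⟩ | ⟨j, t, hj, rfl | rfl | rfl⟩
    · simp [wideConstraint]
    all_goals
      simp [litConstraint]
      omega
  · simp [formulaConstraints, wideConstraint]

/-- The position of a true literal in a clause. -/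
noncomputable def truePos (τ : ℕ → Bool) (t : Triple) : ℕ :=
  open Classical in if Lit.Holds τ t.1 then 0 else if Lit.Holds τ t.2.1 then 1 else 2

lemma truePos_lt (τ : ℕ → Bool) (t : Triple) : truePos τ t < 3 := by
  unfold truePos
  split_ifs <;> omega

/-- Each clause variable is confined to three values although the domain may be larger, and its
value `p` forces the literal in position `p`. Conversely, `truePos` selects a suitable value for a
satisfied clause. -/
lemma formulaConstraints_sat_iff {a d n : ℕ} {ts : List Triple} (hd : 3 ≤ d)
    (hT : TripleVars n ts) :
    (∃ τ : ℕ → ℕ, (∀ x < a + n + ts.length, τ x < d) ∧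
      ∀ c ∈ formulaConstraints a d n ts, c.1.map τ ∈ c.2) ↔
    ∃ τ : ℕ → Bool, ∀ t ∈ ts, Triple.Holds τ t := by
  constructor
  · rintro ⟨τ, -, hτ⟩
    refine ⟨fun x => decide (τ (a + x) = 1), fun t ht => ?_⟩
    obtain ⟨j, hj, e⟩ := List.getElem_of_mem (List.mem_reverse.2 ht)
    have hj' : ts.reverse[j]? = some t := by rw [List.getElem?_eq_getElem hj, e]
    have key : ∀ p x, litConstraint a (a + n + j) p x ∈ formulaConstraints a d n ts →
        τ (a + n + j) < 3 ∧ (τ (a + n + j) = p →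
          Lit.Holds (fun x => decide (τ (a + x) = 1)) x) := by
      intro p x hc
      have := hτ _ hc
      rw [litConstraint_snd] at this
      simp only [litConstraint, List.map_cons, List.map_nil] at this
      obtain ⟨h₁, -, h₂⟩ := mem_litTable.1 this
      refine ⟨h₁, fun hp => ?_⟩
      rw [Lit.Holds, h₂ hp]
      cases x.2 <;> rfl
    have k₀ := key 0 t.1 (mem_formulaConstraints.2 (.inr (.inr ⟨j, t, hj', .inl rfl⟩)))
    have k₁ := key 1 t.2.1
      (mem_formulaConstraints.2 (.inr (.inr ⟨j, t, hj', .inr (.inl rfl)⟩)))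
    have k₂ := key 2 t.2.2
      (mem_formulaConstraints.2 (.inr (.inr ⟨j, t, hj', .inr (.inr rfl)⟩)))
    rcases (by omega : τ (a + n + j) = 0 ∨ τ (a + n + j) = 1 ∨ τ (a + n + j) = 2) with h | h | h
    · exact .inl (k₀.2 h)
    · exact .inr (.inl (k₁.2 h))
    · exact .inr (.inr (k₂.2 h))
  · rintro ⟨τ, hτ⟩
    -- The wide constraint is met by the constant tuple 0. The default 0 concerns indices beyond the
    -- last clause only.
    let τ' : ℕ → ℕ := fun x => if x < a then 0 else if x < a + n then (τ (x - a)).toNat else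
      (ts.reverse[x - (a + n)]?).elim 0 (truePos τ)
    have e₀ : ∀ x < a, τ' x = 0 := fun x hx => by simp [τ', hx]
    have e₁ : ∀ x < n, τ' (a + x) = (τ x).toNat := fun x hx => by simp [τ', hx]
    have e₂ : ∀ (j : ℕ) (t : Triple), ts.reverse[j]? = some t → τ' (a + n + j) = truePos τ t := fun j t h => by
      simp only [τ']
      rw [if_neg (by omega), if_neg (by omega), Nat.add_sub_cancel_left, h]
      rfl
    refine ⟨τ', fun x _ => ?_, fun c hc => ?_⟩
    · refine lt_of_lt_of_le ?_ hd
      simp only [τ']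
      split_ifs
      · omega
      · cases τ (x - a) <;> simp
      · cases ts.reverse[x - (a + n)]? with
        | none => simp
        | some t => exact truePos_lt τ t
    · have hl : ∀ (j : ℕ) (t : Triple), ts.reverse[j]? = some t →
          (t.1.1 < n ∧ t.2.1.1 < n ∧ t.2.2.1 < n) ∧ Triple.Holds τ t := by
        intro j t h
        obtain ⟨hj, rfl⟩ := List.getElem?_eq_some_iff.1 h
        have h' : ts.reverse[j] ∈ ts := List.mem_reverse.1 (List.getElem_mem _)
        have := hT _ h'
        rw [mem_lits, mem_lits, mem_lits] at this
        exact ⟨this, hτ _ h'⟩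
      have key : ∀ (j : ℕ) (t : Triple) (p : ℕ) (x : Lit), ts.reverse[j]? = some t → x.1 < n →
          (truePos τ t = p → Lit.Holds τ x) →
          (litConstraint a (a + n + j) p x).1.map τ' ∈ (litConstraint a (a + n + j) p x).2 := by
        intro j t p x hj hx h
        rw [litConstraint_snd]
        simp only [litConstraint, List.map_cons, List.map_nil]
        rw [e₂ j t hj, e₁ _ hx, mem_litTable]
        exact ⟨truePos_lt τ t, by cases τ x.1 <;> simp, fun hp => by rw [h hp]⟩
      rcases mem_formulaConstraints.1 hc with rfl | ⟨x, hx, rfl⟩ | ⟨j, t, hj, hc⟩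
      · simp only [wideConstraint, List.mem_map, List.mem_range]
        refine ⟨0, by omega, ?_⟩
        rw [eq_comm, List.eq_replicate_iff]
        simpa using e₀
      · simp only [List.map_cons, List.map_nil]
        rw [e₁ x hx]
        cases τ x <;> simp
      · obtain ⟨h, ht⟩ := hl j t hj
        rcases hc with rfl | rfl | rfl
        · refine key j t 0 _ hj h.1 fun hp => ?_
          by_contra hn
          simp only [truePos, hn, if_false] at hp
          split_ifs at hp
        · refine key j t 1 _ hj h.2.1 fun hp => ?_
          by_contra hn
          simp only [truePos, hn, if_false] at hp
          split_ifs at hp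
          omega
        · refine key j t 2 _ hj h.2.2 fun hp => ?_
          by_contra hn
          rcases ht with ht | ht | ht
          · simp [truePos, ht] at hp
          · simp only [truePos, ht, if_true] at hp
            split_ifs at hp
            all_goals omega
          · exact hn ht

/-! ## The steps of the algorithm in polynomial time -/

section Poly

variable {α : Type} [Enc α]

lemma Poly.lits {n : α → ℕ} (hn : Poly n) : Poly fun a => lits (n a) :=
  hn.natFlat (g := fun p : α × ℕ => [(p.2, true), (p.2, false)])
    ((Poly.id.snd.pair (.const true)).cons ((Poly.id.snd.pair (.const false)).cons (.const [])))

lemma Poly.litPairs {n : α → ℕ} (hn : Poly n) : Poly fun a => litPairs (n a) :=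
  hn.lits.flatMap (g := fun p : α × Lit => (SubexpCSP.lits (n p.1)).map fun y => (p.2, y))
    ((hn.comp Poly.id.fst).lits.map (g := fun p : (α × Lit) × Lit => (p.1.2, p.2))
      (Poly.id.fst.snd.pair Poly.id.snd))

lemma Poly.adj {σ : α → Branch} {x y : α → Lit} (hσ : Poly σ) (hx : Poly x) (hy : Poly y) :
    Poly fun a => adj (σ a) (x a) (y a) :=
  ((hx.pair hy).mem hσ.snd).and ((hx.mem hσ.fst).not.and (hy.mem hσ.fst).not)

lemma Poly.act {Th : α → List Triple} {σ : α → Branch} {x y z : α → Lit} (hT : Poly Th)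
    (hσ : Poly σ) (hx : Poly x) (hy : Poly y) (hz : Poly z) :
    Poly fun a => act (Th a) (σ a) (x a) (y a) (z a) :=
  ((hx.pair (hy.pair hz)).mem hT).and
    (((hx.mem hσ.fst).not.and ((hy.mem hσ.fst).not.and (hz.mem hσ.fst).not)).and
      (((hx.pair hy).mem hσ.snd).not.and
        (((hx.pair hz).mem hσ.snd).not.and ((hy.pair hz).mem hσ.snd).not)))

lemma Poly.nbr₂ {n : α → ℕ} {σ : α → Branch} {x : α → Lit} (hn : Poly n) (hσ : Poly σ)
    (hx : Poly x) : Poly fun a => nbr₂ (n a) (σ a) (x a) :=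
  hn.lits.filter (c := fun p : α × Lit => SubexpCSP.adj (σ p.1) (x p.1) p.2)
    ((hσ.comp Poly.id.fst).adj (hx.comp Poly.id.fst) Poly.id.snd)

lemma Poly.nbr₃ {n : α → ℕ} {Th : α → List Triple} {σ : α → Branch} {x y : α → Lit}
    (hn : Poly n) (hT : Poly Th) (hσ : Poly σ) (hx : Poly x) (hy : Poly y) :
    Poly fun a => nbr₃ (n a) (Th a) (σ a) (x a) (y a) :=
  hn.lits.filter (c := fun p : α × Lit => SubexpCSP.act (Th p.1) (σ p.1) (x p.1) (y p.1) p.2)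
    ((hT.comp Poly.id.fst).act (hσ.comp Poly.id.fst) (hx.comp Poly.id.fst)
      (hy.comp Poly.id.fst) Poly.id.snd)

lemma Poly.nbrPairs {n : α → ℕ} {Th : α → List Triple} {σ : α → Branch} {x : α → Lit}
    (hn : Poly n) (hT : Poly Th) (hσ : Poly σ) (hx : Poly x) :
    Poly fun a => nbrPairs (n a) (Th a) (σ a) (x a) :=
  hn.litPairs.filter
    (c := fun p : α × (Lit × Lit) => SubexpCSP.act (Th p.1) (σ p.1) (x p.1) p.2.1 p.2.2)
    ((hT.comp Poly.id.fst).act (hσ.comp Poly.id.fst) (hx.comp Poly.id.fst) Poly.id.snd.fst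
      Poly.id.snd.snd)

lemma Poly.addLits {n : α → ℕ} {σ : α → Branch} {V : α → List Lit} (hn : Poly n)
    (hσ : Poly σ) (hV : Poly V) : Poly fun a => addLits (n a) (σ a) (V a) :=
  (hn.lits.filter (c := fun p : α × Lit => decide (p.2 ∈ (σ p.1).1) || decide (p.2 ∈ V p.1))
    ((Poly.id.snd.mem (hσ.comp Poly.id.fst).fst).or (Poly.id.snd.mem (hV.comp Poly.id.fst)))).pair
    hσ.snd

lemma Poly.addPairs {n : α → ℕ} {σ : α → Branch} {V : α → List (Lit × Lit)} (hn : Poly n)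
    (hσ : Poly σ) (hV : Poly V) : Poly fun a => addPairs (n a) (σ a) (V a) :=
  hσ.fst.pair (hn.litPairs.filter
    (c := fun p : α × (Lit × Lit) => decide (p.2 ∈ (σ p.1).2) || decide (p.2 ∈ V p.1))
    ((Poly.id.snd.mem (hσ.comp Poly.id.fst).snd).or (Poly.id.snd.mem (hV.comp Poly.id.fst))))

lemma Poly.branch₂ {n s : α → ℕ} {σ : α → Branch} (hn : Poly n) (hs : Poly s) (hσ : Poly σ) :
    Poly fun a => branch₂ (n a) (s a) (σ a) := by
  have hn' := hn.comp (Poly.id (α := α × Lit)).fst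
  have hσ' := hσ.comp (Poly.id (α := α × Lit)).fst
  have hN := hn'.nbr₂ hσ' Poly.id.snd
  exact hn.lits.flatMap (((hs.comp Poly.id.fst).le hN.length).ite
    (((hn'.addLits hσ' (Poly.id.snd.cons (.const []))).pair (hn'.addLits hσ' hN)).cons
      (.const [])) (.const []))

lemma Poly.branch₃ {n s : α → ℕ} {Th : α → List Triple} {σ : α → Branch} (hn : Poly n)
    (hs : Poly s) (hT : Poly Th) (hσ : Poly σ) :
    Poly fun a => branch₃ (n a) (s a) (Th a) (σ a) := by
  have hn' := hn.comp (Poly.id (α := α × (Lit × Lit))).fst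
  have hσ' := hσ.comp (Poly.id (α := α × (Lit × Lit))).fst
  have hN := hn'.nbr₃ (hT.comp Poly.id.fst) hσ' Poly.id.snd.fst Poly.id.snd.snd
  exact hn.litPairs.flatMap (((hs.comp Poly.id.fst).le hN.length).ite
    (((hn'.addPairs hσ' ((Poly.id.snd.fst.pair Poly.id.snd.snd).cons
      ((Poly.id.snd.snd.pair Poly.id.snd.fst).cons (.const [])))).pair (hn'.addLits hσ' hN)).cons
      (.const [])) (.const []))

lemma Poly.branch₁ {n s : α → ℕ} {Th : α → List Triple} {σ : α → Branch} (hn : Poly n)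
    (hs : Poly s) (hT : Poly Th) (hσ : Poly σ) :
    Poly fun a => branch₁ (n a) (s a) (Th a) (σ a) := by
  have hn' := hn.comp (Poly.id (α := α × Lit)).fst
  have hσ' := hσ.comp (Poly.id (α := α × Lit)).fst
  have hN := hn'.nbrPairs (hT.comp Poly.id.fst) hσ' Poly.id.snd
  exact hn.lits.flatMap ((((hs.mul hs).comp Poly.id.fst).le hN.length).ite
    (((hn'.addLits hσ' (Poly.id.snd.cons (.const []))).pair (hn'.addPairs hσ' hN)).cons
      (.const [])) (.const []))

lemma Poly.branchings {n s : α → ℕ} {Th : α → List Triple} {σ : α → Branch} (hn : Poly n)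
    (hs : Poly s) (hT : Poly Th) (hσ : Poly σ) :
    Poly fun a => branchings (n a) (s a) (Th a) (σ a) :=
  (hn.branch₂ hs hσ).append ((hn.branch₃ hs hT hσ).append (hn.branch₁ hs hT hσ))

lemma Poly.sparseClauses {n : α → ℕ} {Th : α → List Triple} {σ : α → Branch} (hn : Poly n)
    (hT : Poly Th) (hσ : Poly σ) : Poly fun a => sparseClauses (n a) (Th a) (σ a) := by
  have hn' := hn.comp (Poly.id (α := α × Lit)).fst
  have hσ' := hσ.comp (Poly.id (α := α × Lit)).fst
  have hx := (Poly.id (α := α × Lit)).snd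
  exact (hσ.fst.map (hx.pair (hx.pair hx))).append
    ((hn.lits.flatMap ((hn'.nbr₂ hσ' hx).map (Poly.id.fst.snd.pair
      (Poly.id.fst.snd.pair Poly.id.snd)))).append
    (hn.lits.flatMap ((hn'.nbrPairs (hT.comp Poly.id.fst) hσ' hx).map (Poly.id.fst.snd.pair
      (Poly.id.snd.fst.pair Poly.id.snd.snd)))))

/-- As `p` is fixed, the two possible tables are constants; the case distinction in `litConstraint`
is written out for this purpose. -/
lemma Poly.litConstraint {i : α → ℕ} {x : α → Lit} (a p : ℕ) (hi : Poly i) (hx : Poly x) :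
    Poly fun z => litConstraint a (i z) p (x z) :=
  (hi.cons (((Poly.const a).add hx.fst).cons (.const []))).pair
    (hx.snd.ite (.const _) (.const _))

lemma Poly.formulaConstraints {n : α → ℕ} {ts : α → List Triple} (a d : ℕ) (hn : Poly n)
    (ht : Poly ts) : Poly fun z => formulaConstraints a d (n z) (ts z) := by
  have hi := ((Poly.const a).add (hn.comp (Poly.id (α := α × (Triple × List Triple))).fst)).add
    Poly.id.snd.snd.length
  have hx := (Poly.id (α := α × (Triple × List Triple))).snd.fst
  exact (Poly.const (wideConstraint a d)).cons ((hn.natFlat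
    (g := fun p : α × ℕ => [([a + p.2], [[0], [1]])])
    (((((Poly.const a).add Poly.id.snd).cons (.const [])).pair (.const _)).cons
      (.const []))).append
    (ht.flatTails ((Poly.litConstraint a 0 hi hx.fst).cons
      ((Poly.litConstraint a 1 hi hx.snd.fst).cons
        ((Poly.litConstraint a 2 hi hx.snd.snd).cons (.const []))))))

end Poly

/-! ### Configurations and one step of the tree search -/

/-- The parameter, the number of variables, the clauses. -/
abbrev Env : Type := ℕ × ℕ × List Triple

/-- The instance solved at a leaf of the branching tree. -/
def leafInstance (a d : ℕ) (e : Env) (σ : Branch) : ℕ × ℕ × List RawConstraint :=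
  (a + e.2.1 + (sparseClauses e.2.1 e.2.2 σ).length, d,
    formulaConstraints a d e.2.1 (sparseClauses e.2.1 e.2.2 σ))

/-- The first three literals of a clause, with repetitions if there are fewer. -/
def toTriple (c : List Lit) : Triple :=
  (c.headD (0, false), (c.tail ++ c).headD (0, false), (c.tail.tail ++ c).headD (0, false))

/-- All permutations of the clauses. -/
def permTriples (ts : List Triple) : List Triple :=
  ts.flatMap fun t => [(t.1, t.2.1, t.2.2), (t.1, t.2.2, t.2.1), (t.2.1, t.1, t.2.2),
    (t.2.1, t.2.2, t.1), (t.2.2, t.1, t.2.1), (t.2.2, t.2.1, t.1)]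

/-- The stack of branches still to be explored, the environment, the result. -/
abbrev Config : Type := List Branch × Env × Bool

/-- The initial configuration for a parameter, a number of variables and a list of clauses. -/
def initConfig (x : ℕ × ℕ × List (List Lit)) : Config :=
  if (x.2.2.any fun c => c.isEmpty) = true then ([], (x.1 + 1, x.2.1, []), false) else
    ([([], [])], (x.1 + 1, x.2.1, permTriples (x.2.2.map toTriple)), false)

lemma poly_toTriple : Poly toTriple :=
  have h := Poly.const (α := List Lit) ((0, false) : Lit)
  (Poly.id.headD h).pair (((Poly.id.tail.append Poly.id).headD h).pair
    ((Poly.id.tail.tail.append Poly.id).headD h))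

lemma poly_permTriples : Poly permTriples := by
  have h := (Poly.id (α := List Triple × Triple)).snd
  exact Poly.id.flatMap (g := fun p : List Triple × Triple => _)
    ((h.fst.pair (h.snd.fst.pair h.snd.snd)).cons ((h.fst.pair (h.snd.snd.pair h.snd.fst)).cons
      ((h.snd.fst.pair (h.fst.pair h.snd.snd)).cons ((h.snd.fst.pair (h.snd.snd.pair h.fst)).cons
        ((h.snd.snd.pair (h.fst.pair h.snd.fst)).cons
          ((h.snd.snd.pair (h.snd.fst.pair h.fst)).cons (.const [])))))))

lemma poly_initConfig : Poly initConfig := by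
  have h := (Poly.id (α := ℕ × ℕ × List (List Lit)))
  exact (h.snd.snd.any (c := fun p => p.2.isEmpty) Poly.id.snd.isEmpty).ite
    ((Poly.const ([] : List Branch)).pair ((h.fst.succ.pair (h.snd.fst.pair (.const ([] : List Triple)))).pair (.const false)))
    ((Poly.const [(([], []) : Branch)]).pair ((h.fst.succ.pair (h.snd.fst.pair (poly_permTriples.comp
      (h.snd.snd.map (poly_toTriple.comp Poly.id.snd))))).pair (.const false)))

lemma poly_leafInstance (a d : ℕ) :
    Poly fun x : Config => leafInstance a d x.2.1 (x.1.headD ([], [])) := by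
  have h := (Poly.id (α := Config))
  have hs := h.snd.fst.snd.fst.sparseClauses h.snd.fst.snd.snd (h.fst.headD (.const ([], [])))
  exact (((Poly.const a).add h.snd.fst.snd.fst).add hs.length).pair
    ((Poly.const d).pair (Poly.formulaConstraints a d h.snd.fst.snd.fst hs))

/-- The branchings at the first branch on the stack. -/
def headBranchings (x : Config) : List (Branch × Branch) :=
  branchings x.2.1.2.1 x.2.1.1 x.2.1.2.2 (x.1.headD ([], []))

lemma poly_headBranchings : Poly headBranchings := by
  have h := (Poly.id (α := Config))
  exact h.snd.fst.snd.fst.branchings h.snd.fst.fst h.snd.fst.snd.snd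
    (h.fst.headD (.const ([], [])))

/-- The configuration after a branching. -/
def splitConfig (x : Config) : Config :=
  let c := (headBranchings x).headD (([], []), ([], []))
  (c.1 :: c.2 :: x.1.tail, x.2)

lemma poly_splitConfig : Poly splitConfig := by
  have h := poly_headBranchings.headD (.const (([], []), ([], [])))
  exact (h.fst.cons (h.snd.cons Poly.id.fst.tail)).pair Poly.id.snd

/-- The configuration after a leaf, given whether the instance is satisfiable. -/
def leafConfig (p : Bool × Config) : Config :=
  if p.1 = true then ([], p.2.2.1, true) else (p.2.1.tail, p.2.2)

lemma poly_leafConfig : Poly leafConfig := by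
  have h := (Poly.id (α := Bool × Config))
  exact h.fst.ite ((Poly.const ([] : List Branch)).pair (h.snd.snd.fst.pair (.const true)))
    (h.snd.fst.tail.pair h.snd.snd)

lemma Poly.does {α β : Type} [Enc α] [Enc β] {f : α → β} (hf : Poly f) :
    ∃ (p : Prog) (b : ℕ) (P : Polynomial ℕ), 0 < b ∧ ∀ a,
      Does p b (enc a) (· = enc (f a)) (P.eval (enc a).size) ∧
        (enc (f a)).size ≤ P.eval (enc a).size := by
  obtain ⟨F, ⟨p, b, P, hb, hp⟩, eF⟩ := hf
  exact ⟨p, b, P, hb, fun a => eF a ▸ hp (enc a)⟩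

/-- Replaces the output by a truth value. -/
def boolProg (q : Prog) : Prog :=
  .seq q (iteProg 1 (.assign 0 (.var 0)) (.assign 0 (.cons .nil .nil)) (.assign 0 .nil))

lemma Does.bool {q : Prog} {b : ℕ} {x : Data} {Y : Prop} {t : ℕ}
    (h : Does q b x (fun out => out ≠ .nil ↔ Y) t) :
    Does (boolProg q) (b + 2) x (fun y => ∃ r : Bool, y = enc r ∧ (r = true ↔ Y)) (t + 12) := by
  refine (h.mono (by omega) (fun _ h => h) le_rfl).seq fun y hy => ?_
  have d₁ := Does.assign (e := .var 0) (by simp [Exp.bound]) (constStore y)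
  have d₂ := Does.assign (e := .cons .nil .nil) (by simp [Exp.bound]) (constStore y)
  have d₃ := Does.assign (e := .nil) (by simp [Exp.bound]) (constStore y)
  simp only [Exp.eval, Exp.cost] at d₁ d₂ d₃
  refine (Does.ite (b := 1) (u := 4) one_pos d₁ (fun z hz hn => ?_) (fun hn => ?_)).mono
    (by omega) (fun _ h => h) (by omega)
  · subst hz
    exact d₂.mono le_rfl (fun w hw => ⟨true, hw, by simpa using hy.1 hn⟩) (by omega)
  · refine d₃.mono le_rfl (fun w hw => ⟨false, hw, ?_⟩) (by omega)
    simpa using fun hY => hy.2 hY hn.symm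

/-- The time `t` for a leaf enters additively beside a polynomial overhead, since it will be
exponential and must not be multiplied up. The proposition `Y` stands for the satisfiability of the
leaf. -/
lemma exists_body (a d : ℕ) (q : Prog) (b₀ : ℕ) : ∃ (p : Prog) (b : ℕ) (P : Polynomial ℕ),
    0 < b ∧ ∀ x : Config,
      (headBranchings x ≠ [] →
        Does p b (enc x) (· = enc (splitConfig x)) (P.eval (enc x).size)) ∧
      (headBranchings x = [] → ∀ (Y : Prop) (t : ℕ),
        Does q b₀ (enc (leafInstance a d x.2.1 (x.1.headD ([], [])))) (fun out => out ≠ .nil ↔ Y) t →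
        Does p b (enc x) (fun y => ∃ r : Bool, y = enc (leafConfig (r, x)) ∧ (r = true ↔ Y))
          (t + P.eval (enc x).size)) := by
  obtain ⟨p₁, b₁, P₁, hb₁, h₁⟩ := poly_headBranchings.isEmpty.does
  obtain ⟨p₂, b₂, P₂, hb₂, h₂⟩ := poly_splitConfig.does
  obtain ⟨p₃, b₃, P₃, hb₃, h₃⟩ := (poly_leafInstance a d).does
  obtain ⟨p₄, b₄, P₄, hb₄, h₄⟩ := (Poly.id (α := Config)).does
  obtain ⟨p₅, b₅, P₅, hb₅, h₅⟩ := poly_leafConfig.does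
  let b := b₁ + b₂ + b₃ + b₄ + b₅ + b₀ + 2
  -- In `.X + .C 4` the constant covers a truth value, of size at most 3, and the node that pairs it
  -- with the configuration.
  refine ⟨iteProg (b + 2) p₁ (.seq (pairProg b (.seq p₃ (boolProg q)) p₄) p₅) p₂, b + 3,
    P₁ + P₂ + P₃ + P₄ + P₅.comp (.X + .C 4) + .C 100, by omega, fun x => ⟨fun hx => ?_,
      fun hx Y t hq => ?_⟩⟩
  · simp only [Polynomial.eval_add, Polynomial.eval_C]
    refine (Does.ite (b := b + 2) (by omega) ((h₁ x).1.mono (by omega) (fun _ h => h) le_rfl)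
      (fun y hy hn => absurd ?_ hn)
      (fun _ => (h₂ x).1.mono (by omega) (fun _ h => h) le_rfl)).mono le_rfl (fun _ h => h)
      (by omega)
    rw [hy, List.isEmpty_eq_false_iff.2 hx]
    rfl
  · simp only [Polynomial.eval_add, Polynomial.eval_C, Polynomial.eval_comp, Polynomial.eval_X]
    have d₁ := Does.seq (b := b) ((h₃ x).1.mono (by omega) (fun _ h => h) le_rfl)
      (fun y hy => by subst hy; exact hq.bool.mono (by omega) (fun _ h => h) le_rfl)
    have d₂ := d₁.pair (by omega) ((h₄ x).1.mono (by omega) (fun _ h => h) le_rfl)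
    have d₃ := Does.seq (b := b + 2) (u := P₅.eval ((enc x).size + 4))
      (R := fun y => ∃ r : Bool, y = enc (leafConfig (r, x)) ∧ (r = true ↔ Y)) d₂ (q := p₅) (by
      rintro _ ⟨_, _, rfl, ⟨r, rfl, hr⟩, rfl⟩
      refine (h₅ (r, x)).1.mono (by omega) (fun y hy => ⟨r, hy, hr⟩) (polyEval_mono _ ?_)
      change (codeBool r).size + (enc x).size + 1 ≤ _
      cases r <;> simp [codeBool, Data.size] <;> omega)
    refine (Does.ite (b := b + 2) (by omega) ((h₁ x).1.mono (by omega) (fun _ h => h) le_rfl)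
      (fun y hy hn => d₃) (fun hn => absurd hn ?_)).mono le_rfl (fun _ h => h) (by omega)
    rw [hx]
    simp [enc, Enc.code, codeBool]

/-! ### Depth-first exploration of the branching tree -/

/-- The number of branches explored, by the remaining progress. -/
def nodes (k : ℕ) : ℕ → ℕ
  | 0 => 1
  | w + 1 => if k ≤ w then 1 + nodes k w + nodes k (w - k) else 1
decreasing_by all_goals omega

lemma one_le_nodes (k : ℕ) : ∀ w, 1 ≤ nodes k w
  | 0 => by simp [nodes]
  | w + 1 => by
      rw [nodes]
      split_ifs <;> omega

/-- Every leaf of the branching tree is solved in time `t`. -/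
def LeavesSolved (a d : ℕ) (q : Prog) (b₀ : ℕ) (e : Env) (t : ℕ) : Prop :=
  ∀ σ : Branch, σ.Good e.2.1 e.1 → branchings e.2.1 e.1 e.2.2 σ = [] →
    Does q b₀ (enc (leafInstance a d e σ)) (fun out => out ≠ .nil ↔ ∃ τ, σ.Sat e.2.2 τ) t

/-- Induction on the remaining progress `w`, in continuation style: `u` bounds the work on the rest
of the stack, which is reached only if `σ` is unsatisfiable. A branching lengthens the stack by one
and lowers `w` by at least one, so `l.length + w + 1 ≤ L` persists and configurations stay
polynomially small. -/
lemma does_explore {a d : ℕ} {q : Prog} {b₀ : ℕ} {p : Prog} {b : ℕ} {P : Polynomial ℕ}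
    (hp : ∀ x : Config,
      (headBranchings x ≠ [] →
        Does p b (enc x) (· = enc (splitConfig x)) (P.eval (enc x).size)) ∧
      (headBranchings x = [] → ∀ (Y : Prop) (t : ℕ),
        Does q b₀ (enc (leafInstance a d x.2.1 (x.1.headD ([], [])))) (fun out => out ≠ .nil ↔ Y) t →
        Does p b (enc x) (fun y => ∃ r : Bool, y = enc (leafConfig (r, x)) ∧ (r = true ↔ Y))
          (t + P.eval (enc x).size)))
    {e : Env} (hs : 2 ≤ e.1) (hperm : PermClosed e.2.2) (hT : TripleVars e.2.1 e.2.2) {t L S : ℕ}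
    (hq : LeavesSolved a d q b₀ e t)
    (hS : ∀ l : List Branch, l.length ≤ L → (∀ σ ∈ l, σ.Good e.2.1 e.1) →
      (enc ((l, e, false) : Config)).size ≤ S) {Q : Data → Prop} :
    ∀ (w : ℕ) (σ : Branch) (l : List Branch) (u : ℕ), σ.Good e.2.1 e.1 →
      14 * e.1 * e.2.1 ≤ σ.progress e.1 + w → l.length + w + 1 ≤ L →
      (∀ σ ∈ l, σ.Good e.2.1 e.1) → 4 ≤ u →
      (¬ (∃ τ, σ.Sat e.2.2 τ) →
        Does (.loop (.hd (.var 0)) p) b (enc ((l, e, false) : Config)) Q u) →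
      ((∃ τ, σ.Sat e.2.2 τ) → Q (enc (([], e, true) : Config))) →
      Does (.loop (.hd (.var 0)) p) b (enc ((σ :: l, e, false) : Config)) Q
        (nodes (e.1 * e.1 - 1) w * (t + P.eval S + 4) + u) := by
  intro w
  induction w using Nat.strong_induction_on with
  | _ w ih =>
  intro σ l u hσ hw hL hl hu hrest hacc
  have hsize : P.eval (enc ((σ :: l, e, false) : Config)).size ≤ P.eval S :=
    polyEval_mono _ (hS _ (by simp; omega) (List.forall_mem_cons.2 ⟨hσ, hl⟩))
  have hne : (Exp.hd (.var 0)).eval (constStore (enc ((σ :: l, e, false) : Config))) ≠ .nil := by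
    simp [Exp.eval, enc, Enc.code, codeList]
  by_cases hb : branchings e.2.1 e.1 e.2.2 σ = []
  · have hbody := (hp (σ :: l, e, false)).2 hb _ t (hq σ hσ hb)
    refine (Does.loop_step (e := .hd (.var 0)) (u := u) (by simp [Exp.bound]) hne hbody ?_).mono
      le_rfl (fun _ h => h) ?_
    · rintro _ ⟨r, rfl, hr⟩
      cases r with
      | true =>
        refine (Does.loop_done (e := .hd (.var 0))
          (s₀ := constStore (enc (([], e, true) : Config))) (by simp [Exp.bound])
          (by simp [Exp.eval, enc, Enc.code, codeList]) (hacc (hr.1 rfl))).mono le_rfl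
          (fun _ h => h) (by simp only [Exp.cost]; omega)
      | false => exact hrest fun h => by simpa using hr.2 h
    · have := Nat.mul_le_mul_right (t + P.eval S + 4) (one_le_nodes (e.1 * e.1 - 1) w)
      simp only [Exp.cost]
      omega
  · obtain ⟨c, m, hc⟩ := List.exists_cons_of_ne_nil hb
    have hB := hσ.isBranching hs hperm hT hc
    have hbody := (hp (σ :: l, e, false)).1 hb
    have hsplit : splitConfig (σ :: l, e, false) = (c.1 :: c.2 :: l, e, false) := by
      simp [splitConfig, headBranchings, hc]
    rw [hsplit] at hbody
    have hpos : 1 ≤ e.1 * e.1 := Nat.mul_pos (by omega) (by omega)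
    have h₁ := hB.progress_fst
    have h₂ := hB.progress_snd
    have h₃ := hB.good_snd.progress_le
    -- The progress of the second child is at least `e.1 * e.1` larger and still within the global
    -- bound, so `w` is at least that large and `nodes` is in its branching case.
    obtain ⟨w, rfl⟩ : ∃ v, w = v + 1 := ⟨w - 1, by omega⟩
    have hk : e.1 * e.1 - 1 ≤ w := by omega
    -- The exploration of the second child is the continuation for the first one, under the
    -- assumption that the first is unsatisfiable.
    have ih₂ := fun (hns : ¬ ∃ τ, c.1.Sat e.2.2 τ) => ih (w - (e.1 * e.1 - 1)) (by omega) c.2 l u hB.good_snd (by omega)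
      (by omega) hl hu (fun hn => hrest fun ⟨τ, hτ⟩ =>
        ((hB.sat_iff τ).1 hτ).elim (fun h => hns ⟨τ, h⟩) fun h => hn ⟨τ, h⟩)
      (fun ⟨τ, hτ⟩ => hacc ⟨τ, (hB.sat_iff τ).2 (.inr hτ)⟩)
    have ih₁ := ih w (by omega) c.1 (c.2 :: l) _ hB.good_fst (by omega)
      (by simp; omega) (List.forall_mem_cons.2 ⟨hB.good_snd, hl⟩)
      (hu.trans (Nat.le_add_left _ _)) ih₂
      (fun ⟨τ, hτ⟩ => hacc ⟨τ, (hB.sat_iff τ).2 (.inl hτ)⟩)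
    refine (Does.loop_step (e := .hd (.var 0)) (by simp [Exp.bound]) hne hbody
      (fun y hy => by subst hy; exact ih₁)).mono le_rfl (fun _ h => h) ?_
    rw [nodes, if_pos hk, add_mul, add_mul]
    simp only [Exp.cost]
    omega

/-! ## CNF formulas -/

/-- The clauses of a formula as lists of literals over natural numbers. -/
def CNF.raw (F : CNF) : List (List Lit) := F.clauses.map (List.map fun l => (l.1.val, l.2))

lemma CNF.code_eq (F : CNF) : F.code = enc (F.vars, F.raw) := by
  simp only [CNF.code, CNF.raw, enc, Enc.code, codeList_map]

lemma CNF.satisfiable_iff (F : CNF) :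
    F.Satisfiable ↔ ∃ τ : ℕ → Bool, ∀ c ∈ F.raw, ∃ l ∈ c, Lit.Holds τ l := by
  constructor
  · rintro ⟨τ, hτ⟩
    refine ⟨fun x => if hx : x < F.vars then τ ⟨x, hx⟩ else true, fun c hc => ?_⟩
    obtain ⟨C, hC, rfl⟩ := List.mem_map.1 hc
    obtain ⟨l, hl, h⟩ := hτ C hC
    exact ⟨_, List.mem_map_of_mem hl, by simpa [Lit.Holds] using h⟩
  · rintro ⟨τ, hτ⟩
    refine ⟨fun x => τ x.val, fun C hC => ?_⟩
    obtain ⟨l, hl, h⟩ := hτ _ (List.mem_map_of_mem hC)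
    obtain ⟨l', hl', rfl⟩ := List.mem_map.1 hl
    exact ⟨l', hl', h⟩

lemma CNF.raw_lt {F : CNF} {c : List Lit} (hc : c ∈ F.raw) : ∀ l ∈ c, l.1 < F.vars := by
  intro l hl
  obtain ⟨C, -, rfl⟩ := List.mem_map.1 hc
  obtain ⟨l, -, rfl⟩ := List.mem_map.1 hl
  exact l.1.isLt

lemma toTriple_mem {c : List Lit} (h : c ≠ []) :
    (toTriple c).1 ∈ c ∧ (toTriple c).2.1 ∈ c ∧ (toTriple c).2.2 ∈ c := by
  match c, h with
  | [x], _ => simp [toTriple]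
  | [x, y], _ => simp [toTriple]
  | x :: y :: z :: l, _ => simp [toTriple]

lemma toTriple_holds {τ : ℕ → Bool} {c : List Lit} (h : c ≠ []) (h₃ : c.length ≤ 3) :
    Triple.Holds τ (toTriple c) ↔ ∃ l ∈ c, Lit.Holds τ l := by
  match c, h, h₃ with
  | [x], _, _ => simp [toTriple, Triple.Holds]
  | [x, y], _, _ =>
    simp only [toTriple, Triple.Holds, List.headD_cons, List.tail_cons, List.cons_append,
      List.nil_append, List.mem_cons, List.not_mem_nil, or_false, exists_eq_or_imp,
      exists_eq_left]
    tauto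
  | [x, y, z], _, _ => simp [toTriple, Triple.Holds]

lemma mem_permTriples {ts : List Triple} {x y z : Lit} : (x, y, z) ∈ permTriples ts ↔
    (x, y, z) ∈ ts ∨ (x, z, y) ∈ ts ∨ (y, x, z) ∈ ts ∨ (z, x, y) ∈ ts ∨ (y, z, x) ∈ ts ∨
      (z, y, x) ∈ ts := by
  simp only [permTriples, List.mem_flatMap, List.mem_cons, List.not_mem_nil, or_false]
  constructor
  · rintro ⟨⟨u, v, w⟩, h, e⟩
    simp only [Prod.mk.injEq] at e
    rcases e with ⟨rfl, rfl, rfl⟩ | ⟨rfl, rfl, rfl⟩ | ⟨rfl, rfl, rfl⟩ | ⟨rfl, rfl, rfl⟩ |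
      ⟨rfl, rfl, rfl⟩ | ⟨rfl, rfl, rfl⟩ <;> simp [h]
  · rintro (h | h | h | h | h | h) <;> exact ⟨_, h, by simp⟩

lemma permClosed_permTriples (ts : List Triple) : PermClosed (permTriples ts) := by
  constructor <;> intro x y z <;> rw [mem_permTriples, mem_permTriples] <;> tauto

lemma holds_permTriples {ts : List Triple} {τ : ℕ → Bool} :
    (∀ t ∈ permTriples ts, Triple.Holds τ t) ↔ ∀ t ∈ ts, Triple.Holds τ t := by
  constructor
  · rintro h ⟨x, y, z⟩ ht
    exact h _ (mem_permTriples.2 (.inl ht))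
  · rintro h ⟨x, y, z⟩ ht
    simp only [Triple.Holds] at h ⊢
    rcases mem_permTriples.1 ht with ht | ht | ht | ht | ht | ht
    all_goals
      have := h _ ht
      simp only at this
      tauto

lemma tripleVars_permTriples {n : ℕ} {ts : List Triple} (h : TripleVars n ts) :
    TripleVars n (permTriples ts) := by
  rintro ⟨x, y, z⟩ ht
  rcases mem_permTriples.1 ht with ht | ht | ht | ht | ht | ht
  all_goals
    have := h _ ht
    simp only at this ⊢
    tauto

/-- The environment of the algorithm for a formula without empty clause. -/
def CNF.env (j : ℕ) (F : CNF) : Env := (j + 1, F.vars, permTriples (F.raw.map toTriple))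

lemma CNF.initConfig_of_mem {F : CNF} (j : ℕ) (h : [] ∈ F.raw) :
    initConfig (j, F.vars, F.raw) = ([], (j + 1, F.vars, []), false) ∧ ¬ F.Satisfiable := by
  constructor
  · rw [initConfig, if_pos (List.any_eq_true.2 ⟨[], h, rfl⟩)]
  · rw [F.satisfiable_iff]
    rintro ⟨τ, hτ⟩
    obtain ⟨l, hl, -⟩ := hτ _ h
    simp at hl

lemma CNF.initConfig_of_notMem {F : CNF} (j : ℕ) (hF : F.WidthLE 3) (h : [] ∉ F.raw) :
    initConfig (j, F.vars, F.raw) = ([([], [])], F.env j, false) ∧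
      PermClosed (F.env j).2.2 ∧ TripleVars F.vars (F.env j).2.2 ∧
      (F.Satisfiable ↔ ∃ τ, Branch.Sat (F.env j).2.2 ([], []) τ) := by
  have hne : ∀ c ∈ F.raw, c ≠ [] := fun c hc e => h (e ▸ hc)
  refine ⟨?_, permClosed_permTriples _, tripleVars_permTriples ?_, ?_⟩
  · rw [initConfig, if_neg, CNF.env]
    rw [List.any_eq_true]
    rintro ⟨c, hc, e⟩
    exact hne c hc (List.isEmpty_iff.1 e)
  · intro t ht
    obtain ⟨c, hc, rfl⟩ := List.mem_map.1 ht
    have := toTriple_mem (hne c hc)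
    rw [mem_lits, mem_lits, mem_lits]
    exact ⟨F.raw_lt hc _ this.1, F.raw_lt hc _ this.2.1, F.raw_lt hc _ this.2.2⟩
  · rw [F.satisfiable_iff]
    refine exists_congr fun τ => ?_
    have : (∀ c ∈ F.raw, ∃ l ∈ c, Lit.Holds τ l) ↔
        ∀ t ∈ F.raw.map toTriple, Triple.Holds τ t := by
      rw [List.forall_mem_map]
      refine forall₂_congr fun c hc => (toTriple_holds (hne c hc) ?_).symm
      obtain ⟨C, hC, rfl⟩ := List.mem_map.1 hc
      simpa using hF C hC
    rw [this, ← holds_permTriples]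
    exact ⟨fun h => ⟨h, by simp, by simp⟩, fun h => h.triples⟩

/-! ## The algorithm -/

lemma size_codeNat (n : ℕ) : (codeNat n).size = 2 * n + 1 := by
  induction n with
  | zero => rfl
  | succ n ih =>
    simp only [codeNat, Data.size, ih]
    omega

lemma size_enc_pair {α β : Type} [Enc α] [Enc β] (p : α × β) :
    (enc p).size = (enc p.1).size + (enc p.2).size + 1 := rfl

lemma size_enc_list_le {α : Type} [Enc α] {B : ℕ} :
    ∀ {l : List α}, (∀ x ∈ l, (enc x).size ≤ B) → (enc l).size ≤ l.length * (B + 1) + 1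
  | [], _ => by simp [enc, Enc.code, codeList, Data.size]
  | x :: l, h => by
      have h₁ := size_enc_list_le fun y hy => h y (List.mem_cons_of_mem _ hy)
      have h₂ := h x List.mem_cons_self
      change (enc x).size + (enc l).size + 1 ≤ _
      rw [List.length_cons, add_mul]
      omega

lemma size_enc_lit_le {n : ℕ} {x : Lit} (h : x ∈ lits n) : (enc x).size ≤ 2 * n + 5 := by
  have := mem_lits.1 h
  rw [size_enc_pair]
  change (codeNat x.1).size + (codeBool x.2).size + 1 ≤ _
  rw [size_codeNat]
  cases x.2 <;> simp only [codeBool, Data.size] <;> omega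

lemma Branch.Good.size_le {n s : ℕ} {σ : Branch} (h : σ.Good n s) :
    (enc σ).size ≤ 2 * n * (2 * n + 6) + 4 * n ^ 2 * (4 * n + 12) + 3 := by
  have e₁ : σ.1.length ≤ 2 * n := by
    rw [← length_lits]
    exact (List.subperm_of_subset h.nodup h.lits_sub).length_le
  have h₁ := size_enc_list_le fun x hx => size_enc_lit_le (h.lits_sub x hx)
  have h₂ : (enc σ.2).size ≤ σ.2.length * (4 * n + 11 + 1) + 1 :=
    size_enc_list_le fun q hq => by
      have := mem_litPairs.1 (h.pairs_sub q hq)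
      have l₁ := size_enc_lit_le this.1
      have l₂ := size_enc_lit_le this.2
      rw [size_enc_pair]
      omega
  have h₃ := Nat.mul_le_mul_right (2 * n + 6) e₁
  have h₄ := Nat.mul_le_mul_right (4 * n + 12) h.length_pairs
  rw [size_enc_pair]
  simp only [Nat.reduceAdd, add_assoc] at h₁ h₂
  omega

/-- The algorithm built from programs for the initial configuration and for one step. -/
def mainProg (init body : Prog) : Prog :=
  .seq init (.seq (.loop (.hd (.var 0)) body) (.assign 0 (.tl (.tl (.var 0)))))

/-- If `p` solves the instances of arity `a` and domain size `d`, then it also solves the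
instances at the leaves. -/
lemma leavesSolved {a d : ℕ} (ha : 2 ≤ a) (hd : 3 ≤ d) {p : Prog} {f : ℕ → ℕ} {c : ℕ}
    (hp : ∀ I : CSP, I.arity = a ∧ I.dom = d → ∃ (out : Data) (t : ℕ), p.Outputs I.code out t ∧
      (out ≠ .nil ↔ I.Satisfiable) ∧ t ≤ c * I.dom ^ f I.vars * I.code.size ^ c)
    {e : Env} (hs : 2 ≤ e.1) (hT : TripleVars e.2.1 e.2.2) {X S : ℕ}
    (hX : ∀ N, e.2.1 ≤ N → N ≤ a + e.2.1 + 2 * e.2.1 * (1 + e.1 + e.1 * e.1) → d ^ f N ≤ X)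
    (hS : ∀ σ : Branch, σ.Good e.2.1 e.1 → (enc (leafInstance a d e σ)).size ≤ S) :
    LeavesSolved a d (fresh p) (p.bound + 1) e (2 * (p.bound + 1) + c * X * S ^ c) := by
  intro σ hσ hb
  have hT' : TripleVars e.2.1 (sparseClauses e.2.1 e.2.2 σ) := by
    intro t ht
    simp only [sparseClauses, List.mem_append, List.mem_map, List.mem_flatMap, nbr₂, nbrPairs,
      List.mem_filter] at ht
    rcases ht with ⟨x, hx, rfl⟩ | ⟨x, hx, y, hy, rfl⟩ | ⟨x, hx, q, hq, rfl⟩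
    · exact ⟨hσ.lits_sub x hx, hσ.lits_sub x hx, hσ.lits_sub x hx⟩
    · exact ⟨hx, hx, hy.1⟩
    · exact ⟨hx, mem_litPairs.1 hq.1⟩
  obtain ⟨I, hv, hdom, hcode, har, hsat⟩ := (formulaConstraints_valid ha hd hT').exists_csp
  rw [formulaConstraints_arity ha] at har
  obtain ⟨out, t, ho, hY, ht⟩ := hp I ⟨har, hdom⟩
  rw [hcode] at ho
  rw [hdom, hv, hcode] at ht
  have hlen := hσ.length_sparseClauses_le (by omega) hT hb
  refine (Does.of_outputs ho).mono le_rfl (fun y hy => ?_) (Nat.add_le_add_left (ht.trans ?_) _)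
  · rw [hy, hY, hsat, formulaConstraints_sat_iff hd hT']
    exact exists_congr fun τ => (hσ.sat_iff hT τ).symm
  · exact Nat.mul_le_mul (Nat.mul_le_mul_left c (hX _ (by omega) (by omega)))
      (Nat.pow_le_pow_left (hS σ hσ) c)

/-- The parameter is `s = j + 1`, so `1 ≤ j` gives `2 ≤ s`. As `f` need not be monotone, `X` has to
bound `d ^ f N` for every number of variables that a leaf instance can have. The program and the
polynomial are the same for all `j`. -/
lemma exists_algorithm {a d : ℕ} (ha : 2 ≤ a) (hd : 3 ≤ d) {p : Prog} {f : ℕ → ℕ} {c : ℕ}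
    (hp : ∀ I : CSP, I.arity = a ∧ I.dom = d → ∃ (out : Data) (t : ℕ), p.Outputs I.code out t ∧
      (out ≠ .nil ↔ I.Satisfiable) ∧ t ≤ c * I.dom ^ f I.vars * I.code.size ^ c) :
    ∃ (A : Prog) (b : ℕ) (R : Polynomial ℕ), ∀ (j : ℕ) (F : CNF) (X : ℕ), 1 ≤ j → F.WidthLE 3 →
      (∀ N, F.vars ≤ N → N ≤ a + F.vars + 2 * F.vars * (1 + (j + 1) + (j + 1) * (j + 1)) →
        d ^ f N ≤ X) →
      Does A b (.cons (codeNat j) F.code) (fun y => y ≠ .nil ↔ F.Satisfiable)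
        (nodes ((j + 1) * (j + 1) - 1) (14 * (j + 1) * F.vars) * (X + 1) *
          R.eval (Data.cons (codeNat j) F.code).size) := by
  obtain ⟨p₁, b₁, P₁, hb₁, h₁⟩ := poly_initConfig.does
  obtain ⟨p₂, b₂, P₂, hb₂, h₂⟩ := exists_body a d (fresh p) (p.bound + 1)
  obtain ⟨_, _, P₃, _, h₃⟩ := (poly_leafInstance a d).does
  -- This bounds all configurations: at most `14 * z * z + 1` stacked branches, each bounded by
  -- `Branch.Good.size_le`. The environment never changes, so `P₁` bounds it as part of the initial
  -- configuration.
  let S : Polynomial ℕ := (.C 14 * .X * .X + .C 1) *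
    (.C 2 * .X * (.C 2 * .X + .C 6) + .C 4 * .X ^ 2 * (.C 4 * .X + .C 12) + .C 3 + .C 1) + .C 4 + P₁
  let R : Polynomial ℕ := P₁ + .C 20 + .C (2 * (p.bound + 1)) + .C c * (P₃.comp S) ^ c + P₂.comp S
  refine ⟨mainProg p₁ p₂, b₁ + b₂, R, fun j F X hj hF hX => ?_⟩
  set z := (Data.cons (codeNat j) F.code).size with hz
  have hx : Data.cons (codeNat j) F.code = enc (j, F.vars, F.raw) := by
    rw [F.code_eq]
    rfl
  have hzj : 2 * j + 2 * F.vars + 2 ≤ z := by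
    rw [hz, CNF.code, Data.size, Data.size, size_codeNat, size_codeNat]
    omega
  have hR : R.eval z = P₁.eval z + 20 + 2 * (p.bound + 1) + c * (P₃.eval (S.eval z)) ^ c +
      P₂.eval (S.eval z) := by
    simp [R, Polynomial.eval_comp]
  set n₀ := nodes ((j + 1) * (j + 1) - 1) (14 * (j + 1) * F.vars) with hn₀
  have hn₁ : 1 ≤ n₀ := one_le_nodes _ _
  have dfin : ∀ (e : Env) (r : Bool), Does (.assign 0 (.tl (.tl (.var 0)))) (b₁ + b₂)
      (enc (([], e, r) : Config)) (· = enc r) 4 := fun e r =>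
    (Does.assign (e := .tl (.tl (.var 0))) (by simp [Exp.bound]) (constStore _)).mono (by omega)
      (fun y hy => hy) (by simp [Exp.cost])
  have hr : ∀ r : Bool, enc r ≠ .nil ↔ r = true := by
    intro r
    cases r <;> simp [enc, Enc.code, codeBool]
  have hdone : ∀ (b : ℕ) (e : Env), Does (.loop (.hd (.var 0)) p₂) b
      (enc (([], e, false) : Config)) (· = enc (([], e, false) : Config)) 4 := fun b e =>
    (Does.loop_done (e := .hd (.var 0)) (Q := (· = enc (([], e, false) : Config)))
      (s₀ := constStore (enc (([], e, false) : Config)))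
      (by simp [Exp.bound]) (by simp [Exp.eval, enc, Enc.code, codeList]) rfl).mono le_rfl
      (fun _ h => h) (by simp only [Exp.cost]; omega)
  have dinit := (h₁ (j, F.vars, F.raw)).1
  have sinit := (h₁ (j, F.vars, F.raw)).2
  rw [← hx] at dinit sinit
  rw [← hz] at dinit sinit
  by_cases hmem : [] ∈ F.raw
  · obtain ⟨hinit, hunsat⟩ := CNF.initConfig_of_mem j hmem
    rw [hinit] at dinit
    refine (Does.seq (dinit.mono (by omega) (fun _ h => h) le_rfl) fun y hy => by
      subst hy
      exact (hdone _ _).seq fun y hy => by subst hy; exact dfin _ false).mono le_rfl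
      (fun y hy => ?_) ?_
    · rw [hy, hr]
      simpa using hunsat
    · have h₄ : 1 * R.eval z ≤ n₀ * (X + 1) * R.eval z :=
        Nat.mul_le_mul_right _ (Nat.mul_pos hn₁ (Nat.succ_pos X))
      omega
  · obtain ⟨hinit, hperm, hT, hsat⟩ := CNF.initConfig_of_notMem j hF hmem
    rw [hinit] at dinit sinit
    have hsize : ∀ l : List Branch, l.length ≤ 14 * (j + 1) * F.vars + 1 →
        (∀ σ ∈ l, σ.Good F.vars (j + 1)) →
        (enc ((l, F.env j, false) : Config)).size ≤ S.eval z := by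
      intro l hl hg
      have s₁ := size_enc_list_le fun σ hσ => (hg σ hσ).size_le
      have s₂ : (enc (F.env j, false)).size ≤ P₁.eval z := by
        rw [size_enc_pair] at sinit
        simp only at sinit
        omega
      have s₃ : l.length ≤ 14 * z * z + 1 :=
        hl.trans (Nat.add_le_add_right (Nat.mul_le_mul (Nat.mul_le_mul_left _ (by omega))
          (by omega)) 1)
      have hnz : F.vars ≤ z := by omega
      have s₄ : 2 * F.vars * (2 * F.vars + 6) + 4 * F.vars ^ 2 * (4 * F.vars + 12) + 3 + 1 ≤
          2 * z * (2 * z + 6) + 4 * z ^ 2 * (4 * z + 12) + 3 + 1 := by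
        gcongr
      have s₅ := Nat.mul_le_mul s₃ s₄
      rw [size_enc_pair]
      simp only [S, Polynomial.eval_add, Polynomial.eval_mul, Polynomial.eval_C,
        Polynomial.eval_X, Polynomial.eval_pow]
      generalize (14 * z * z + 1) *
        (2 * z * (2 * z + 6) + 4 * z ^ 2 * (4 * z + 12) + 3 + 1) = T at s₅ ⊢
      generalize l.length * (2 * F.vars * (2 * F.vars + 6) +
        4 * F.vars ^ 2 * (4 * F.vars + 12) + 3 + 1) = U at s₁ s₅
      omega
    have hleaf : ∀ σ : Branch, σ.Good F.vars (j + 1) →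
        (enc (leafInstance a d (F.env j) σ)).size ≤ P₃.eval (S.eval z) := fun σ hσ =>
      (h₃ ([σ], F.env j, false)).2.trans
        (polyEval_mono _ (hsize [σ] (by simp) (by simpa using hσ)))
    have hLS := leavesSolved ha hd hp (e := F.env j) (X := X) (S := P₃.eval (S.eval z))
      (by simp only [CNF.env]; omega) hT hX hleaf
    have dmain := does_explore h₂ (e := F.env j) (by simp only [CNF.env]; omega) hperm hT hLS
      (L := 14 * (j + 1) * F.vars + 1) hsize
      (Q := fun y => ∃ r : Bool, y = enc (([], F.env j, r) : Config) ∧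
        (r = true ↔ F.Satisfiable)) (14 * (j + 1) * F.vars) ([], []) [] 4
      (Branch.Good.empty _ _) (Nat.le_add_left _ _) (by simp) (by simp) le_rfl
      (fun hn => (hdone b₂ (F.env j)).mono le_rfl (fun y hy => ⟨false, hy, by simpa [hsat] using hn⟩) le_rfl)
      (fun hy => ⟨true, rfl, by simpa [hsat] using hy⟩)
    rw [hinit] at *
    refine (Does.seq (dinit.mono (by omega) (fun _ h => h) le_rfl) fun y hy => by
      subst hy
      exact (dmain.mono (by omega) (fun _ h => h) le_rfl).seq fun y ⟨r, hy, hY⟩ => by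
        subst hy
        exact (dfin _ r).mono le_rfl (Q' := fun y => y ≠ .nil ↔ F.Satisfiable)
          (fun y hy => by rw [hy, hr, hY]) le_rfl).mono le_rfl (fun y hy => hy) ?_
    rw [hR]
    obtain ⟨m, hm⟩ : ∃ m, n₀ = m + 1 := ⟨n₀ - 1, by omega⟩
    have e₁ : nodes ((F.env j).1 * (F.env j).1 - 1) (14 * (j + 1) * F.vars) = m + 1 := hm
    rw [hm, e₁]
    generalize P₁.eval z = u₁
    generalize P₂.eval (S.eval z) = u₂
    generalize P₃.eval (S.eval z) ^ c = u₃
    generalize p.bound + 1 = u₄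
    -- The witness is the difference of the two sides, in the form `n₀ = m + 1`.
    refine Nat.le.intro (k := u₁ * (m * X + m + X) + (20 * m * X + 16 * m + 20 * X + 8) +
      (m + 1) * X * (2 * u₄ + u₂) + (m + 1) * c * u₃) ?_
    ring

/-! ## Subexponential bounds -/

/-- With one added, `nodes` satisfies a recursion without constant term, so `2 * x ^ w` is an upper
bound as soon as `x ^ w + x ^ (w - k) ≤ x ^ (w + 1)`, that is `1 ≤ x ^ k * (x - 1)`. For `x = 1 + 1
/ E` this is the hypothesis. -/
lemma nodes_succ_le {E k : ℕ} (hE : 1 ≤ E) (h : (E : ℝ) ≤ (1 + 1 / (E : ℝ)) ^ k) (w : ℕ) :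
    (nodes k w : ℝ) + 1 ≤ 2 * (1 + 1 / (E : ℝ)) ^ w := by
  have hE' : (0 : ℝ) < E := by exact_mod_cast hE
  set x : ℝ := 1 + 1 / (E : ℝ) with hx
  have hx₁ : 1 ≤ x := by
    rw [hx]
    have : 0 ≤ 1 / (E : ℝ) := by positivity
    linarith
  have hxE : 1 ≤ x ^ k * (x - 1) := by
    have : x - 1 = 1 / (E : ℝ) := by rw [hx]; ring
    rw [this, mul_one_div, le_div_iff₀ hE']
    linarith
  induction w using Nat.strong_induction_on with
  | _ w ih =>
  cases w with
  | zero => norm_num [nodes]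
  | succ w =>
    rw [nodes]
    split_ifs with hk
    · have h₁ := ih w (by omega)
      have h₂ := ih (w - k) (by omega)
      have h₃ : x ^ w = x ^ (w - k) * x ^ k := by rw [← pow_add, Nat.sub_add_cancel hk]
      have h₄ : 0 < x ^ (w - k) := by positivity
      have h₅ : x ^ (w - k) * 1 ≤ x ^ (w - k) * (x ^ k * (x - 1)) :=
        mul_le_mul_of_nonneg_left hxE h₄.le
      push_cast
      rw [pow_succ]
      nlinarith
    · have := one_le_pow₀ hx₁ (n := w + 1)
      push_cast
      linarith

lemma cube_lt_two_pow {q : ℕ} (hq : 10 ≤ q) : q ^ 3 + 1 ≤ 2 ^ q := by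
  induction q, hq using Nat.le_induction with
  | base => norm_num
  | succ q hq ih =>
    rw [pow_succ 2]
    nlinarith [Nat.mul_le_mul hq hq, Nat.mul_le_mul (Nat.mul_le_mul hq hq) hq]

/-- With the parameter `s = q ^ 2`, the branching tree has size `2 ^ O(n / q)`. -/
lemma nodes_le {q n : ℕ} (hq : 10 ≤ q) :
    nodes (q ^ 2 * q ^ 2 - 1) (14 * q ^ 2 * n) ≤ 2 ^ (28 * (n / q + 1) + 1) := by
  have hq₀ : 0 < q := by omega
  have hqR : (0 : ℝ) < q := by exact_mod_cast hq₀
  set x : ℝ := 1 + 1 / ((q ^ 3 : ℕ) : ℝ) with hx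
  have hE : (0 : ℝ) < ((q ^ 3 : ℕ) : ℝ) := by positivity
  have hx₀ : 0 < x := by positivity
  -- Bernoulli's inequality; raised to the power `q` it beats `q ^ 3 + 1` for `q ≥ 10`.
  have h₁ : (2 : ℝ) ≤ x ^ q ^ 3 := by
    have := one_add_mul_le_pow (a := 1 / ((q ^ 3 : ℕ) : ℝ)) (by
      have : 0 ≤ 1 / ((q ^ 3 : ℕ) : ℝ) := by positivity
      linarith) (q ^ 3)
    rw [mul_one_div, div_self hE.ne'] at this
    linarith
  have h₂ : ((q ^ 3 : ℕ) : ℝ) + 1 ≤ x ^ (q ^ 2 * q ^ 2) := by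
    have h₃ : x ^ (q ^ 2 * q ^ 2) = (x ^ q ^ 3) ^ q := by rw [← pow_mul]; ring_nf
    rw [h₃]
    refine le_trans ?_ (pow_le_pow_left₀ (by norm_num) h₁ q)
    exact_mod_cast cube_lt_two_pow hq
  -- As `q ^ 3 + 1 = q ^ 3 * x`, one factor `x` cancels; this accounts for the exponent `q ^ 2 * q ^
  -- 2 - 1`.
  have h₃ : ((q ^ 3 : ℕ) : ℝ) ≤ x ^ (q ^ 2 * q ^ 2 - 1) := by
    have e : x ^ (q ^ 2 * q ^ 2) = x ^ (q ^ 2 * q ^ 2 - 1) * x := by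
      rw [← pow_succ, Nat.sub_add_cancel (by have : 0 < q ^ 2 * q ^ 2 := by positivity
                                             omega)]
    have e' : ((q ^ 3 : ℕ) : ℝ) + 1 = ((q ^ 3 : ℕ) : ℝ) * x := by
      rw [hx, mul_add, mul_one, mul_one_div, div_self hE.ne']
    rw [e, e'] at h₂
    exact le_of_mul_le_mul_right h₂ hx₀
  have h₄ := nodes_succ_le (Nat.one_le_pow 3 q hq₀) h₃ (14 * q ^ 2 * n)
  have h₅ : x ^ (14 * q ^ 2 * n) ≤ 2 ^ (28 * (n / q + 1)) := by
    have e₁ : x ≤ Real.exp (1 / ((q ^ 3 : ℕ) : ℝ)) := by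
      rw [hx, add_comm]
      exact Real.add_one_le_exp _
    have e₂ : x ^ (14 * q ^ 2 * n) ≤ Real.exp (14 * (n / q)) := by
      refine (pow_le_pow_left₀ hx₀.le e₁ _).trans_eq ?_
      rw [← Real.exp_nat_mul]
      congr 1
      push_cast
      field_simp
    have e₃ : (14 * (n / q) : ℝ) ≤ ((14 * (n / q + 1) : ℕ) : ℝ) := by
      have : (n / q : ℝ) ≤ ((n / q : ℕ) : ℝ) + 1 := by
        rw [div_le_iff₀ hqR]
        have := Nat.lt_div_mul_add (a := n) hq₀
        have h' : n ≤ (n / q + 1) * q := by rw [add_mul]; omega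
        exact_mod_cast h'
      push_cast
      linarith
    -- The estimate `e ≤ 2 ^ 2` turns the factor 14 into 28.
    refine e₂.trans ((Real.exp_le_exp.2 e₃).trans ?_)
    rw [← mul_one ((14 * (n / q + 1) : ℕ) : ℝ), Real.exp_nat_mul]
    refine (pow_le_pow_left₀ (Real.exp_pos 1).le
      (Real.exp_one_lt_d9.le.trans (by norm_num : (2.7182818286 : ℝ) ≤ 2 ^ 2)) _).trans_eq ?_
    rw [← pow_mul]
    ring_nf
  have h₆ : ((nodes (q ^ 2 * q ^ 2 - 1) (14 * q ^ 2 * n) : ℕ) : ℝ) ≤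
      2 ^ (28 * (n / q + 1) + 1) := by
    have e : (2 : ℝ) ^ (28 * (n / q + 1) + 1) = 2 ^ (28 * (n / q + 1)) * 2 := pow_succ _ _
    rw [e]
    rw [← hx] at h₄
    linarith
  exact_mod_cast h₆

/-! ### The choice of the parameter and the final estimate -/

/-- An effective bound for a sublinear function that is valid everywhere. -/
lemma IsLittleOEff.exists_bound {f : ℕ → ℕ} (h : IsLittleOEff f fun n => n) :
    ∃ (μ : ℕ → ℕ) (K : ℕ), Computable μ ∧ Monotone μ ∧ (∀ b, ∃ n, b ≤ μ n) ∧ (∀ n, 1 ≤ μ n) ∧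
      ∀ n, f n * μ n ≤ n + K := by
  obtain ⟨-, -, μ, hc, hm, hu, n₀, hn₀⟩ := h
  obtain ⟨n₁, hn₁⟩ := hu 1
  -- The sum over the finitely many exceptional arguments serves as the additive constant `K`.
  refine ⟨fun n => max (μ n) 1, ∑ n ∈ Finset.range (max n₀ n₁), f n * max (μ n) 1,
    Primrec.nat_max.to_comp.comp hc (.const 1), fun i j hij => max_le_max (hm hij) le_rfl,
    fun b => (hu b).imp fun n hn => hn.trans (le_max_left _ _), fun n => le_max_right _ _,
    fun n => ?_⟩
  by_cases hn : n < max n₀ n₁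
  · exact (Finset.single_le_sum (f := fun n => f n * max (μ n) 1) (fun _ _ => Nat.zero_le _)
      (Finset.mem_range.2 hn)).trans (Nat.le_add_left _ _)
  · have h₁ : 1 ≤ μ n := hn₁.trans (hm (by omega))
    simp only [max_eq_left h₁]
    exact (hn₀ n (by omega)).trans (Nat.le_add_right _ _)

/-- The parameter chosen in the analysis, a slowly growing function. -/
def slow (μ : ℕ → ℕ) (n : ℕ) : ℕ := 10 + (Nat.sqrt (Nat.sqrt (Nat.sqrt (min (μ n) n))))

lemma sqrt_sqrt_sqrt_pow_le (n : ℕ) : (Nat.sqrt (Nat.sqrt (Nat.sqrt n))) ^ 8 ≤ n := by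
  have h₁ := Nat.sqrt_le' n
  have h₂ := Nat.sqrt_le' (Nat.sqrt n)
  have h₃ := Nat.sqrt_le' (Nat.sqrt (Nat.sqrt n))
  calc (Nat.sqrt (Nat.sqrt (Nat.sqrt n))) ^ 8
      = ((Nat.sqrt (Nat.sqrt (Nat.sqrt n)) ^ 2) ^ 2) ^ 2 := by ring
    _ ≤ ((Nat.sqrt (Nat.sqrt n)) ^ 2) ^ 2 := by gcongr
    _ ≤ (Nat.sqrt n) ^ 2 := by gcongr
    _ ≤ n := h₁

/-- Four powers of `q` are lost to the number of clauses at a leaf, and a fifth is needed for the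
gain `n / q`. The eighth root, three integer square roots, is more than small enough. -/
lemma slow_pow_le {μ : ℕ → ℕ} {n : ℕ} (hμ : 1 ≤ μ n) : slow μ n ^ 5 ≤ 11 ^ 5 * μ n := by
  unfold slow
  set r := Nat.sqrt (Nat.sqrt (Nat.sqrt (min (μ n) n))) with hr
  have h : r ^ 8 ≤ μ n := (sqrt_sqrt_sqrt_pow_le _).trans (min_le_left _ _)
  obtain h₀ | h₀ := r.eq_zero_or_pos
  · rw [h₀]
    omega
  · calc (10 + r) ^ 5 ≤ (11 * r) ^ 5 := Nat.pow_le_pow_left (by omega) 5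
      _ = 11 ^ 5 * r ^ 5 := mul_pow _ _ _
      _ ≤ 11 ^ 5 * r ^ 8 := Nat.mul_le_mul_left _ (Nat.pow_le_pow_right h₀ (by omega))
      _ ≤ 11 ^ 5 * μ n := Nat.mul_le_mul_left _ h

/-- The parameter is part of the input in unary, so it must be polynomial in `n`; this is the reason
for the minimum with `n` in `slow`. -/
lemma slow_sq_le (μ : ℕ → ℕ) (n : ℕ) : slow μ n ^ 2 ≤ 200 + 2 * n := by
  unfold slow
  set r := Nat.sqrt (Nat.sqrt (Nat.sqrt (min (μ n) n))) with hr
  have h : r ^ 8 ≤ n := (sqrt_sqrt_sqrt_pow_le _).trans (min_le_right _ _)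
  have h₂ : r ^ 2 ≤ n := by
    obtain h₀ | h₀ := r.eq_zero_or_pos
    · rw [h₀]
      omega
    · exact (Nat.pow_le_pow_right h₀ (by omega)).trans h
  zify at h₂ ⊢
  nlinarith [sq_nonneg ((r : ℤ) - 10)]

/-- The rate `slow μ n / (κ + 1)` absorbs the factor `κ` and works from `n = 0` on; it is unbounded
because both `μ` and the identity are. -/
lemma isLittleOEff_div_slow {μ : ℕ → ℕ} (hc : Computable μ) (hm : Monotone μ)
    (hu : ∀ b, ∃ n, b ≤ μ n) (κ : ℕ) :
    IsLittleOEff (fun n => κ * (n / slow μ n)) fun n => n := by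
  have hs : Computable (slow μ) :=
    Primrec.nat_add.to_comp.comp (.const 10) (Primrec.nat_sqrt.to_comp.comp
      (Primrec.nat_sqrt.to_comp.comp (Primrec.nat_sqrt.to_comp.comp
        (Primrec.nat_min.to_comp.comp hc .id))))
  have hsm : Monotone (slow μ) := fun i j hij => Nat.add_le_add_left (Nat.sqrt_le_sqrt
    (Nat.sqrt_le_sqrt (Nat.sqrt_le_sqrt (min_le_min (hm hij) hij)))) 10
  refine ⟨Primrec.nat_mul.to_comp.comp (.const κ) (Primrec.nat_div.to_comp.comp .id hs), .id,
    fun n => slow μ n / (κ + 1), Primrec.nat_div.to_comp.comp hs (.const (κ + 1)),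
    fun i j hij => Nat.div_le_div_right (hsm hij), fun b => ?_, 0, fun n _ => ?_⟩
  · obtain ⟨n, hn⟩ := hu ((((b * (κ + 1)) ^ 2) ^ 2) ^ 2)
    refine ⟨max n ((((b * (κ + 1)) ^ 2) ^ 2) ^ 2), (Nat.le_div_iff_mul_le (Nat.succ_pos κ)).2 ?_⟩
    refine le_trans ?_ (Nat.le_add_left _ _)
    rw [Nat.le_sqrt', Nat.le_sqrt', Nat.le_sqrt']
    exact le_min (hn.trans (hm (le_max_left _ _))) (le_max_right _ _)
  · calc κ * (n / slow μ n) * (slow μ n / (κ + 1))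
        ≤ (κ + 1) * (n / slow μ n) * (slow μ n / (κ + 1)) := by gcongr; omega
      _ = (n / slow μ n) * (slow μ n / (κ + 1) * (κ + 1)) := by ring
      _ ≤ (n / slow μ n) * slow μ n := Nat.mul_le_mul_left _ (Nat.div_mul_le_self _ _)
      _ ≤ n := Nat.div_mul_le_self _ _

/-- The exponent in the time for solving a leaf is `O(n / q)`. -/
lemma leaf_exponent_le {f μ : ℕ → ℕ} {K a n N : ℕ} (hm : Monotone μ) (hμ : ∀ n, 1 ≤ μ n)
    (hf : ∀ n, f n * μ n ≤ n + K) (hn : n ≤ N)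
    (hN : N ≤ a + n + 2 * n * (1 + slow μ n ^ 2 + slow μ n ^ 2 * slow μ n ^ 2)) :
    f N ≤ 11 ^ 5 * (a + K + 7) * (n / slow μ n + 1) := by
  have h₁ := slow_pow_le (hμ n)
  have hq : 10 ≤ slow μ n := Nat.le_add_right _ _
  set q := slow μ n with hqdef
  have hq4 : 1 ≤ q ^ 4 := Nat.one_le_pow _ _ (by omega)
  have hq2 : q ^ 2 ≤ q ^ 4 := Nat.pow_le_pow_right (by omega) (by omega)
  have h₂ : f N * μ n ≤ (a + K + 7 * n) * q ^ 4 := by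
    -- Monotonicity of `μ` replaces `μ N` by `μ n`, so that `q` depends on the formula only and not
    -- on the leaf.
    have e₁ : f N * μ n ≤ N + K := (Nat.mul_le_mul_left _ (hm hn)).trans (hf N)
    have e₂ : q ^ 2 * q ^ 2 = q ^ 4 := by ring
    rw [e₂] at hN
    nlinarith [Nat.mul_le_mul_left n hq4, Nat.mul_le_mul_left n hq2,
      Nat.mul_le_mul_left (a + K) hq4]
  have h₃ : f N * q ≤ 11 ^ 5 * (a + K + 7 * n) := by
    have : f N * q * q ^ 4 ≤ 11 ^ 5 * (a + K + 7 * n) * q ^ 4 := by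
      calc f N * q * q ^ 4 = f N * q ^ 5 := by ring
        _ ≤ f N * (11 ^ 5 * μ n) := Nat.mul_le_mul_left _ h₁
        _ = 11 ^ 5 * (f N * μ n) := by ring
        _ ≤ 11 ^ 5 * ((a + K + 7 * n) * q ^ 4) := Nat.mul_le_mul_left _ h₂
        _ = _ := by ring
    exact Nat.le_of_mul_le_mul_right this (by omega)
  have h₄ : n ≤ (n / q + 1) * q := by
    have := Nat.lt_div_mul_add (a := n) (show 0 < q by omega)
    rw [add_mul]
    omega
  refine Nat.le_of_mul_le_mul_right (h₃.trans ?_) (show 0 < q by omega)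
  have h₅ : a + K ≤ (a + K) * ((n / q + 1) * q) :=
    Nat.le_mul_of_pos_right _ (Nat.mul_pos (Nat.succ_pos _) (by omega))
  calc 11 ^ 5 * (a + K + 7 * n)
      ≤ 11 ^ 5 * ((a + K) * ((n / q + 1) * q) + 7 * ((n / q + 1) * q)) := by gcongr
    _ = _ := by ring

lemma solvable_of_csp {a d : ℕ} (ha : 2 ≤ a) (hd : 3 ≤ d)
    (h : CSPSolvableInSubexpTime fun I => I.arity = a ∧ I.dom = d) :
    SolvableInSubexpTime (CNF.WidthLE 3) CNF.Satisfiable CNF.code CNF.vars fun _ => 2 := by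
  obtain ⟨p, f, c, hf, hp⟩ := h
  obtain ⟨A, b, R, hA⟩ := exists_algorithm ha hd hp
  obtain ⟨μ, K, hc, hm, hu, hμ, hfμ⟩ := hf.exists_bound
  -- The constant `β` comes from the leaf exponent. In `Γ`, the number 30 covers `28 * (m + 1) + 1`
  -- from the tree and one more factor 2 from `X + 1`; the cube in `does_searchProg` later gives `3
  -- * Γ`.
  let β : ℕ := 11 ^ 5 * (a + K + 7)
  let Γ : ℕ := 30 + d * β
  let T : Polynomial ℕ := R + .X + .C 4
  -- The factor `2 ^ (3 * Γ)` absorbs the difference between `m + 1` and `m = n / q` in the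
  -- exponent.
  let W : Polynomial ℕ :=
    .C ((clockedFactor A + 300) * 2 ^ (3 * Γ)) * (T.comp (.C 5 * .X + .C 400)) ^ 3
  obtain ⟨c', hc'⟩ := exists_pow_bound W
  refine ⟨searchProg A, fun n => 3 * Γ * (n / slow μ n), c', isLittleOEff_div_slow hc hm hu _,
    fun F hF => ?_⟩
  -- For a general parameter only termination with a correct answer matters, so the crude sum of all
  -- `d ^ f N` in the range serves as `X`.
  have hall : ∀ j, 1 ≤ j → ∃ t, Does A b (.cons (codeNat j) F.code)
      (fun y => y ≠ .nil ↔ F.Satisfiable) t := fun j hj =>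
    ⟨_, hA j F (∑ N ∈ Finset.range
      (a + F.vars + 2 * F.vars * (1 + (j + 1) + (j + 1) * (j + 1)) + 1), d ^ f N) hj hF
      fun N _ hN => Finset.single_le_sum (f := fun N => d ^ f N) (fun _ _ => Nat.zero_le _)
        (Finset.mem_range.2 (by omega))⟩
  set n := F.vars with hn
  have hq : 10 ≤ slow μ n := Nat.le_add_right _ _
  have hqn := slow_sq_le μ n
  set q := slow μ n with hqdef
  set m := n / q with hmdef
  have hq2 : 100 ≤ q ^ 2 := Nat.pow_le_pow_left hq 2
  have hj : q ^ 2 - 1 + 1 = q ^ 2 := by omega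
  -- The algorithm adds one to its parameter, so this yields `s = q ^ 2`. The base `d` is replaced
  -- by `2 ^ d` to obtain a power of 2.
  have hAq := hA (q ^ 2 - 1) F (2 ^ (d * (β * (m + 1)))) (by omega) hF (fun N hN hN' => by
    rw [hj] at hN'
    calc d ^ f N ≤ (2 ^ d) ^ f N := Nat.pow_le_pow_left Nat.lt_two_pow_self.le _
      _ = 2 ^ (d * f N) := (pow_mul _ _ _).symm
      _ ≤ _ := Nat.pow_le_pow_right (by omega)
        (Nat.mul_le_mul_left _ (leaf_exponent_le hm hμ hfμ hN hN')))
  rw [hj] at hAq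
  obtain ⟨y, t, ho, hy, ht⟩ := (does_searchProg hall (by omega) hAq).outputs
  refine ⟨y, t, ho, hy, ht.trans ?_⟩
  set z := (Data.cons (codeNat (q ^ 2 - 1)) F.code).size with hz
  have hsize : 2 * n + 1 ≤ F.code.size := by
    rw [CNF.code, Data.size, size_codeNat]
    omega
  have hz₁ : 2 * (q ^ 2 - 1) + 1 ≤ z := by
    rw [hz, Data.size, size_codeNat]
    omega
  have hz₂ : z ≤ 5 * F.code.size + 400 := by
    rw [hz, Data.size, size_codeNat]
    omega
  have hnodes : nodes (q ^ 2 * q ^ 2 - 1) (14 * q ^ 2 * n) ≤ 2 ^ (28 * (m + 1) + 1) := nodes_le hq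
  have hX : 2 ^ (d * (β * (m + 1))) + 1 ≤ 2 ^ (d * (β * (m + 1)) + 1) := by
    have e : 2 ^ (d * (β * (m + 1)) + 1) = 2 ^ (d * (β * (m + 1))) * 2 := pow_succ _ _
    rw [e, mul_two]
    exact Nat.add_le_add_left Nat.one_le_two_pow _
  have hT₀ : nodes (q ^ 2 * q ^ 2 - 1) (14 * q ^ 2 * n) * (2 ^ (d * (β * (m + 1))) + 1) ≤
      2 ^ (Γ * (m + 1)) := by
    refine (Nat.mul_le_mul hnodes hX).trans ?_
    rw [← pow_add]
    refine Nat.pow_le_pow_right (by omega) ?_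
    have : Γ * (m + 1) = 30 * (m + 1) + d * (β * (m + 1)) := by
      simp only [Γ]
      ring
    rw [this]
    linarith [Nat.zero_le m]
  set N₀ := nodes (q ^ 2 * q ^ 2 - 1) (14 * q ^ 2 * n) * (2 ^ (d * (β * (m + 1))) + 1) with hN₀
  have hsum : N₀ * R.eval z + (q ^ 2 - 1) + 4 ≤ 2 ^ (Γ * (m + 1)) * T.eval z := by
    have e₁ := Nat.mul_le_mul_right (R.eval z) hT₀
    have e₂ := Nat.le_mul_of_pos_left (z + 4) (Nat.two_pow_pos (Γ * (m + 1)))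
    have e₃ : T.eval z = R.eval z + (z + 4) := by simp [T, add_assoc]
    rw [e₃, mul_add]
    omega
  have hTz : T.eval z ≤ T.eval (5 * F.code.size + 400) := polyEval_mono _ hz₂
  calc (clockedFactor A + 300) * (N₀ * R.eval z + (q ^ 2 - 1) + 4) ^ 3
      ≤ (clockedFactor A + 300) *
          (2 ^ (Γ * (m + 1)) * T.eval (5 * F.code.size + 400)) ^ 3 :=
        Nat.mul_le_mul_left _ (Nat.pow_le_pow_left
          (hsum.trans (Nat.mul_le_mul_left _ hTz)) 3)
    _ = 2 ^ (3 * Γ * m) * W.eval F.code.size := by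
        simp only [W, Polynomial.eval_mul, Polynomial.eval_C, Polynomial.eval_pow,
          Polynomial.eval_comp, Polynomial.eval_add, Polynomial.eval_X]
        rw [mul_pow, ← pow_mul, show Γ * (m + 1) * 3 = 3 * Γ * m + 3 * Γ by ring, pow_add]
        ring
    _ ≤ 2 ^ (3 * Γ * m) * (c' * F.code.size ^ c') :=
        Nat.mul_le_mul_left _ (hc' _ (Data.one_le_size _))
    _ = c' * 2 ^ (3 * Γ * m) * F.code.size ^ c' := by ring

end SubexpCSP

theorem mainTheorem11 (hETH : SubexpCSP.ETH) (a d : ℕ) (ha : 2 ≤ a) (hd : 3 ≤ d) :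
    ¬ SubexpCSP.CSPSolvableInSubexpTime (fun I => I.arity = a ∧ I.dom = d) :=
  fun h => hETH 3 le_rfl (SubexpCSP.solvable_of_csp ha hd h)
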